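/- \textbf{Setting.} A weighted graph $G=(V,E,\ell)$ is a finite undirected graph without loops or parallel edges, with lengths $\ell:E\to\mathbb{R}_{\ge 0}$. Edge sets $F\subseteq E$ below are multi-sets, $\ell(F)$ counts multiplicities, and $\mathrm{odd}(F)$ is the set of vertices of odd degree in $(V,F)$. For $T\subseteq V$, a $T$-join is a multi-set $F\subseteq E$ with $\mathrm{odd}(F)=T$. A TSP tour in $G$ is a multi-set $F\subseteq E$ such that $(V,F)$ is connected and $\mathrm{odd}(F)=\emptyset$. An interface of $G$ is a triple $\Phi=(I,T,\mathcal{C})$ with $T\subseteq I\subseteq V$, $|T|$ even, and $\mathcal{C}$ a partition of $I$. A $\Phi$-tour in $G$ is a multi-set $F\subseteq E$ such that (i) $\mathrm{odd}(F)=T$, (ii) the graph $(V,F)/I$ obtained from $(V,F)$ by contracting $I$ is connected (with $(V,F)/\emptyset=(V,F)$), and (iii) for each $C\in\mathcal{C}$, all vertices of $C$ lie in the same connected component of $(V,F)$. The interface $\Phi$ is feasible if $G$ admits a $\Phi$-tour. An $\alpha$-approximation algorithm $\mathcal{A}$ for TSP computes, for every connected weighted graph, a TSP tour of length at most $\alpha$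 times the minimum length of a TSP tour; its running time is not restricted, and $f_{\mathcal{A}}(G)$ denotes the maximum running time of $\mathcal{A}$ on a TSP instance (that is, a connected graph) that is a subgraph of $G$. Running times are numbers of steps on a unit-cost pointer machine with arithmetic operations and comparisons of real numbers; a call of $\mathcal{A}$ as a subroutine is charged the number of steps that $\mathcal{A}$ makes. \textbf{Theorem.} There are an algorithm that uses a TSP algorithm as a subroutine, and an absolute constant $c>0$, such that the following holds. Let $\alpha>1$ and let the subroutine be an $\alpha$-approximation algorithm $\mathcal{A}$ for TSP. Then, for any $\delta>0$, any weighted graph $G=(V,E,\ell)$ and any feasible interface $\Phi=(I,T,\mathcal{C})$ of $G$, the algorithm, given $(G,\Phi,\delta)$, computes a $\Phi$-tour $F$ in $G$ with $$\ell(F)\ \le\ (1+\delta)\cdot\alpha\cdot\ell(\mathrm{OPT})+(\alpha+1)\cdot\ell(J)$$ in time at most $$c\cdot|V|^{\,c\left(1+\frac{|I|}{\delta}\right)}\cdot f_{\mathcal{A}}(G),$$ where $J$ is a shortest $T$-join in $G$ and $\mathrm{OPT}$ is a shortest $\Phi$-tour in $G$ (both exist). -/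

import Mathlib

open scoped NNReal

namespace PhiTSP

/-! ## Weighted graphs, interfaces and tours -/

/-- A finite weighted graph `(V, E, ℓ)` without loops or parallel edges, with non-negative edge
lengths. Vertices are named by natural numbers; the values of `len` outside `E` play no role. -/
structure WGraph where
  V : Finset ℕ
  E : Finset (Sym2 ℕ)
  ends : ∀ e ∈ E, ∀ v ∈ e, v ∈ V
  loopless : ∀ e ∈ E, ¬ e.IsDiag
  len : Sym2 ℕ → ℝ≥0

/-- `H` is a subgraph of `G`, with the same edge lengths. -/
def WGraph.IsSubgraph (H G : WGraph) : Prop :=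
  H.V ⊆ G.V ∧ H.E ⊆ G.E ∧ ∀ e ∈ H.E, H.len e = G.len e

/-- The total length `ℓ(F)` of a multi-set of edges, counted with multiplicity. -/
noncomputable def WGraph.length (G : WGraph) (F : Multiset (Sym2 ℕ)) : ℝ :=
  (F.map fun e => (G.len e : ℝ)).sum

/-- The graph `(V, F)` (parallel edges are irrelevant for connectivity). -/
def WGraph.graphOf (G : WGraph) (F : Multiset (Sym2 ℕ)) : SimpleGraph G.V where
  Adj u v := u ≠ v ∧ s((u : ℕ), (v : ℕ)) ∈ F
  symm := ⟨fun _ _ h => ⟨h.1.symm, by rw [Sym2.eq_swap]; exact h.2⟩⟩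
  loopless := ⟨fun _ h => h.1 rfl⟩

/-- `G` is connected (in particular it has a vertex). -/
def WGraph.Connected (G : WGraph) : Prop := (G.graphOf G.E.val).Connected

/-- `odd(F)`: the vertices of odd degree in `(V, F)`; edges here are never loops. -/
def WGraph.odd (G : WGraph) (F : Multiset (Sym2 ℕ)) : Finset ℕ :=
  G.V.filter fun v => Odd (F.countP fun e => v ∈ e)

/-- `F` is a multi-set of edges of `G`. -/
def WGraph.IsEdgeMultiset (G : WGraph) (F : Multiset (Sym2 ℕ)) : Prop :=
  ∀ e ∈ F, e ∈ G.E

/-- `F` is a `T`-join in `G`. -/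
def WGraph.IsTJoin (G : WGraph) (T : Finset ℕ) (F : Multiset (Sym2 ℕ)) : Prop :=
  G.IsEdgeMultiset F ∧ G.odd F = T

/-- `F` is a TSP tour in `G`, as a multi-set of edges. -/
def WGraph.IsTSPTour (G : WGraph) (F : Multiset (Sym2 ℕ)) : Prop :=
  G.IsEdgeMultiset F ∧ (G.graphOf F).Connected ∧ G.odd F = ∅

/-- The equivalence relation that identifies all the vertices of `I` with each other. -/
def contractSetoid (V I : Finset ℕ) : Setoid V where
  r u v := u = v ∨ ((u : ℕ) ∈ I ∧ (v : ℕ) ∈ I)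
  iseqv := by
    refine ⟨fun _ => Or.inl rfl, ?_, ?_⟩
    · rintro u v (h | h)
      · exact Or.inl h.symm
      · exact Or.inr ⟨h.2, h.1⟩
    · rintro u v w (rfl | h) (rfl | h')
      · exact Or.inl rfl
      · exact Or.inr h'
      · exact Or.inr h
      · exact Or.inr ⟨h.1, h'.2⟩

/-- The graph `(V, F) / I` obtained from `(V, F)` by contracting the vertex set `I`
(it is `(V, F)` itself when `I = ∅`). -/
def WGraph.contract (G : WGraph) (F : Multiset (Sym2 ℕ)) (I : Finset ℕ) :
    SimpleGraph (Quotient (contractSetoid G.V I)) :=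
  SimpleGraph.fromRel fun a b => ∃ u v : G.V,
    Quotient.mk (contractSetoid G.V I) u = a ∧ Quotient.mk (contractSetoid G.V I) v = b ∧
      (G.graphOf F).Adj u v

/-- An interface `Φ = (I, T, 𝒞)` of `G`. -/
structure Interface (G : WGraph) where
  I : Finset ℕ
  T : Finset ℕ
  T_subset : T ⊆ I
  I_subset : I ⊆ G.V
  even_T : Even T.card
  C : Finpartition I

/-- `F` is a `Φ`-tour in `G`. -/
def IsPhiTour (G : WGraph) (Φ : Interface G) (F : Multiset (Sym2 ℕ)) : Prop :=
  G.IsTJoin Φ.T F ∧ (G.contract F Φ.I).Connected ∧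
    ∀ C ∈ Φ.C.parts, ∀ u v : G.V, (u : ℕ) ∈ C → (v : ℕ) ∈ C → (G.graphOf F).Reachable u v

/-- The interface `Φ` is feasible: `G` admits a `Φ`-tour. -/
def Feasible (G : WGraph) (Φ : Interface G) : Prop := ∃ F, IsPhiTour G Φ F

/-- `F` is a shortest multi-set of edges among those satisfying `P`. -/
def WGraph.IsShortest (G : WGraph) (P : Multiset (Sym2 ℕ) → Prop) (F : Multiset (Sym2 ℕ)) : Prop :=
  P F ∧ ∀ F', P F' → G.length F ≤ G.length F'

/-! ## The model of computation

A unit-cost pointer machine with real arithmetic: values are binary trees whose leaves are `nil`,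
identifiers (atoms) or real numbers; programs are finite terms built from unit-cost primitive
operations, composition, branching, while-loops and calls of one subroutine. The only numerical
constants of a program are `0` and `1`. -/

/-- The values on which programs operate. -/
inductive Data : Type
  | nil : Data
  | atom : ℕ → Data
  | num : ℝ → Data
  | pair : Data → Data → Data

/-- The truth values: `nil` is false, and `pair nil nil` is used for true. -/
noncomputable def Data.ofProp (p : Prop) : Data :=
  open Classical in if p then Data.pair Data.nil Data.nil else Data.nil

/-- The primitive operations. -/
inductive Prim : Type
  | id | nil | zero | one
  | fst | snd
  | isPair | isAtom | isNum
  | eqAtom | leAtom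
  | add | sub | mul | div | leNum

/-- The effect of a primitive operation (the result is `nil` on operands of the wrong kind). -/
noncomputable def Prim.apply : Prim → Data → Data
  | .id, x => x
  | .nil, _ => .nil
  | .zero, _ => .num 0
  | .one, _ => .num 1
  | .fst, .pair x _ => x
  | .snd, .pair _ y => y
  | .isPair, .pair _ _ => .ofProp True
  | .isAtom, .atom _ => .ofProp True
  | .isNum, .num _ => .ofProp True
  | .eqAtom, .pair (.atom a) (.atom b) => .ofProp (a = b)
  | .leAtom, .pair (.atom a) (.atom b) => .ofProp (a ≤ b)
  | .add, .pair (.num x) (.num y) => .num (x + y)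
  | .sub, .pair (.num x) (.num y) => .num (x - y)
  | .mul, .pair (.num x) (.num y) => .num (x * y)
  | .div, .pair (.num x) (.num y) => .num (x / y)
  | .leNum, .pair (.num x) (.num y) => .ofProp (x ≤ y)
  | _, _ => .nil

/-- Programs. -/
inductive Code : Type
  /-- a primitive operation -/
  | prim : Prim → Code
  /-- `pair f g` maps `x` to the pair of `f x` and `g x` -/
  | pair : Code → Code → Code
  /-- `comp g f` maps `x` to `g (f x)` -/
  | comp : Code → Code → Code
  /-- `ite p f g` maps `x` to `f x` if `p x` is not `nil`, and to `g x` otherwise -/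
  | ite : Code → Code → Code → Code
  /-- `loop p f` replaces `x` by `f x` as long as `p x` is not `nil` -/
  | loop : Code → Code → Code
  /-- a call of the subroutine -/
  | call : Code

/-- `Eval sub c x y t`: on input `x`, the program `c` halts with output `y` after `t` steps.
Here `sub a b s` says that the subroutine, on input `a`, halts with output `b` after `s` steps;
these `s` steps are charged for a call. -/
inductive Eval (sub : Data → Data → ℕ → Prop) : Code → Data → Data → ℕ → Prop
  | prim (p : Prim) (x : Data) : Eval sub (.prim p) x (p.apply x) 1
  | pair {f g : Code} {x y z : Data} {s t : ℕ} :
      Eval sub f x y s → Eval sub g x z t → Eval sub (.pair f g) x (.pair y z) (s + t + 1)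
  | comp {f g : Code} {x y z : Data} {s t : ℕ} :
      Eval sub f x y s → Eval sub g y z t → Eval sub (.comp g f) x z (s + t + 1)
  | ite_true {p f g : Code} {x y z : Data} {s t : ℕ} :
      Eval sub p x y s → y ≠ .nil → Eval sub f x z t → Eval sub (.ite p f g) x z (s + t + 1)
  | ite_false {p f g : Code} {x z : Data} {s t : ℕ} :
      Eval sub p x .nil s → Eval sub g x z t → Eval sub (.ite p f g) x z (s + t + 1)
  | loop_done {p f : Code} {x : Data} {s : ℕ} :
      Eval sub p x .nil s → Eval sub (.loop p f) x x (s + 1)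
  | loop_step {p f : Code} {x y z w : Data} {r s t : ℕ} :
      Eval sub p x y r → y ≠ .nil → Eval sub f x z s → Eval sub (.loop p f) z w t →
        Eval sub (.loop p f) x w (r + s + t + 1)
  | call {x y : Data} {t : ℕ} : sub x y t → Eval sub .call x y (t + 1)

/-- A program has at most one output and one number of steps on each input, provided that its
subroutine does. -/
theorem Eval.unique {sub : Data → Data → ℕ → Prop}
    (hsub : ∀ x y y' t t', sub x y t → sub x y' t' → y = y' ∧ t = t')
    {c : Code} {x y y' : Data} {t t' : ℕ}
    (h : Eval sub c x y t) (h' : Eval sub c x y' t') : y = y' ∧ t = t' := by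
  induction h generalizing y' t' with
  | prim p x => cases h'; exact ⟨rfl, rfl⟩
  | pair _ _ ih₁ ih₂ =>
    cases h' with
    | pair a b =>
      obtain ⟨rfl, rfl⟩ := ih₁ a
      obtain ⟨rfl, rfl⟩ := ih₂ b
      exact ⟨rfl, rfl⟩
  | comp _ _ ih₁ ih₂ =>
    cases h' with
    | comp a b =>
      obtain ⟨rfl, rfl⟩ := ih₁ a
      obtain ⟨rfl, rfl⟩ := ih₂ b
      exact ⟨rfl, rfl⟩
  | ite_true _ hy _ ih₁ ih₂ =>
    cases h' with
    | ite_true a _ b =>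
      obtain ⟨rfl, rfl⟩ := ih₁ a
      obtain ⟨rfl, rfl⟩ := ih₂ b
      exact ⟨rfl, rfl⟩
    | ite_false a _ => exact absurd (ih₁ a).1 hy
  | ite_false _ _ ih₁ ih₂ =>
    cases h' with
    | ite_true a hy _ => exact absurd (ih₁ a).1.symm hy
    | ite_false a b =>
      obtain ⟨_, rfl⟩ := ih₁ a
      obtain ⟨rfl, rfl⟩ := ih₂ b
      exact ⟨rfl, rfl⟩
  | loop_done _ ih =>
    cases h' with
    | loop_done a => obtain ⟨_, rfl⟩ := ih a; exact ⟨rfl, rfl⟩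
    | loop_step a hy _ _ => exact absurd (ih a).1.symm hy
  | loop_step _ hy _ _ ih₁ ih₂ ih₃ =>
    cases h' with
    | loop_done a => exact absurd (ih₁ a).1 hy
    | loop_step a _ b d =>
      obtain ⟨rfl, rfl⟩ := ih₁ a
      obtain ⟨rfl, rfl⟩ := ih₂ b
      obtain ⟨rfl, rfl⟩ := ih₃ d
      exact ⟨rfl, rfl⟩
  | call hs =>
    cases h' with
    | call hs' =>
      obtain ⟨rfl, rfl⟩ := hsub _ _ _ _ _ hs hs'
      exact ⟨rfl, rfl⟩

/-- `Runs A x y t`: the stand-alone program `A` (no subroutine is available to it) halts on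
input `x` with output `y` after `t` steps. -/
def Runs (A : Code) : Data → Data → ℕ → Prop := Eval (fun _ _ _ => False) A

/-- `RunsWith A P x y t`: the program `P`, with `A` as its subroutine, halts on input `x` with
output `y` after `t` steps, including the steps of `A` in all the calls. -/
def RunsWith (A P : Code) : Data → Data → ℕ → Prop := Eval (Runs A) P

/-! ## Encoding of the instances and of the solutions -/

/-- Lists as nested pairs that end in `nil`. -/
def Data.ofList : List Data → Data
  | [] => .nil
  | x :: l => .pair x (Data.ofList l)

/-- A finite set of vertices, as its increasing list. -/
def Data.ofVertices (S : Finset ℕ) : Data :=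
  Data.ofList ((S.sort (· ≤ ·)).map Data.atom)

/-- The edges of `G`, each once, as pairs `(u, v)` with `u < v`, in lexicographic order. -/
def WGraph.edgeList (G : WGraph) : List (ℕ × ℕ) :=
  ((G.V.sort (· ≤ ·)).product (G.V.sort (· ≤ ·))).filter
    fun p => p.1 < p.2 ∧ s(p.1, p.2) ∈ G.E

/-- A weighted graph: the list of its vertices and the list of its edges `(u, (v, ℓ(uv)))`. -/
noncomputable def WGraph.encode (G : WGraph) : Data :=
  .pair (Data.ofVertices G.V)
    (Data.ofList (G.edgeList.map fun p =>
      .pair (.atom p.1) (.pair (.atom p.2) (.num (G.len s(p.1, p.2))))))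

/-- The parts of the partition `𝒞`, each once, ordered by their least elements. -/
def Interface.partList {G : WGraph} (Φ : Interface G) : List (Finset ℕ) :=
  ((Φ.I.sort (· ≤ ·)).filter fun i => ∀ j ∈ Φ.C.part i, i ≤ j).map fun i => Φ.C.part i

/-- An interface: the list of `I`, the list of `T`, and the list of the parts of `𝒞`. -/
def Interface.encode {G : WGraph} (Φ : Interface G) : Data :=
  .pair (Data.ofVertices Φ.I)
    (.pair (Data.ofVertices Φ.T) (Data.ofList (Φ.partList.map Data.ofVertices)))

/-- A weighted graph, an interface and an accuracy parameter, as the input of a program. -/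
noncomputable def encodeInput (G : WGraph) (Φ : Interface G) (δ : ℝ) : Data :=
  .pair G.encode (.pair Φ.encode (.num δ))

/-- `d` is a list of edges that represents the multi-set `F`, in any order, where each copy of
an edge `uv` is written as `(u, v)` or as `(v, u)`. -/
def Represents (d : Data) (F : Multiset (Sym2 ℕ)) : Prop :=
  ∃ l : List (ℕ × ℕ),
    d = Data.ofList (l.map fun p => .pair (.atom p.1) (.atom p.2)) ∧
      F = (l.map fun p => s(p.1, p.2) : List (Sym2 ℕ))

/-! ## Approximation algorithms for TSP -/

/-- `A` is an `α`-approximation algorithm for TSP: on every connected weighted graph it halts with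
a tour that is at most `α` times as long as any tour. No bound on its running time is imposed. -/
def IsTSPApprox (α : ℝ) (A : Code) : Prop :=
  ∀ G : WGraph, G.Connected → ∃ (d : Data) (t : ℕ) (F : Multiset (Sym2 ℕ)),
    Runs A G.encode d t ∧ Represents d F ∧ G.IsTSPTour F ∧
      ∀ F', G.IsTSPTour F' → G.length F ≤ α * G.length F'

/-- `f_A(G)`: the maximum running time of `A` on a TSP instance that is a subgraph of `G`. -/
noncomputable def maxTime (A : Code) (G : WGraph) : ℕ :=
  sSup {t | ∃ (H : WGraph) (d : Data), H.IsSubgraph G ∧ H.Connected ∧ Runs A H.encode d t}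

end PhiTSP

/-!
The program guesses a part of a shortest tour `OPT` for the interface and completes it by means of
the TSP algorithm. It first enumerates

* a set `S` of at most `8 |I| / δ` edges, meant to be the edges of `OPT` above a threshold `r`,
* an edge that fixes the threshold, meant to be the longest edge of length at most `r`,
* if `δ < 6`, at most `|T|` pairs of vertices of `T`, meant to be joined by a shortest `T`-join.

The edges of `S`, the edges up to the threshold and shortest walks `L` between the guessed pairs
form a graph `H`. In each connected component of `H` the TSP algorithm finds a tour; their union is
`K`. Adding an edge set with odd vertices `T` yields a candidate, and the program outputs the
shortest candidate that is a tour for the interface.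

For the right guess, `H` contains `OPT`, so that `K` connects everything that `OPT` connects
(`isPhiTour_append`). Conversely, every vertex is connected by `OPT` to one of the `|I|` vertices of
the interface (or else `OPT` is connected), so at most `|I|` further edges `Y` of `H` connect in
`OPT + L + Y` what is connected in `H` (`exists_connecting`). These edges belong neither to `OPT`
nor to `L`, hence are not above the threshold, and the choice of the threshold gives
`8 ℓ(Y) ≤ δ ℓ(OPT)` (`exists_threshold`, `exists_guess`). If `δ < 6`, then `OPT + L + 2 Y` is even,
its parts in the components of `H` are tours, so that `ℓ(K) ≤ α (ℓ(OPT) + ℓ(L) + 2 ℓ(Y))`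
(`tours_spec`), and `L` itself corrects the parities. It is as short as a `T`-join because a
`T`-join contains walks that pair up `T` (`exists_pairing`). If `δ ≥ 6`, then `2 OPT + 2 Y` takes
the role of `OPT + L + 2 Y`, and the parities are corrected by a subset of `K`, the sum modulo two
of walks from a root of each component to the vertices of `T` (`deg_treeWalks`); the total is at
most `2 α (2 + δ / 4) ℓ(OPT) ≤ (1 + δ) α ℓ(OPT)`. Both cases are joined in `exists_candidate`, and
`solve_spec` states that the output is correct.

The running time is controlled by the relation `Comp p x y`: one program computes `y i` from `x i`
for all `i`, in time polynomial in a parameter `B` times the maximum running time `M` of the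
subroutine, and `y i` has polynomial size. It is closed under the usual operations on lists, and
`Comp.solve` is obtained by following the definition of the algorithm. The parameter `B` is a power
of `|V|` that bounds the number of guesses, with an exponent of the order `1 + |I| / δ`
(`Problem.exponent_le`). The subroutine may output long lists, but not longer than the height of its
input plus its running time (`IsTSPApprox.callable`), and such a list is only scanned by a loop that
makes no calls, so that the factor `M` enters linearly.
-/

namespace PhiTSP

/-! ### Values and their sizes -/

/-- The number of nodes of a value. -/
def Data.size : Data → ℕ
  | .pair x y => x.size + y.size + 1
  | _ => 1

/-- Types whose elements are represented by values of the machine. -/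
class Enc (β : Type) where
  /-- the value that represents an element -/
  enc : β → Data

open Enc

instance : Enc ℕ := ⟨Data.atom⟩
instance : Enc ℝ := ⟨Data.num⟩
instance : Enc Bool := ⟨fun b => if b then .pair .nil .nil else .nil⟩
instance {α β : Type} [Enc α] [Enc β] : Enc (α × β) := ⟨fun q => .pair (enc q.1) (enc q.2)⟩
instance {α : Type} [Enc α] : Enc (List α) := ⟨fun l => Data.ofList (l.map enc)⟩

section size
variable {α β : Type} [Enc α] [Enc β]

@[simp] theorem enc_nat (a : ℕ) : enc a = .atom a := rfl
@[simp] theorem enc_real (a : ℝ) : enc a = .num a := rfl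
@[simp] theorem enc_true : enc true = .pair .nil .nil := rfl
@[simp] theorem enc_false : enc false = .nil := rfl
@[simp] theorem enc_prod (a : α) (b : β) : enc (a, b) = .pair (enc a) (enc b) := rfl
@[simp] theorem enc_nil : enc ([] : List α) = .nil := rfl
@[simp] theorem enc_cons (a : α) (l : List α) : enc (a :: l) = .pair (enc a) (enc l) := rfl

theorem size_prod (q : α × β) : (enc q).size = (enc q.1).size + (enc q.2).size + 1 := rfl

theorem size_bool_le (b : Bool) : (enc b).size ≤ 3 := by cases b <;> simp [Data.size]

theorem size_append (l l' : List α) : (enc (l ++ l')).size + 1 = (enc l).size + (enc l').size := by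
  induction l with
  | nil => simp [Data.size]; omega
  | cons a l ih => simp [Data.size] at ih ⊢; omega

theorem length_lt_size (l : List α) : l.length < (enc l).size := by
  induction l with
  | nil => simp [Data.size]
  | cons a l ih => simp [Data.size]; omega

theorem size_mem_le {l : List α} {a : α} (h : a ∈ l) : (enc a).size ≤ (enc l).size := by
  induction l with
  | nil => simp at h
  | cons b l ih =>
    rcases List.mem_cons.1 h with rfl | h
    · simp [Data.size]; omega
    · have := ih h; simp [Data.size]; omega

theorem size_list_le {l : List α} {s : ℕ} (h : ∀ a ∈ l, (enc a).size ≤ s) :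
    (enc l).size ≤ l.length * (s + 1) + 1 := by
  induction l with
  | nil => simp [Data.size]
  | cons b l ih =>
    have h1 := ih fun a ha => h a (List.mem_cons_of_mem _ ha)
    have h2 := h b (by simp)
    simp only [enc_cons, Data.size, List.length_cons, add_mul, one_mul]; omega

theorem size_sublist_le {l l' : List α} (h : l.Sublist l') : (enc l).size ≤ (enc l').size := by
  induction h with
  | slnil => rfl
  | cons a _ ih => simp [Data.size]; omega
  | cons_cons a _ ih => simp [Data.size]; omega

theorem size_flatMap_le {κ : Type} {l : List κ} {f : κ → List β} {s : ℕ}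
    (h : ∀ a ∈ l, (enc (f a)).size ≤ s) : (enc (l.flatMap f)).size ≤ l.length * s + 1 := by
  induction l with
  | nil => simp [Data.size]
  | cons b l ih =>
    have h1 := ih fun a ha => h a (List.mem_cons_of_mem _ ha)
    have h2 := h b (by simp)
    have h3 := size_append (f b) (l.flatMap f)
    simp only [List.flatMap_cons, List.length_cons, add_mul, one_mul]; omega

theorem size_reverse (l : List α) : (enc l.reverse).size = (enc l).size := by
  induction l with
  | nil => rfl
  | cons a l ih =>
    have := size_append l.reverse [a]
    simp [Data.size] at this ⊢; omega

end size

/-! ### Computations with bounded resources -/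

/-- The resources of a computation: a subroutine, a parameter `B` in which running times and sizes
are polynomially bounded, and a factor `M` that may enter running times linearly. -/
structure Machine where
  sub : Data → Data → ℕ → Prop
  B : ℕ
  M : ℕ
  B_pos : 1 ≤ B
  M_pos : 1 ≤ M

/-- `f` is polynomially bounded in the parameters `B` of the machines. -/
def Bd {ι : Type} (p : ι → Machine) (f : ι → ℕ) : Prop := ∃ C, ∀ i, f i ≤ C * (p i).B ^ C

section Bd
variable {ι κ : Type} {p : ι → Machine} {f g : ι → ℕ}

theorem Bd.mono (hg : Bd p g) (h : ∀ i, f i ≤ g i) : Bd p f :=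
  hg.imp fun _ hC i => (h i).trans (hC i)

theorem Bd.const (c : ℕ) : Bd p fun _ => c :=
  ⟨c, fun i => Nat.le_mul_of_pos_right _ (pow_pos (p i).B_pos _)⟩

theorem Bd.add (hf : Bd p f) (hg : Bd p g) : Bd p fun i => f i + g i := by
  obtain ⟨C, hC⟩ := hf
  obtain ⟨D, hD⟩ := hg
  refine ⟨C + D, fun i => (Nat.add_le_add (hC i) (hD i)).trans ?_⟩
  rw [add_mul]
  exact Nat.add_le_add
    (Nat.mul_le_mul_left _ (Nat.pow_le_pow_right (p i).B_pos (Nat.le_add_right _ _)))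
    (Nat.mul_le_mul_left _ (Nat.pow_le_pow_right (p i).B_pos (Nat.le_add_left _ _)))

theorem Bd.mul (hf : Bd p f) (hg : Bd p g) : Bd p fun i => f i * g i := by
  obtain ⟨C, hC⟩ := hf
  obtain ⟨D, hD⟩ := hg
  refine ⟨C * D + C + D, fun i => (Nat.mul_le_mul (hC i) (hD i)).trans ?_⟩
  calc C * (p i).B ^ C * (D * (p i).B ^ D) = C * D * (p i).B ^ (C + D) := by ring
    _ ≤ _ := Nat.mul_le_mul (by omega) (Nat.pow_le_pow_right (p i).B_pos (by omega))

theorem Bd.B : Bd p fun i => (p i).B := ⟨1, fun i => by simp⟩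

theorem Bd.comap (hf : Bd p f) (π : κ → ι) : Bd (fun k => p (π k)) fun k => f (π k) :=
  hf.imp fun _ hC _ => hC _

end Bd

section Ev
variable {ι κ : Type} {p : ι → Machine} {α β γ δ : Type} [Enc α] [Enc β] [Enc γ] [Enc δ]

/-- One program computes `y i` from `x i` for all `i`, in time polynomial in `B`, times `M`. -/
def Ev (p : ι → Machine) (x : ι → α) (y : ι → β) : Prop :=
  ∃ c : Code, ∃ τ : ι → ℕ, Bd p τ ∧
    ∀ i, ∃ t ≤ τ i * (p i).M, Eval (p i).sub c (enc (x i)) (enc (y i)) t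

/-- One program computes `y i` from `x i` for all `i`, in time polynomial in `B`, times `M`, and
the sizes of the results are polynomial in `B`. -/
structure Comp (p : ι → Machine) (x : ι → α) (y : ι → β) : Prop where
  ev : Ev p x y
  bd : Bd p fun i => (enc (y i)).size

theorem Ev.of_prim {x : ι → α} {y : ι → β} (q : Prim) (h : ∀ i, q.apply (enc (x i)) = enc (y i)) :
    Ev p x y :=
  ⟨.prim q, fun _ => 1, Bd.const 1, fun i =>
    ⟨1, by simpa using (p i).M_pos, by rw [← h]; exact Eval.prim _ _⟩⟩

theorem Ev.trans {x : ι → α} {y : ι → β} {z : ι → γ} (h : Ev p x y) (h' : Ev p y z) : Ev p x z := by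
  obtain ⟨c, τ, hτ, hc⟩ := h
  obtain ⟨c', τ', hτ', hc'⟩ := h'
  refine ⟨.comp c' c, fun i => τ i + τ' i + 1, (hτ.add hτ').add (Bd.const 1), fun i => ?_⟩
  obtain ⟨t, ht, e⟩ := hc i
  obtain ⟨t', ht', e'⟩ := hc' i
  have := (p i).M_pos
  exact ⟨_, by rw [add_mul, add_mul]; omega, e.comp e'⟩

theorem Ev.pair {x : ι → α} {y : ι → β} {z : ι → γ} (h : Ev p x y) (h' : Ev p x z) :
    Ev p x fun i => (y i, z i) := by
  obtain ⟨c, τ, hτ, hc⟩ := h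
  obtain ⟨c', τ', hτ', hc'⟩ := h'
  refine ⟨.pair c c', fun i => τ i + τ' i + 1, (hτ.add hτ').add (Bd.const 1), fun i => ?_⟩
  obtain ⟨t, ht, e⟩ := hc i
  obtain ⟨t', ht', e'⟩ := hc' i
  have := (p i).M_pos
  exact ⟨_, by rw [add_mul, add_mul]; omega, e.pair e'⟩

theorem Ev.ite {x : ι → α} {b : ι → Bool} {y z : ι → β} (h : Ev p x b) (h₁ : Ev p x y)
    (h₂ : Ev p x z) : Ev p x fun i => if b i then y i else z i := by
  obtain ⟨c, τ, hτ, hc⟩ := h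
  obtain ⟨c₁, τ₁, hτ₁, hc₁⟩ := h₁
  obtain ⟨c₂, τ₂, hτ₂, hc₂⟩ := h₂
  refine ⟨.ite c c₁ c₂, fun i => τ i + τ₁ i + τ₂ i + 1, ((hτ.add hτ₁).add hτ₂).add (Bd.const 1),
    fun i => ?_⟩
  obtain ⟨t, ht, e⟩ := hc i
  obtain ⟨t₁, ht₁, e₁⟩ := hc₁ i
  obtain ⟨t₂, ht₂, e₂⟩ := hc₂ i
  have := (p i).M_pos
  rw [add_mul, add_mul, add_mul]
  cases hb : b i <;> rw [hb] at e
  · exact ⟨t + t₂ + 1, by omega, by simpa [hb] using Eval.ite_false (f := c₁) e e₂⟩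
  · exact ⟨t + t₁ + 1, by omega,
      by simpa [hb] using Eval.ite_true (g := c₂) e (fun h => by cases h) e₁⟩

theorem Ev.refl (x : ι → α) : Ev p x x := .of_prim .id fun _ => rfl

theorem Ev.fst {x : ι → α} {y : ι → β × γ} (h : Ev p x y) : Ev p x fun i => (y i).1 :=
  h.trans (.of_prim .fst fun _ => rfl)

theorem Ev.snd {x : ι → α} {y : ι → β × γ} (h : Ev p x y) : Ev p x fun i => (y i).2 :=
  h.trans (.of_prim .snd fun _ => rfl)

theorem Ev.comap {x : ι → α} {y : ι → β} (h : Ev p x y) (π : κ → ι) :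
    Ev (fun k => p (π k)) (fun k => x (π k)) fun k => y (π k) := by
  obtain ⟨c, τ, hτ, hc⟩ := h
  exact ⟨c, _, hτ.comap π, fun k => hc _⟩

/-- The code of a loop that folds the list computed by `l`, starting from the value of `b`. -/
def Code.foldl (l b f : Code) : Code :=
  .comp (.comp (.prim .fst) (.prim .snd))
    (.comp
      (.loop (.comp (.prim .snd) (.prim .snd))
        (.pair (.prim .fst)
          (.pair
            (.comp f (.pair (.prim .fst)
              (.pair (.comp (.prim .fst) (.prim .snd))
                (.comp (.prim .fst) (.comp (.prim .snd) (.prim .snd))))))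
            (.comp (.prim .snd) (.comp (.prim .snd) (.prim .snd))))))
      (.pair (.prim .id) (.pair b l)))

/-- The loop of `Code.foldl`. Its state consists of the input, the accumulator and the rest of the
list. -/
theorem Eval.foldl_loop {sub : Data → Data → ℕ → Prop} {f : Code} {g : β → γ → β} {x : α} {T : ℕ}
    (l : List γ) (b : β)
    (h : ∀ pre e, pre ++ [e] <+: l → ∃ t ≤ T,
      Eval sub f (enc (x, pre.foldl g b, e)) (enc (g (pre.foldl g b) e)) t) :
    ∃ t ≤ l.length * (T + 30) + 10,
      Eval sub (.loop (.comp (.prim .snd) (.prim .snd))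
        (.pair (.prim .fst)
          (.pair
            (.comp f (.pair (.prim .fst)
              (.pair (.comp (.prim .fst) (.prim .snd))
                (.comp (.prim .fst) (.comp (.prim .snd) (.prim .snd))))))
            (.comp (.prim .snd) (.comp (.prim .snd) (.prim .snd))))))
        (enc (x, b, l)) (enc (x, l.foldl g b, ([] : List γ))) t := by
  induction l generalizing b with
  | nil => exact ⟨_, by simp, .loop_done (.comp (.prim .snd _) (.prim .snd _))⟩
  | cons e l ih =>
    obtain ⟨t, ht, h1⟩ := h [] e (by simp)
    obtain ⟨t', ht', h2⟩ := ih (g b e) fun pre a ha => by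
      simpa using h (e :: pre) a (by simpa using ha)
    refine ⟨_, ?_, .loop_step (.comp (.prim .snd _) (.prim .snd _)) (fun h => by cases h)
      (.pair (.prim .fst _) (.pair (.comp (.pair (.prim .fst _)
        (.pair (.comp (.prim .snd _) (.prim .fst _))
          (.comp (.comp (.prim .snd _) (.prim .snd _)) (.prim .fst _)))) h1)
          (.comp (.comp (.prim .snd _) (.prim .snd _)) (.prim .snd _)))) h2⟩
    simp only [List.length_cons, add_mul, one_mul] at ht' ⊢
    omega

/-- The stages of folding the lists `l i`: a prefix that is done, and the next element. -/
abbrev FoldIx (l : ι → List γ) : Type := Σ i, {q : List γ × γ // q.1 ++ [q.2] <+: l i}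

/-- Folding a list whose length is polynomial in `B`, times `N`, where the body of the loop takes
time polynomial in `B`, times the factor of `q`. With `N = 1` and `q = p` this is the usual loop.
The other extreme is a list as long as the factor of `p`, and a body that does not call the
subroutine. -/
theorem Ev.foldl' {x : ι → α} {l : ι → List γ} {b : ι → β} {g : ι → β → γ → β}
    (q : ι → Machine) (N : ι → ℕ)
    (hq : ∀ i, (q i).sub = (p i).sub ∧ (q i).B = (p i).B ∧ N i * (q i).M ≤ (p i).M)
    (hl : Ev p x l) (hb : Ev p x b) {L : ι → ℕ} (hL : Bd p L) (hlen : ∀ i, (l i).length ≤ L i * N i)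
    (hf : Ev (fun j : FoldIx l => q j.1)
      (fun j => (x j.1, j.2.1.1.foldl (g j.1) (b j.1), j.2.1.2))
      (fun j => g j.1 (j.2.1.1.foldl (g j.1) (b j.1)) j.2.1.2)) :
    Ev p x fun i => (l i).foldl (g i) (b i) := by
  obtain ⟨cl, τl, hτl, hcl⟩ := hl
  obtain ⟨cb, τb, hτb, hcb⟩ := hb
  obtain ⟨cf, τf, ⟨Cf, hτf⟩, hcf⟩ := hf
  have hBf : Bd p fun i => Cf * (p i).B ^ Cf := ⟨Cf, fun i => le_rfl⟩
  refine ⟨.foldl cl cb cf, fun i => τl i + τb i + (L i * (Cf * (p i).B ^ Cf + 30) + 10) + 30,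
    ((hτl.add hτb).add ((hL.mul (hBf.add (Bd.const 30))).add (Bd.const 10))).add (Bd.const 30),
    fun i => ?_⟩
  obtain ⟨tl, htl, el⟩ := hcl i
  obtain ⟨tb, htb, eb⟩ := hcb i
  obtain ⟨t, ht, e⟩ := Eval.foldl_loop (sub := (p i).sub) (f := cf) (g := g i) (x := x i)
      (T := Cf * (p i).B ^ Cf * (q i).M) (l i) (b i) fun pre a ha => by
    obtain ⟨t, ht, e⟩ := hcf ⟨i, (pre, a), ha⟩
    refine ⟨t, ht.trans ?_, by rw [← (hq i).1]; exact e⟩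
    have := hτf ⟨i, (pre, a), ha⟩
    simp only [(hq i).2.1] at this
    exact Nat.mul_le_mul_right _ this
  refine ⟨_, ?_, .comp (.comp (.pair (.prim .id _) (.pair eb el)) e)
    (.comp (.prim .snd _) (.prim .fst _))⟩
  have h1 := (p i).M_pos
  have h2 : t ≤ (L i * (Cf * (p i).B ^ Cf + 30) + 10) * (p i).M := by
    have h3 := (hq i).2.2
    have h4 := (q i).M_pos
    have h5 : (l i).length * (Cf * (p i).B ^ Cf * (q i).M + 30) ≤
        (L i * N i) * ((Cf * (p i).B ^ Cf + 30) * (q i).M) := by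
      refine Nat.mul_le_mul (hlen i) ?_
      rw [add_mul]; omega
    have h6 : (L i * N i) * ((Cf * (p i).B ^ Cf + 30) * (q i).M) =
        L i * (Cf * (p i).B ^ Cf + 30) * (N i * (q i).M) := by ring
    have h7 := Nat.mul_le_mul_left (L i * (Cf * (p i).B ^ Cf + 30)) h3
    rw [add_mul]; omega
  simp only [add_mul] at h2 ⊢
  omega

theorem Ev.foldl {x : ι → α} {l : ι → List γ} {b : ι → β} {g : ι → β → γ → β}
    (hl : Ev p x l) (hb : Ev p x b) (hlen : Bd p fun i => (l i).length)
    (hf : Ev (fun j : FoldIx l => p j.1)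
      (fun j => (x j.1, j.2.1.1.foldl (g j.1) (b j.1), j.2.1.2))
      (fun j => g j.1 (j.2.1.1.foldl (g j.1) (b j.1)) j.2.1.2)) :
    Ev p x fun i => (l i).foldl (g i) (b i) :=
  Ev.foldl' p (fun _ => 1) (by simp) hl hb hlen (by simp) hf

end Ev

/-! ### Closure properties of the computable functions -/

section Comp
variable {ι κ : Type} {p : ι → Machine} {α β γ δ : Type} [Enc α] [Enc β] [Enc γ] [Enc δ]
  {x : ι → α}

theorem Comp.congr {y z : ι → β} (h : Comp p x y) (e : ∀ i, y i = z i) : Comp p x z := by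
  rwa [← funext e]

theorem Comp.pair {y : ι → β} {z : ι → γ} (h : Comp p x y) (h' : Comp p x z) :
    Comp p x fun i => (y i, z i) :=
  ⟨h.ev.pair h'.ev, (h.bd.add h'.bd).add (Bd.const 1)⟩

theorem Comp.fst {y : ι → β × γ} (h : Comp p x y) : Comp p x fun i => (y i).1 :=
  ⟨h.ev.fst, h.bd.mono fun i => by rw [size_prod]; omega⟩

theorem Comp.snd {y : ι → β × γ} (h : Comp p x y) : Comp p x fun i => (y i).2 :=
  ⟨h.ev.snd, h.bd.mono fun i => by rw [size_prod]; omega⟩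

theorem Comp.ite {b : ι → Bool} {y z : ι → β} (h : Comp p x b) (h₁ : Comp p x y)
    (h₂ : Comp p x z) : Comp p x fun i => if b i then y i else z i :=
  ⟨h.ev.ite h₁.ev h₂.ev, (h₁.bd.add h₂.bd).mono fun i => by split <;> omega⟩

theorem Comp.nil : Comp p x fun _ => ([] : List β) :=
  ⟨.of_prim .nil fun _ => rfl, Bd.const 1⟩

theorem Comp.cons {a : ι → β} {l : ι → List β} (h : Comp p x a) (h' : Comp p x l) :
    Comp p x fun i => a i :: l i :=
  ⟨(h.ev.pair h'.ev).trans (.of_prim .id fun _ => rfl), (h.bd.add h'.bd).add (Bd.const 1)⟩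

theorem Comp.of_bool {y : ι → Bool} (h : Ev p x y) : Comp p x y :=
  ⟨h, (Bd.const 3).mono fun _ => size_bool_le _⟩

theorem Comp.true : Comp p x fun _ => true :=
  .of_bool <| ((Ev.of_prim .nil fun _ => rfl : Ev p x fun _ => false).pair
    (.of_prim .nil fun _ => rfl : Ev p x fun _ => false)).trans (.of_prim .id fun _ => rfl)

theorem Comp.false : Comp p x fun _ => false := .of_bool (.of_prim .nil fun _ => rfl)

theorem Comp.and {a b : ι → Bool} (h : Comp p x a) (h' : Comp p x b) :
    Comp p x fun i => a i && b i :=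
  (h.ite h' .false).congr fun i => by cases a i <;> rfl

theorem Comp.or {a b : ι → Bool} (h : Comp p x a) (h' : Comp p x b) :
    Comp p x fun i => a i || b i :=
  (h.ite .true h').congr fun i => by cases a i <;> rfl

theorem Comp.not {a : ι → Bool} (h : Comp p x a) : Comp p x fun i => !a i :=
  (h.ite .false .true).congr fun i => by cases a i <;> rfl

theorem Comp.xor {a b : ι → Bool} (h : Comp p x a) (h' : Comp p x b) :
    Comp p x fun i => a i ^^ b i :=
  (h.ite h'.not h').congr fun i => by cases a i <;> simp

theorem Comp.bool_beq {a b : ι → Bool} (h : Comp p x a) (h' : Comp p x b) :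
    Comp p x fun i => a i == b i :=
  (h.xor h').not.congr fun i => by cases a i <;> cases b i <;> rfl

theorem Comp.beq {a b : ι → ℕ} (h : Comp p x a) (h' : Comp p x b) :
    Comp p x fun i => a i == b i :=
  .of_bool <| (h.ev.pair h'.ev).trans <| .of_prim .eqAtom fun i => by
    by_cases e : a i = b i <;> simp [Prim.apply, Data.ofProp, e, beq_eq_decide]

theorem Comp.natLe {a b : ι → ℕ} (h : Comp p x a) (h' : Comp p x b) :
    Comp p x fun i => decide (a i ≤ b i) :=
  .of_bool <| (h.ev.pair h'.ev).trans <| .of_prim .leAtom fun i => by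
    by_cases e : a i ≤ b i <;> simp [Prim.apply, Data.ofProp, e]

theorem Comp.realLe {a b : ι → ℝ} (h : Comp p x a) (h' : Comp p x b) :
    Comp p x fun i => decide (a i ≤ b i) :=
  .of_bool <| (h.ev.pair h'.ev).trans <| .of_prim .leNum fun i => by
    by_cases e : a i ≤ b i <;> simp [Prim.apply, Data.ofProp, e]

theorem Comp.of_nat {y : ι → ℕ} (h : Ev p x y) : Comp p x y := ⟨h, Bd.const 1⟩

theorem Comp.of_real {y : ι → ℝ} (h : Ev p x y) : Comp p x y := ⟨h, Bd.const 1⟩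

theorem Comp.realAdd {a b : ι → ℝ} (h : Comp p x a) (h' : Comp p x b) :
    Comp p x fun i => a i + b i :=
  .of_real <| (h.ev.pair h'.ev).trans (.of_prim .add fun _ => rfl)

theorem Comp.realSub {a b : ι → ℝ} (h : Comp p x a) (h' : Comp p x b) :
    Comp p x fun i => a i - b i :=
  .of_real <| (h.ev.pair h'.ev).trans (.of_prim .sub fun _ => rfl)

theorem Comp.realNat (n : ℕ) : Comp p x fun _ => (n : ℝ) := by
  induction n with
  | zero => exact .of_real (.of_prim .zero fun _ => by simp [Prim.apply])
  | succ n ih =>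
    have h : Comp p x fun _ => (1 : ℝ) := .of_real (.of_prim .one fun _ => rfl)
    exact (ih.realAdd h).congr fun _ => by push_cast; rfl

theorem Comp.isEmpty {l : ι → List β} (h : Comp p x l) : Comp p x fun i => (l i).isEmpty := by
  refine .of_bool <| h.ev.trans ?_
  refine ⟨.ite (.prim .id) (.prim .nil) (.pair (.prim .nil) (.prim .nil)), fun _ => 10,
    Bd.const 10, fun i => ?_⟩
  have hM := (p i).M_pos
  change ∃ t ≤ 10 * (p i).M, Eval (p i).sub _ (enc (l i)) (enc (l i).isEmpty) t
  rcases l i with _ | ⟨a, m⟩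
  · exact ⟨1 + (1 + 1 + 1) + 1, by omega,
      .ite_false (.prim .id _) (.pair (.prim .nil _) (.prim .nil _))⟩
  · exact ⟨1 + 1 + 1, by omega, .ite_true (.prim .id _) (fun h => by cases h) (.prim .nil _)⟩

/-- An intermediate result `y` may be of any size, if only the time for computing it is bounded. -/
theorem Comp.letE {y : ι → β} {z : ι → γ} (hy : Ev p x y) (hz : Comp p (fun i => (x i, y i)) z) :
    Comp p x z :=
  ⟨((Ev.refl x).pair hy).trans hz.ev, hz.bd⟩

/-- Folding a list. The body of the loop may use everything that was available outside (`wk`), the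
current element `e` and the current value `a` of the accumulator, whose size has to be bounded by
a polynomial at all stages. -/
theorem Comp.foldl {l : ι → List γ} {b : ι → β} {g : ι → β → γ → β}
    (hl : Comp p x l) (hb : Comp p x b) {S : ι → ℕ} (hS : Bd p S)
    (hbd : ∀ i pre, pre <+: l i → (enc (pre.foldl (g i) (b i))).size ≤ S i)
    (hf : ∀ (κ : Type) (p' : κ → Machine) (α' : Type) [Enc α'] (x' : κ → α') (π : κ → ι)
      (e : κ → γ) (a : κ → β) (_ : ∀ k, p' k = p (π k))
      (_ : ∀ k, ∃ pre, pre ++ [e k] <+: l (π k) ∧ a k = pre.foldl (g (π k)) (b (π k)))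
      (_ : Ev p' x' fun k => x (π k))
      (_ : ∀ {ε : Type} [Enc ε] {y : ι → ε}, Comp p x y → Comp p' x' fun k => y (π k)),
      Comp p' x' e → Comp p' x' a → Ev p' x' fun k => g (π k) (a k) (e k)) :
    Comp p x fun i => (l i).foldl (g i) (b i) := by
  refine ⟨Ev.foldl hl.ev hb.ev (hl.bd.mono fun i => (length_lt_size _).le) ?_,
    hS.mono fun i => hbd i _ List.prefix_rfl⟩
  refine hf (FoldIx l) (fun j => p j.1) _ (fun j => (x j.1, j.2.1.1.foldl (g j.1) (b j.1), j.2.1.2))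
    (fun j => j.1) (fun j => j.2.1.2) (fun j => j.2.1.1.foldl (g j.1) (b j.1)) (fun _ => rfl)
    (fun j => ⟨_, j.2.2, rfl⟩) (Ev.refl _).fst ?_ ?_ ?_
  · intro ε _ y hy
    have h : Ev (fun j : FoldIx l => p j.1)
      (fun j => (x j.1, j.2.1.1.foldl (g j.1) (b j.1), j.2.1.2)) (fun j => x j.1) := (Ev.refl _).fst
    exact ⟨h.trans (hy.ev.comap fun j : FoldIx l => j.1), hy.bd.comap _⟩
  · refine ⟨(Ev.refl _).snd.snd, (hl.bd.comap fun j : FoldIx l => j.1).mono fun j => ?_⟩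
    exact size_mem_le (j.2.2.subset (by simp))
  · refine ⟨(Ev.refl _).snd.fst, (hS.comap fun j : FoldIx l => j.1).mono fun j => ?_⟩
    exact hbd _ _ ((List.prefix_append _ _).trans j.2.2)

theorem Comp.reverse {l : ι → List β} (hl : Comp p x l) : Comp p x fun i => (l i).reverse := by
  have h : Comp p x fun i => (l i).foldl (fun a e => e :: a) [] := by
    refine Comp.foldl hl .nil hl.bd (fun i pre hpre => ?_) ?_
    · rw [List.foldl_flip_cons_eq_append]
      simpa [size_reverse] using size_sublist_le hpre.sublist
    · intro κ p' α' _ x' π e a _ _ _ _ he ha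
      exact (he.cons ha).ev
  exact h.congr fun i => by rw [List.foldl_flip_cons_eq_append]; simp

theorem Comp.append {l l' : ι → List β} (hl : Comp p x l) (hl' : Comp p x l') :
    Comp p x fun i => l i ++ l' i := by
  have h : Comp p x fun i => (l i).reverse.foldl (fun a e => e :: a) (l' i) := by
    refine Comp.foldl hl.reverse hl' (hl.bd.add hl'.bd) (fun i pre hpre => ?_) ?_
    · rw [List.foldl_flip_cons_eq_append]
      have h1 := size_append pre.reverse (l' i)
      have h2 := size_sublist_le hpre.sublist
      rw [size_reverse] at h1 h2
      simp only [List.map_id'] at *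
      omega
    · intro κ p' α' _ x' π e a _ _ _ _ he ha
      exact (he.cons ha).ev
  exact h.congr fun i => by rw [List.foldl_flip_cons_eq_append]; simp

/-- A variant of `Comp.flatMap` in which the body may also use the input `x` itself, whose size need
not be bounded. The program `f i e` for one element is given uniformly, for every family of machines
`p'` that arises from `p` by a map `π` of the index sets. -/
theorem Comp.flatMap' {l : ι → List γ} {g : ι → γ → List β} (hl : Comp p x l)
    (hf : ∀ (κ : Type) (p' : κ → Machine) (α' : Type) [Enc α'] (x' : κ → α') (π : κ → ι)
      (e : κ → γ) (_ : ∀ k, p' k = p (π k)) (_ : ∀ k, e k ∈ l (π k))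
      (_ : Ev p' x' fun k => x (π k))
      (_ : ∀ {ε : Type} [Enc ε] {y : ι → ε}, Comp p x y → Comp p' x' fun k => y (π k)),
      Comp p' x' e → Comp p' x' fun k => g (π k) (e k)) :
    Comp p x fun i => (l i).flatMap (g i) := by
  obtain ⟨C, hC⟩ := (hf (Σ i, {e : γ // e ∈ l i}) (fun j => p j.1) _ (fun j => (x j.1, j.2.1))
    (fun j => j.1) (fun j => j.2.1) (fun _ => rfl) (fun j => j.2.2) (Ev.refl _).fst
    (fun {ε} _ y hy =>
      ⟨(Ev.refl _).fst.trans (hy.ev.comap fun j : Σ i, {e : γ // e ∈ l i} => j.1), hy.bd.comap _⟩)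
    ⟨(Ev.refl _).snd, (hl.bd.comap fun j : Σ i, {e : γ // e ∈ l i} => j.1).mono
      fun j => size_mem_le j.2.2⟩).bd
  have hC' : ∀ i, ∀ e ∈ l i, (enc (g i e)).size ≤ C * (p i).B ^ C := fun i e he => hC ⟨i, e, he⟩
  have key : ∀ (i : ι) (pre : List γ), pre.foldl (fun a e => g i e ++ a) [] =
      pre.reverse.flatMap (g i) := by
    intro i pre
    rw [← List.foldr_reverse]
    induction pre.reverse with
    | nil => rfl
    | cons a l ih => simp [ih]
  have h : Comp p x fun i => (l i).reverse.foldl (fun a e => g i e ++ a) [] := by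
    refine Comp.foldl hl.reverse .nil
      (((hl.bd.mul (⟨C, fun i => le_rfl⟩ : Bd p fun i => C * (p i).B ^ C))).add (Bd.const 1))
      (fun i pre hpre => ?_) ?_
    · rw [key]
      refine (size_flatMap_le fun a ha => hC' i a ?_).trans ?_
      · simpa using hpre.subset (List.mem_reverse.1 ha)
      · refine Nat.add_le_add_right (Nat.mul_le_mul_right _ ?_) _
        have h1 := hpre.length_le
        have h2 := length_lt_size (l i)
        simp at h1 ⊢; omega
    · intro κ p' α' _ x' π e a hp hmem hx wk he ha
      refine (Comp.append (hf κ p' α' x' π e hp (fun k => ?_) hx wk he) ha).ev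
      obtain ⟨pre, h1, -⟩ := hmem k
      simpa using h1.subset (by simp : e k ∈ _)
  exact h.congr fun i => by rw [key, List.reverse_reverse]

/-- The body of the loop may use everything that was available outside (`wk`) and the current
element. -/
theorem Comp.flatMap {l : ι → List γ} {g : ι → γ → List β} (hl : Comp p x l)
    (hf : ∀ (κ : Type) (p' : κ → Machine) (α' : Type) [Enc α'] (x' : κ → α') (π : κ → ι)
      (e : κ → γ) (_ : ∀ k, p' k = p (π k)) (_ : ∀ k, e k ∈ l (π k))
      (_ : ∀ {ε : Type} [Enc ε] {y : ι → ε}, Comp p x y → Comp p' x' fun k => y (π k)),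
      Comp p' x' e → Comp p' x' fun k => g (π k) (e k)) :
    Comp p x fun i => (l i).flatMap (g i) :=
  Comp.flatMap' hl fun κ p' α' _ x' π e hp hm _ wk he => hf κ p' α' x' π e hp hm wk he

theorem Comp.map {l : ι → List γ} {g : ι → γ → β} (hl : Comp p x l)
    (hf : ∀ (κ : Type) (p' : κ → Machine) (α' : Type) [Enc α'] (x' : κ → α') (π : κ → ι)
      (e : κ → γ) (_ : ∀ k, p' k = p (π k)) (_ : ∀ k, e k ∈ l (π k))
      (_ : ∀ {ε : Type} [Enc ε] {y : ι → ε}, Comp p x y → Comp p' x' fun k => y (π k)),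
      Comp p' x' e → Comp p' x' fun k => g (π k) (e k)) :
    Comp p x fun i => (l i).map (g i) :=
  (Comp.flatMap (g := fun i e => [g i e]) hl fun κ p' α' _ x' π e hp hm wk he =>
    (hf κ p' α' x' π e hp hm wk he).cons .nil).congr fun i => by
      rw [List.map_eq_flatMap]

theorem Comp.filter {l : ι → List γ} {g : ι → γ → Bool} (hl : Comp p x l)
    (hf : ∀ (κ : Type) (p' : κ → Machine) (α' : Type) [Enc α'] (x' : κ → α') (π : κ → ι)
      (e : κ → γ) (_ : ∀ k, p' k = p (π k)) (_ : ∀ k, e k ∈ l (π k))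
      (_ : ∀ {ε : Type} [Enc ε] {y : ι → ε}, Comp p x y → Comp p' x' fun k => y (π k)),
      Comp p' x' e → Comp p' x' fun k => g (π k) (e k)) :
    Comp p x fun i => (l i).filter (g i) :=
  (Comp.flatMap (g := fun i e => if g i e then [e] else []) hl
    fun κ p' α' _ x' π e hp hm wk he =>
    (hf κ p' α' x' π e hp hm wk he).ite (he.cons .nil) .nil).congr fun i => by
      induction l i with
      | nil => rfl
      | cons a l ih => rw [List.flatMap_cons, ih, List.filter_cons]; split <;> rfl

theorem Comp.any {l : ι → List γ} {g : ι → γ → Bool} (hl : Comp p x l)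
    (hf : ∀ (κ : Type) (p' : κ → Machine) (α' : Type) [Enc α'] (x' : κ → α') (π : κ → ι)
      (e : κ → γ) (_ : ∀ k, p' k = p (π k)) (_ : ∀ k, e k ∈ l (π k))
      (_ : ∀ {ε : Type} [Enc ε] {y : ι → ε}, Comp p x y → Comp p' x' fun k => y (π k)),
      Comp p' x' e → Comp p' x' fun k => g (π k) (e k)) :
    Comp p x fun i => (l i).any (g i) :=
  (Comp.filter hl hf).isEmpty.not.congr fun i => by
    induction l i with
    | nil => rfl
    | cons a l ih => rw [List.filter_cons, List.any_cons, ← ih]; split <;> simp [*]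

theorem Comp.all {l : ι → List γ} {g : ι → γ → Bool} (hl : Comp p x l)
    (hf : ∀ (κ : Type) (p' : κ → Machine) (α' : Type) [Enc α'] (x' : κ → α') (π : κ → ι)
      (e : κ → γ) (_ : ∀ k, p' k = p (π k)) (_ : ∀ k, e k ∈ l (π k))
      (_ : ∀ {ε : Type} [Enc ε] {y : ι → ε}, Comp p x y → Comp p' x' fun k => y (π k)),
      Comp p' x' e → Comp p' x' fun k => g (π k) (e k)) :
    Comp p x fun i => (l i).all (g i) :=
  (Comp.any (g := fun i e => !g i e) hl fun κ p' α' _ x' π e hp hm wk he =>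
    (hf κ p' α' x' π e hp hm wk he).not).not.congr fun i => by
      rw [List.all_eq_not_any_not]

end Comp

/-! ### The algorithm -/

/-- An edge `(u, (v, ℓ))` with its length. -/
abbrev Ed : Type := ℕ × ℕ × ℝ

/-- The candidate of least value, as a list with at most one element. -/
noncomputable def best {γ : Type} (l : List (ℝ × γ)) : List (ℝ × γ) :=
  l.foldl (fun acc c => if acc.any (fun a => decide (a.1 ≤ c.1)) then acc else [c]) []

/-- The labels of `u` in a table. -/
def look {γ : Type} (tbl : List (ℕ × List γ)) (u : ℕ) : List γ :=
  tbl.flatMap fun q => if q.1 == u then q.2 else []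

/-- The walks that arise from the labels of `a` by appending the edge `e = {a, b}`, if `v = b`. -/
noncomputable def extend (tbl : List (ℕ × List (ℝ × List Ed))) (a b v : ℕ) (e : Ed) :
    List (ℝ × List Ed) :=
  if v == b then (look tbl a).map (fun c => (c.1 + e.2.2, e :: c.2)) else []

/-- One round of the Bellman–Ford algorithm. -/
noncomputable def relax (E : List Ed) (tbl : List (ℕ × List (ℝ × List Ed))) :
    List (ℕ × List (ℝ × List Ed)) :=
  tbl.map fun q => (q.1, best (q.2 ++ E.flatMap fun e =>
    extend tbl e.1 e.2.1 q.1 e ++ extend tbl e.2.1 e.1 q.1 e))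

/-- The initial table of the Bellman–Ford algorithm: only `s` has a label, the empty walk. -/
noncomputable def start (V : List ℕ) (s : ℕ) : List (ℕ × List (ℝ × List Ed)) :=
  V.map fun v => (v, if v == s then [(0, [])] else [])

/-- The Bellman–Ford algorithm: each vertex that is reachable from `s` by edges of `E` is labelled
with a shortest walk from `s` and its length. -/
noncomputable def walks (V : List ℕ) (E : List Ed) (s : ℕ) : List (ℕ × List (ℝ × List Ed)) :=
  V.foldl (fun tbl _ => relax E tbl) (start V s)

/-- Is `v` reachable from `s` by edges of `E`? -/
noncomputable def reach (V : List ℕ) (E : List Ed) (s v : ℕ) : Bool :=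
  !(look (walks V E s) v).isEmpty

/-- A shortest walk from `s` to `v` by edges of `E`; empty if there is none. -/
noncomputable def walk (V : List ℕ) (E : List Ed) (s v : ℕ) : List Ed :=
  (best (look (walks V E s) v)).flatMap fun c => c.2

/-- All lists of elements of `X` that are at most as long as the list `cnt`. -/
def seqs {γ κ : Type} (X : List γ) (cnt : List κ) : List (List γ) :=
  cnt.foldl (fun acc _ => acc ++ X.flatMap fun x => acc.map fun w => x :: w) [[]]

/-- Does `e` occur in `d`, and is the number of its occurrences odd? -/
def mult (d : List (ℕ × ℕ)) (e : Ed) : Bool × Bool :=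
  d.foldl (fun st q => if (q.1 == e.1 && q.2 == e.2.1) || (q.1 == e.2.1 && q.2 == e.1) then
    (true, !st.2) else st) (false, false)

/-- As many copies of `e` as in `d`, modulo two, but two copies if the number in `d` is even and
positive. -/
def copies (d : List (ℕ × ℕ)) (e : Ed) : List Ed :=
  if (mult d e).1 then (if (mult d e).2 then [e] else [e, e]) else []

/-- The vertices of the connected component of `s`. -/
noncomputable def compV (V : List ℕ) (E : List Ed) (s : ℕ) : List ℕ :=
  V.filter fun v => reach V E s v

/-- The edges of the connected component of `s`. -/
noncomputable def compE (V : List ℕ) (E : List Ed) (s : ℕ) : List Ed :=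
  E.filter fun e => reach V E s e.1

/-- The tour that the oracle `O` finds in the connected component of `s`, with the multiplicities
reduced to at most two. -/
noncomputable def subtour (O : List ℕ → List Ed → List (ℕ × ℕ)) (V : List ℕ) (E : List Ed)
    (s : ℕ) : List Ed :=
  (compE V E s).flatMap fun e => copies (O (compV V E s) (compE V E s)) e

/-- Is `s` the least vertex of its connected component? -/
noncomputable def isRep (V : List ℕ) (E : List Ed) (s : ℕ) : Bool :=
  V.all fun v => !reach V E s v || decide (s ≤ v)

/-- The union of the tours of all the connected components. -/
noncomputable def tours (O : List ℕ → List Ed → List (ℕ × ℕ)) (V : List ℕ) (E : List Ed) :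
    List Ed :=
  V.flatMap fun s => if isRep V E s then subtour O V E s else []

/-- Is the number of elements with the property `g` odd? -/
def odds {γ : Type} (g : γ → Bool) (l : List γ) : Bool :=
  l.foldl (fun b e => b ^^ g e) false

/-- Do two edges have the same ends, in the same order? -/
def sameEnds (e f : Ed) : Bool := e.1 == f.1 && e.2.1 == f.2.1

/-- In every component of `(V, EH)`, walks in `K` from the least vertex to all the vertices of
`T`. -/
noncomputable def treeWalks (V : List ℕ) (EH K : List Ed) (T : List ℕ) : List Ed :=
  V.flatMap fun s => if isRep V EH s then T.flatMap fun t => walk V K s t else []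

/-- The edges that occur an odd number of times in `W`. -/
def oddPart (E W : List Ed) : List Ed := E.filter fun e => odds (fun f => sameEnds f e) W

/-- The total length of a list of edges. -/
noncomputable def total (F : List Ed) : ℝ := F.foldl (fun r e => r + e.2.2) 0

/-- Is `F` a tour for the interface with the vertex set `I`, the odd vertices `T` and the
parts `Cs`? -/
noncomputable def check (V I T : List ℕ) (Cs : List (List ℕ)) (F : List Ed) : Bool :=
  (V.all fun v => odds (fun f => f.1 == v || f.2.1 == v) F == T.any fun t => t == v) &&
    ((V.all fun u => V.all fun v => reach V F u v) ||
      (V.all fun v => I.any fun i => reach V F i v)) &&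
    (Cs.all fun C => C.all fun u => C.all fun v => reach V F u v)

/-- A list with `min (|E|, ⌊8 |I| / δ⌋)` elements, the largest number of long edges to be
guessed. -/
noncomputable def budget (I : List ℕ) (E : List Ed) (δ : ℝ) : List Ed :=
  (E.foldl (fun (st : ℝ × List Ed) e => if decide (δ ≤ st.1) then (st.1 - δ, e :: st.2) else st)
    (I.foldl (fun r _ => r + (8 : ℕ)) 0, [])).2

/-- All ordered pairs of elements of `T`. -/
def pairsOf (T : List ℕ) : List (ℕ × ℕ) := T.flatMap fun a => T.map fun b => (a, b)

/-- A list as long as the largest number of pairs to be guessed: `T` if `δ < 6`. If `δ ≥ 6`, then no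
pairs are needed, since the parities can be corrected within the tours of the components. -/
noncomputable def pairBudget (T : List ℕ) (δ : ℝ) : List ℕ :=
  if decide ((6 : ℕ) ≤ δ) then [] else T

/-- The union of shortest walks between the given pairs of vertices. -/
noncomputable def joinOf (V : List ℕ) (E : List Ed) (P : List (ℕ × ℕ)) : List Ed :=
  P.flatMap fun q => walk V E q.1 q.2

/-- The edges in `S` or in `J`, and all those that are at most as long as an edge of `θ`. -/
noncomputable def guessed (E S θ J : List Ed) : List Ed :=
  E.filter fun e => (S.any fun f => sameEnds f e) || (J.any fun f => sameEnds f e) ||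
    (θ.any fun a => decide (e.2.2 ≤ a.2.2))

/-- The edge set that results from a guess. -/
noncomputable def candidate (O : List ℕ → List Ed → List (ℕ × ℕ)) (V : List ℕ) (E : List Ed)
    (T : List ℕ) (δ : ℝ) (S θ : List Ed) (P : List (ℕ × ℕ)) : List Ed :=
  tours O V (guessed E S θ (joinOf V E P)) ++
    if decide ((6 : ℕ) ≤ δ) then
      oddPart E (treeWalks V (guessed E S θ (joinOf V E P))
        (tours O V (guessed E S θ (joinOf V E P))) T)
    else joinOf V E P

/-- The edge sets that result from all the guesses. -/
noncomputable def candidates (O : List ℕ → List Ed → List (ℕ × ℕ)) (V : List ℕ) (E : List Ed)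
    (I T : List ℕ) (δ : ℝ) : List (List Ed) :=
  (seqs E (budget I E δ)).flatMap fun S => (seqs E [false]).flatMap fun θ =>
    (seqs (pairsOf T) (pairBudget T δ)).map fun P => candidate O V E T δ S θ P

/-- The shortest tour that results from a guess. -/
noncomputable def solve (O : List ℕ → List Ed → List (ℕ × ℕ)) (V : List ℕ) (E : List Ed)
    (I T : List ℕ) (Cs : List (List ℕ)) (δ : ℝ) : List (ℕ × ℕ) :=
  (best (((candidates O V E I T δ).filter fun F => check V I T Cs F).map fun F =>
    (total F, F))).flatMap fun c => c.2.map fun e => (e.1, e.2.1)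

section Basic
variable {γ κ : Type}

theorem best_concat (l : List (ℝ × γ)) (c : ℝ × γ) :
    best (l ++ [c]) = if (best l).any (fun a => decide (a.1 ≤ c.1)) then best l else [c] := by
  rw [best, List.foldl_append]; rfl

theorem best_eq (l : List (ℝ × γ)) : best l = [] ∨ ∃ c ∈ l, best l = [c] := by
  induction l using List.reverseRecOn with
  | nil => exact .inl rfl
  | append_singleton l c ih =>
    rw [best_concat]
    split
    · exact ih.imp_right fun ⟨c, hc, h⟩ => ⟨c, by simp [hc], h⟩
    · exact .inr ⟨c, by simp, rfl⟩

/-- The tables of the Bellman–Ford algorithm after `k` rounds: there is at most one label for each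
vertex, and the walks have at most `k` edges. -/
def SmallTable (V : List ℕ) (E : List Ed) (k : ℕ) (tbl : List (ℕ × List (ℝ × List Ed))) : Prop :=
  tbl.length = V.length ∧ ∀ q ∈ tbl, q.2.length ≤ 1 ∧ ∀ c ∈ q.2, c.2.length ≤ k ∧ c.2 ⊆ E

theorem SmallTable.start (V : List ℕ) (E : List Ed) (s : ℕ) : SmallTable V E 0 (start V s) := by
  refine ⟨by simp [PhiTSP.start], fun q hq => ?_⟩
  obtain ⟨v, -, rfl⟩ := List.mem_map.1 hq
  by_cases h : v == s <;> simp [h]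

theorem mem_look {tbl : List (ℕ × List γ)} {u : ℕ} {c : γ} :
    c ∈ look tbl u ↔ ∃ q ∈ tbl, q.1 = u ∧ c ∈ q.2 := by
  simp only [look, List.mem_flatMap]
  refine exists_congr fun q => and_congr_right fun _ => ?_
  by_cases h : q.1 = u <;> simp [h]

theorem mem_extend {tbl : List (ℕ × List (ℝ × List Ed))} {a b v : ℕ} {e : Ed}
    {c : ℝ × List Ed} : c ∈ extend tbl a b v e ↔
      v = b ∧ ∃ c' ∈ look tbl a, (c'.1 + e.2.2, e :: c'.2) = c := by
  by_cases h : v = b <;> simp [extend, h]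

theorem best_subset (l : List (ℝ × γ)) : best l ⊆ l := by
  rcases best_eq l with h | ⟨c, hc, h⟩
  · simp [h]
  · simpa [h] using hc

theorem length_best_le (l : List (ℝ × γ)) : (best l).length ≤ 1 := by
  rcases best_eq l with h | ⟨c, hc, h⟩ <;> simp [h]

theorem SmallTable.relax {V : List ℕ} {E : List Ed} {k : ℕ} {tbl : List (ℕ × List (ℝ × List Ed))}
    (h : SmallTable V E k tbl) : SmallTable V E (k + 1) (relax E tbl) := by
  refine ⟨by simp [PhiTSP.relax, h.1], fun q hq => ?_⟩
  obtain ⟨q, hq', rfl⟩ := List.mem_map.1 hq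
  refine ⟨length_best_le _, fun c hc => ?_⟩
  have key : ∀ a b v, ∀ e ∈ E, c ∈ extend tbl a b v e → c.2.length ≤ k + 1 ∧ c.2 ⊆ E := by
    intro a b v e he hc
    obtain ⟨-, c', hc', rfl⟩ := mem_extend.1 hc
    obtain ⟨q', hq', -, hc'⟩ := mem_look.1 hc'
    have := (h.2 q' hq').2 c' hc'
    simpa [he] using this
  rcases List.mem_append.1 (best_subset _ hc) with hc | hc
  · have := (h.2 q hq').2 c hc
    exact ⟨by omega, this.2⟩
  · obtain ⟨e, he, hc⟩ := List.mem_flatMap.1 hc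
    exact (List.mem_append.1 hc).elim (key _ _ _ e he) (key _ _ _ e he)

theorem SmallTable.foldl (V : List ℕ) (E : List Ed) (s : ℕ) (l : List ℕ) :
    SmallTable V E l.length (l.foldl (fun tbl _ => PhiTSP.relax E tbl) (PhiTSP.start V s)) := by
  induction l using List.reverseRecOn with
  | nil => exact SmallTable.start V E s
  | append_singleton l a ih => simpa using ih.relax

theorem seqs_concat (X : List γ) (cnt : List κ) (a : κ) : seqs X (cnt ++ [a]) =
    seqs X cnt ++ X.flatMap fun x => (seqs X cnt).map fun w => x :: w := by
  simp [seqs]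

theorem length_seqs (X : List γ) (cnt : List κ) :
    (seqs X cnt).length = (X.length + 1) ^ cnt.length := by
  induction cnt using List.reverseRecOn with
  | nil => rfl
  | append_singleton l a ih =>
    rw [seqs_concat]
    simp [List.length_flatMap, ih, pow_succ]
    ring

theorem mem_seqs {X : List γ} {cnt : List κ} {w : List γ} :
    w ∈ seqs X cnt ↔ w.length ≤ cnt.length ∧ w ⊆ X := by
  induction cnt using List.reverseRecOn generalizing w with
  | nil => cases w <;> simp [seqs]
  | append_singleton l a ih =>
    simp only [seqs_concat, List.mem_append, ih, List.mem_flatMap, List.mem_map,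
      List.length_append, List.length_singleton]
    constructor
    · rintro (h | ⟨x, hx, w, ⟨h1, h2⟩, rfl⟩)
      · exact ⟨by omega, h.2⟩
      · exact ⟨by simpa using h1, by simp [hx, h2]⟩
    · rintro ⟨h1, h2⟩
      cases w with
      | nil => exact .inl ⟨by simp, h2⟩
      | cons x w =>
        simp only [List.cons_subset] at h2
        exact .inr ⟨x, h2.1, w, ⟨by simpa using h1, h2.2⟩, rfl⟩

end Basic

/-! ### The running time of the algorithm -/

section Comp
variable {ι : Type} {p : ι → Machine} {α γ κ : Type} [Enc α] [Enc γ] [Enc κ] {x : ι → α}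

theorem Comp.best {l : ι → List (ℝ × γ)} (hl : Comp p x l) : Comp p x fun i => best (l i) := by
  refine Comp.foldl hl .nil (hl.bd.add ((hl.bd.add (Bd.const 1)).add (Bd.const 1)))
    (fun i pre hpre => ?_) ?_
  · rcases best_eq pre with h | ⟨c, hc, h⟩
    · have : (enc ([] : List (ℝ × γ))).size = 1 := rfl
      rw [PhiTSP.best] at h; rw [h]; omega
    · rw [PhiTSP.best] at h; rw [h]
      have := size_mem_le (hpre.subset hc)
      simp only [enc_cons, enc_nil, Data.size]; omega
  · intro κ p' α' _ x' π e a _ _ _ wk he ha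
    refine (Comp.ite (Comp.any ha ?_) ha (he.cons .nil)).ev
    intro κ p' α' _ x' π a _ _ wk ha
    exact ha.fst.realLe (wk he).fst

theorem Comp.look {l : ι → List (ℕ × List γ)} {u : ι → ℕ} (hl : Comp p x l) (hu : Comp p x u) :
    Comp p x fun i => look (l i) (u i) := by
  refine Comp.flatMap hl ?_
  intro κ p' α' _ x' π e _ _ wk he
  exact (he.fst.beq (wk hu)).ite he.snd .nil

theorem Comp.extend {tbl : ι → List (ℕ × List (ℝ × List Ed))} {a b v : ι → ℕ} {e : ι → Ed}
    (ht : Comp p x tbl) (ha : Comp p x a) (hb : Comp p x b) (hv : Comp p x v) (he : Comp p x e) :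
    Comp p x fun i => extend (tbl i) (a i) (b i) (v i) (e i) := by
  refine (hv.beq hb).ite (Comp.map (ht.look ha) ?_) .nil
  intro κ p' α' _ x' π c _ _ wk hc
  exact (hc.fst.realAdd (wk he).snd.snd).pair ((wk he).cons hc.snd)

theorem Comp.relax {E : ι → List Ed} {tbl : ι → List (ℕ × List (ℝ × List Ed))}
    (hE : Comp p x E) (ht : Comp p x tbl) : Comp p x fun i => relax (E i) (tbl i) := by
  refine Comp.map ht ?_
  intro κ p' α' _ x' π q _ _ wk hq
  refine hq.fst.pair (hq.snd.append (Comp.flatMap (wk hE) ?_)).best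
  intro κ p' α' _ x' π e _ _ wk' he
  exact ((wk' (wk ht)).extend he.fst he.snd.fst (wk' hq).fst he).append
    ((wk' (wk ht)).extend he.snd.fst he.fst (wk' hq).fst he)

theorem SmallTable.size_le {V : List ℕ} {E : List Ed} {k n : ℕ}
    {tbl : List (ℕ × List (ℝ × List Ed))} (h : SmallTable V E k tbl) (hk : k ≤ n) :
    (enc tbl).size ≤ V.length * (n * ((enc E).size + 1) + 10) + 1 := by
  refine (size_list_le (s := n * ((enc E).size + 1) + 9) fun q hq => ?_).trans (by rw [h.1])
  obtain ⟨h1, h2⟩ := h.2 q hq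
  rw [size_prod, enc_nat]
  rcases e : q.2 with _ | ⟨c, _ | ⟨c', l⟩⟩
  · simp [Data.size]
  · obtain ⟨h3, h4⟩ := h2 c (by simp [e])
    have := size_list_le fun a ha => size_mem_le (h4 ha)
    have h5 := Nat.mul_le_mul_right ((enc E).size + 1) (h3.trans hk)
    simp only [enc_cons, enc_nil, Data.size, size_prod, enc_real]
    omega
  · simp [e] at h1

theorem Comp.walks {V : ι → List ℕ} {E : ι → List Ed} {s : ι → ℕ} (hV : Comp p x V)
    (hE : Comp p x E) (hs : Comp p x s) : Comp p x fun i => walks (V i) (E i) (s i) := by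
  refine Comp.foldl hV (Comp.map hV ?_) (((hV.bd.mul ((hV.bd.mul
    (hE.bd.add (Bd.const 1))).add (Bd.const 10)))).add (Bd.const 1)) (fun i pre hpre => ?_) ?_
  · intro κ p' α' _ x' π v _ _ wk hv
    exact hv.pair ((hv.beq (wk hs)).ite
      (((Comp.realNat 0).congr (by simp)).pair .nil |>.cons .nil) .nil)
  · have h1 := length_lt_size (V i)
    refine ((SmallTable.foldl (V i) (E i) (s i) pre).size_le (hpre.length_le.trans h1.le)).trans ?_
    gcongr
  · intro κ p' α' _ x' π _ a _ _ _ wk _ ha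
    exact ((wk hE).relax ha).ev

theorem Comp.reach {V : ι → List ℕ} {E : ι → List Ed} {s v : ι → ℕ} (hV : Comp p x V)
    (hE : Comp p x E) (hs : Comp p x s) (hv : Comp p x v) :
    Comp p x fun i => reach (V i) (E i) (s i) (v i) :=
  ((hV.walks hE hs).look hv).isEmpty.not

theorem Comp.walk {V : ι → List ℕ} {E : ι → List Ed} {s v : ι → ℕ} (hV : Comp p x V)
    (hE : Comp p x E) (hs : Comp p x s) (hv : Comp p x v) :
    Comp p x fun i => walk (V i) (E i) (s i) (v i) := by
  refine Comp.flatMap ((hV.walks hE hs).look hv).best ?_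
  intro κ p' α' _ x' π c _ _ wk hc
  exact hc.snd

theorem Comp.odds {l : ι → List γ} {g : ι → γ → Bool} (hl : Comp p x l)
    (hf : ∀ (κ : Type) (p' : κ → Machine) (α' : Type) [Enc α'] (x' : κ → α') (π : κ → ι)
      (e : κ → γ)
      (_ : ∀ {ε : Type} [Enc ε] {y : ι → ε}, Comp p x y → Comp p' x' fun k => y (π k)),
      Comp p' x' e → Comp p' x' fun k => g (π k) (e k)) :
    Comp p x fun i => odds (g i) (l i) := by
  refine Comp.foldl hl .false (Bd.const 3) (fun i pre _ => size_bool_le _) ?_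
  intro κ p' α' _ x' π e a _ _ _ wk he ha
  exact (ha.xor (hf κ p' α' x' π e wk he)).ev

theorem Comp.sameEnds {e f : ι → Ed} (he : Comp p x e) (hf : Comp p x f) :
    Comp p x fun i => sameEnds (e i) (f i) :=
  (he.fst.beq hf.fst).and (he.snd.fst.beq hf.snd.fst)

theorem Comp.compV {V : ι → List ℕ} {E : ι → List Ed} {s : ι → ℕ} (hV : Comp p x V)
    (hE : Comp p x E) (hs : Comp p x s) : Comp p x fun i => compV (V i) (E i) (s i) := by
  refine Comp.filter hV ?_
  intro κ p' α' _ x' π v _ _ wk hv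
  exact (wk hV).reach (wk hE) (wk hs) hv

theorem Comp.compE {V : ι → List ℕ} {E : ι → List Ed} {s : ι → ℕ} (hV : Comp p x V)
    (hE : Comp p x E) (hs : Comp p x s) : Comp p x fun i => compE (V i) (E i) (s i) := by
  refine Comp.filter hE ?_
  intro κ p' α' _ x' π e _ _ wk he
  exact (wk hV).reach (wk hE) (wk hs) he.fst

theorem Comp.isRep {V : ι → List ℕ} {E : ι → List Ed} {s : ι → ℕ} (hV : Comp p x V)
    (hE : Comp p x E) (hs : Comp p x s) : Comp p x fun i => isRep (V i) (E i) (s i) := by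
  refine Comp.all hV ?_
  intro κ p' α' _ x' π v _ _ wk hv
  exact ((wk hV).reach (wk hE) (wk hs) hv).not.or ((wk hs).natLe hv)

theorem Comp.treeWalks {V T : ι → List ℕ} {EH K : ι → List Ed} (hV : Comp p x V)
    (hEH : Comp p x EH) (hK : Comp p x K) (hT : Comp p x T) :
    Comp p x fun i => treeWalks (V i) (EH i) (K i) (T i) := by
  refine Comp.flatMap hV ?_
  intro κ p' α' _ x' π s _ _ wk hs
  refine ((wk hV).isRep (wk hEH) hs).ite (Comp.flatMap (wk hT) ?_) .nil
  intro κ p' α' _ x' π t _ _ wk' ht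
  exact (wk' (wk hV)).walk (wk' (wk hK)) (wk' hs) ht

theorem Comp.oddPart {E W : ι → List Ed} (hE : Comp p x E) (hW : Comp p x W) :
    Comp p x fun i => oddPart (E i) (W i) := by
  refine Comp.filter hE ?_
  intro κ p' α' _ x' π e _ _ wk he
  refine Comp.odds (wk hW) ?_
  intro κ p' α' _ x' π f wk hf
  exact hf.sameEnds (wk he)

theorem Comp.total {F : ι → List Ed} (hF : Comp p x F) : Comp p x fun i => total (F i) := by
  refine Comp.foldl hF ((Comp.realNat 0).congr (by simp)) (Bd.const 1) (fun i pre _ => le_rfl) ?_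
  intro κ p' α' _ x' π e a _ _ _ wk he ha
  exact (ha.realAdd he.snd.snd).ev

theorem Comp.check {V I T : ι → List ℕ} {Cs : ι → List (List ℕ)} {F : ι → List Ed}
    (hV : Comp p x V) (hI : Comp p x I) (hT : Comp p x T) (hC : Comp p x Cs) (hF : Comp p x F) :
    Comp p x fun i => check (V i) (I i) (T i) (Cs i) (F i) := by
  refine ((Comp.all hV ?_).and ((Comp.all hV ?_).or (Comp.all hV ?_))).and (Comp.all hC ?_)
  · intro κ p' α' _ x' π v _ _ wk hv
    refine Comp.bool_beq (Comp.odds (wk hF) ?_) (Comp.any (wk hT) ?_)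
    · intro κ p' α' _ x' π f wk hf
      exact (hf.fst.beq (wk hv)).or (hf.snd.fst.beq (wk hv))
    · intro κ p' α' _ x' π t _ _ wk ht
      exact ht.beq (wk hv)
  · intro κ p' α' _ x' π u _ _ wk hu
    refine Comp.all (wk hV) ?_
    intro κ p' α' _ x' π v _ _ wk' hv
    exact (wk' (wk hV)).reach (wk' (wk hF)) (wk' hu) hv
  · intro κ p' α' _ x' π v _ _ wk hv
    refine Comp.any (wk hI) ?_
    intro κ p' α' _ x' π i _ _ wk' hi
    exact (wk' (wk hV)).reach (wk' (wk hF)) hi (wk' hv)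
  · intro κ p' α' _ x' π C _ _ wk hC
    refine Comp.all hC ?_
    intro κ p' α' _ x' π u _ _ wk' hu
    refine Comp.all (wk' hC) ?_
    intro κ p' α' _ x' π v _ _ wk'' hv
    exact (wk'' (wk' (wk hV))).reach (wk'' (wk' (wk hF))) (wk'' hu) hv

theorem Comp.budget {I : ι → List ℕ} {E : ι → List Ed} {δ : ι → ℝ} (hI : Comp p x I)
    (hE : Comp p x E) (hδ : Comp p x δ) : Comp p x fun i => budget (I i) (E i) (δ i) := by
  refine (Comp.foldl hE (Comp.pair (Comp.foldl hI ((Comp.realNat 0).congr (by simp))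
    (Bd.const 1) (fun i pre _ => le_rfl) ?_) .nil) (hE.bd.add (Bd.const 10))
    (fun i pre hpre => ?_) ?_).snd
  · intro κ p' α' _ x' π e a _ _ _ wk he ha
    exact (ha.realAdd (Comp.realNat 8)).ev
  · refine le_trans ?_ (Nat.add_le_add_right (size_sublist_le hpre.sublist) 10)
    induction pre using List.reverseRecOn with
    | nil => simp [Data.size]
    | append_singleton l a ih =>
      have h1 := ih ((List.prefix_append _ _).trans hpre)
      have h2 := size_append l [a]
      have h3 : (enc [a]).size = (enc a).size + 1 + 1 := rfl
      rw [List.foldl_append, List.foldl_cons, List.foldl_nil]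
      split
      · simp only [size_prod, enc_cons, Data.size, enc_real] at h1 h2 h3 ⊢; omega
      · omega
  · intro κ p' α' _ x' π e a _ _ _ wk he ha
    exact (Comp.ite ((wk hδ).realLe ha.fst) ((ha.fst.realSub (wk hδ)).pair (he.cons ha.snd)) ha).ev

theorem Comp.pairsOf {T : ι → List ℕ} (hT : Comp p x T) : Comp p x fun i => pairsOf (T i) := by
  refine Comp.flatMap hT ?_
  intro κ p' α' _ x' π a _ _ wk ha
  refine Comp.map (wk hT) ?_
  intro κ p' α' _ x' π b _ _ wk hb
  exact (wk ha).pair hb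

theorem Comp.pairBudget {T : ι → List ℕ} {δ : ι → ℝ} (hT : Comp p x T) (hδ : Comp p x δ) :
    Comp p x fun i => pairBudget (T i) (δ i) :=
  ((Comp.realNat 6).realLe hδ).ite .nil hT

theorem Comp.joinOf {V : ι → List ℕ} {E : ι → List Ed} {P : ι → List (ℕ × ℕ)} (hV : Comp p x V)
    (hE : Comp p x E) (hP : Comp p x P) : Comp p x fun i => joinOf (V i) (E i) (P i) := by
  refine Comp.flatMap hP ?_
  intro κ p' α' _ x' π q _ _ wk hq
  exact (wk hV).walk (wk hE) hq.fst hq.snd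

theorem Comp.guessed {E S θ J : ι → List Ed} (hE : Comp p x E) (hS : Comp p x S)
    (hθ : Comp p x θ) (hJ : Comp p x J) :
    Comp p x fun i => guessed (E i) (S i) (θ i) (J i) := by
  refine Comp.filter hE ?_
  intro κ p' α' _ x' π e _ _ wk he
  refine ((Comp.any (wk hS) ?_).or (Comp.any (wk hJ) ?_)).or (Comp.any (wk hθ) ?_)
  · intro κ p' α' _ x' π f _ _ wk hf
    exact hf.sameEnds (wk he)
  · intro κ p' α' _ x' π f _ _ wk hf
    exact hf.sameEnds (wk he)
  · intro κ p' α' _ x' π a _ _ wk ha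
    exact (wk he).snd.snd.realLe ha.snd.snd

/-- The bound `h` is for the number of lists that are generated. -/
theorem Comp.seqs {X : ι → List γ} {cnt : ι → List κ} (hX : Comp p x X) (hc : Comp p x cnt)
    (h : Bd p fun i => ((X i).length + 1) ^ (cnt i).length) :
    Comp p x fun i => seqs (X i) (cnt i) := by
  refine Comp.foldl hc (Comp.nil.cons .nil) ((h.mul ((((hc.bd.mul (hX.bd.add (Bd.const 1)))).add
    (Bd.const 1)).add (Bd.const 1))).add (Bd.const 1)) (fun i pre hpre => ?_) ?_
  · change (enc (PhiTSP.seqs (X i) pre)).size ≤ _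
    refine (size_list_le (s := (enc (cnt i)).size * ((enc (X i)).size + 1) + 1)
      fun w hw => ?_).trans ?_
    · obtain ⟨h1, h2⟩ := mem_seqs.1 hw
      refine (size_list_le fun a ha => size_mem_le (h2 ha)).trans ?_
      have := length_lt_size (cnt i)
      have := hpre.length_le
      gcongr; omega
    · rw [length_seqs]
      have := hpre.length_le
      gcongr; omega
  · intro κ p' α' _ x' π _ a _ _ _ wk _ ha
    refine (Comp.append ha (Comp.flatMap (wk hX) ?_)).ev
    intro κ p' α' _ x' π e _ _ wk he
    refine Comp.map (wk ha) ?_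
    intro κ p' α' _ x' π w _ _ wk hw
    exact (wk he).cons hw

/-- The subroutine of `q` computes the value of `O` at the graph with the vertices `v` and the edges
`e`, and this value is a list of length at most `L` times the factor of `q`. -/
def Callable (q : Machine) (L : ℕ) (O : List ℕ → List Ed → List (ℕ × ℕ)) (v : List ℕ)
    (e : List Ed) : Prop :=
  (O v e).length ≤ L * q.M ∧ ∃ t ≤ q.M, q.sub (enc (v, e)) (enc (O v e)) t

theorem Ev.call {v : ι → List ℕ} {e : ι → List Ed} {O : ι → List ℕ → List Ed → List (ℕ × ℕ)}
    {L : ι → ℕ} (hv : Ev p x v) (he : Ev p x e)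
    (h : ∀ i, Callable (p i) (L i) (O i) (v i) (e i)) : Ev p x fun i => O i (v i) (e i) := by
  refine (hv.pair he).trans ⟨.call, fun _ => 2, Bd.const 2, fun i => ?_⟩
  obtain ⟨-, t, ht, hs⟩ := h i
  have := (p i).M_pos
  exact ⟨t + 1, by dsimp only; omega, .call hs⟩

/-- The list `d` may be as long as the factor `M`: the loop that scans it makes no calls, so that
the time is still linear in `M`. -/
theorem Comp.mult {d : ι → List (ℕ × ℕ)} {e : ι → Ed} (hd : Ev p x d) (he : Comp p x e)
    {L : ι → ℕ} (hL : Bd p L) (h : ∀ i, (d i).length ≤ L i * (p i).M) :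
    Comp p x fun i => mult (d i) (e i) := by
  refine ⟨(hd.pair he.ev).trans ?_, (Bd.const 7).mono fun i => ?_⟩
  · refine Ev.foldl' (fun i => { p i with M := 1, M_pos := le_rfl }) (fun i => (p i).M)
      (fun i => ⟨rfl, rfl, by simp⟩) (Ev.refl _).fst (Comp.false.pair .false).ev hL h ?_
    -- the body of the loop does not call the subroutine
    have hx := Ev.refl (p := fun j : FoldIx d => { p j.1 with M := 1, M_pos := le_rfl })
      fun j => ((d j.1, e j.1), j.2.1.1.foldl (fun (st : Bool × Bool) (q : ℕ × ℕ) =>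
        if (q.1 == (e j.1).1 && q.2 == (e j.1).2.1) || (q.1 == (e j.1).2.1 && q.2 == (e j.1).1)
        then (Bool.true, !st.2) else st) (Bool.false, Bool.false), j.2.1.2)
    have q1 := Comp.of_nat hx.snd.snd.fst
    have q2 := Comp.of_nat hx.snd.snd.snd
    have e1 := Comp.of_nat hx.fst.snd.fst
    have e2 := Comp.of_nat hx.fst.snd.snd.fst
    have st1 := Comp.of_bool hx.snd.fst.fst
    have st2 := Comp.of_bool hx.snd.fst.snd
    exact ((((q1.beq e1).and (q2.beq e2)).or ((q1.beq e2).and (q2.beq e1))).ite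
      (Comp.true.pair st2.not) (st1.pair st2)).ev
  · have h1 := size_bool_le (PhiTSP.mult (d i) (e i)).1
    have h2 := size_bool_le (PhiTSP.mult (d i) (e i)).2
    rw [size_prod]; omega

theorem Comp.copies {d : ι → List (ℕ × ℕ)} {e : ι → Ed} (hd : Ev p x d) (he : Comp p x e)
    {L : ι → ℕ} (hL : Bd p L) (h : ∀ i, (d i).length ≤ L i * (p i).M) :
    Comp p x fun i => copies (d i) (e i) :=
  have hm := Comp.mult hd he hL h
  hm.fst.ite (hm.snd.ite (he.cons .nil) (he.cons (he.cons .nil))) .nil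

variable {O : ι → List ℕ → List Ed → List (ℕ × ℕ)} {L : ι → ℕ}

/-- The output of the subroutine is only scanned for the multiplicities of the edges, so its size
need not be polynomial. -/
theorem Comp.subtour {V : ι → List ℕ} {E : ι → List Ed} {s : ι → ℕ} (hV : Comp p x V)
    (hE : Comp p x E) (hs : Comp p x s) (hL : Bd p L)
    (h : ∀ i, Callable (p i) (L i) (O i) (PhiTSP.compV (V i) (E i) (s i))
      (PhiTSP.compE (V i) (E i) (s i))) :
    Comp p x fun i => subtour (O i) (V i) (E i) (s i) := by
  have hv := hV.compV hE hs
  have he := hV.compE hE hs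
  refine Comp.letE (hv.ev.call he.ev h) (Comp.flatMap'
    ⟨(Ev.refl _).fst.trans he.ev, he.bd⟩ ?_)
  intro κ p' α' _ x' π e hp _ hx wk he
  refine Comp.copies hx.snd he (L := fun k => L (π k)) ?_ fun k => ?_
  · have := hL.comap π
    rwa [← funext hp] at this
  · rw [hp]; exact (h _).1

theorem Comp.tours {V : ι → List ℕ} {E : ι → List Ed} (hV : Comp p x V)
    (hE : Comp p x E) (hL : Bd p L) (h : ∀ i, ∀ s ∈ V i,
      Callable (p i) (L i) (O i) (PhiTSP.compV (V i) (E i) s) (PhiTSP.compE (V i) (E i) s)) :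
    Comp p x fun i => tours (O i) (V i) (E i) := by
  refine Comp.flatMap hV ?_
  intro κ p' α' _ x' π s hp hm wk hs
  refine ((wk hV).isRep (wk hE) hs).ite
    ((wk hV).subtour (O := fun k => O (π k)) (L := fun k => L (π k)) (wk hE) hs ?_ fun k => ?_) .nil
  · have := hL.comap π
    rwa [← funext hp] at this
  · rw [hp]; exact h _ _ (hm k)

theorem Comp.candidate {V T : ι → List ℕ} {E S θ : ι → List Ed} {P : ι → List (ℕ × ℕ)}
    {δ : ι → ℝ} (hV : Comp p x V) (hE : Comp p x E) (hT : Comp p x T) (hδ : Comp p x δ)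
    (hS : Comp p x S) (hθ : Comp p x θ) (hP : Comp p x P) (hL : Bd p L)
    (h : ∀ i, ∀ E', List.Sublist E' (E i) → ∀ s ∈ V i,
      Callable (p i) (L i) (O i) (PhiTSP.compV (V i) E' s) (PhiTSP.compE (V i) E' s)) :
    Comp p x fun i => candidate (O i) (V i) (E i) (T i) (δ i) (S i) (θ i) (P i) := by
  have hJ := hV.joinOf hE hP
  have hG := hE.guessed hS hθ hJ
  have hK := hV.tours hG hL fun i s hs => h i _ List.filter_sublist s hs
  exact hK.append (((Comp.realNat 6).realLe hδ).ite (hE.oddPart (hV.treeWalks hG hK hT)) hJ)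

theorem Comp.candidates {V I T : ι → List ℕ} {E : ι → List Ed} {δ : ι → ℝ} (hV : Comp p x V)
    (hE : Comp p x E) (hI : Comp p x I) (hT : Comp p x T) (hδ : Comp p x δ) (hL : Bd p L)
    (h : ∀ i, ∀ E', List.Sublist E' (E i) → ∀ s ∈ V i,
      Callable (p i) (L i) (O i) (PhiTSP.compV (V i) E' s) (PhiTSP.compE (V i) E' s))
    (h₁ : Bd p fun i => ((E i).length + 1) ^ (PhiTSP.budget (I i) (E i) (δ i)).length)
    (h₂ : Bd p fun i =>
      ((PhiTSP.pairsOf (T i)).length + 1) ^ (PhiTSP.pairBudget (T i) (δ i)).length) :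
    Comp p x fun i => candidates (O i) (V i) (E i) (I i) (T i) (δ i) := by
  have hX : Comp p x fun i => PhiTSP.seqs (E i) [Bool.false] := by
    refine hE.seqs (Comp.false.cons .nil) ?_
    · exact (hE.bd.add (Bd.const 1)).mono fun i => by
        have := length_lt_size (E i)
        simp; omega
  have hY : Comp p x fun i => PhiTSP.seqs (PhiTSP.pairsOf (T i)) (PhiTSP.pairBudget (T i) (δ i)) :=
    hT.pairsOf.seqs (hT.pairBudget hδ) h₂
  refine Comp.flatMap (hE.seqs (hI.budget hE hδ) h₁) ?_
  intro κ p' α' _ x' π S hp _ wk hS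
  refine Comp.flatMap (wk hX) ?_
  intro κ' p'' α'' _ x'' π' θ hp' _ wk' hθ
  refine Comp.map (wk' (wk hY)) ?_
  intro κ'' p₃ α₃ _ x₃ π'' P hp'' _ wk'' hP
  refine Comp.candidate (O := fun k => O (π (π' (π'' k)))) (L := fun k => L (π (π' (π'' k))))
    (wk'' (wk' (wk hV))) (wk'' (wk' (wk hE))) (wk'' (wk' (wk hT))) (wk'' (wk' (wk hδ)))
    (wk'' (wk' hS)) (wk'' hθ) hP ?_ fun k => ?_
  · have := hL.comap fun k => π (π' (π'' k))
    simpa only [← hp, ← hp', ← hp''] using this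
  · rw [hp'', hp', hp]; exact h _

/-- The algorithm runs in polynomial time, up to the factor `M`, if the numbers of guesses of long
edges and of pairs are polynomial. -/
theorem Comp.solve {V I T : ι → List ℕ} {Cs : ι → List (List ℕ)} {E : ι → List Ed} {δ : ι → ℝ}
    (hV : Comp p x V) (hE : Comp p x E) (hI : Comp p x I) (hT : Comp p x T) (hC : Comp p x Cs)
    (hδ : Comp p x δ) (hL : Bd p L)
    (h : ∀ i, ∀ E', List.Sublist E' (E i) → ∀ s ∈ V i,
      Callable (p i) (L i) (O i) (PhiTSP.compV (V i) E' s) (PhiTSP.compE (V i) E' s))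
    (h₁ : Bd p fun i => ((E i).length + 1) ^ (PhiTSP.budget (I i) (E i) (δ i)).length)
    (h₂ : Bd p fun i =>
      ((PhiTSP.pairsOf (T i)).length + 1) ^ (PhiTSP.pairBudget (T i) (δ i)).length) :
    Comp p x fun i => solve (O i) (V i) (E i) (I i) (T i) (Cs i) (δ i) := by
  refine Comp.flatMap (Comp.map (Comp.filter (hV.candidates hE hI hT hδ hL h h₁ h₂) ?_) ?_).best ?_
  · intro κ p' α' _ x' π F _ _ wk hF
    exact (wk hV).check (wk hI) (wk hT) (wk hC) hF
  · intro κ p' α' _ x' π F _ _ wk hF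
    exact hF.total.pair hF
  · intro κ p' α' _ x' π c _ _ wk hc
    refine Comp.map hc.snd ?_
    intro κ p' α' _ x' π e _ _ wk he
    exact he.fst.pair he.snd.fst

end Comp

/-! ### Connectivity -/

/-- The simple graph on the natural numbers whose edges are those of `F`. -/
def gr (F : Multiset (Sym2 ℕ)) : SimpleGraph ℕ := SimpleGraph.fromEdgeSet {x | x ∈ F}

theorem gr_adj {F : Multiset (Sym2 ℕ)} {u v : ℕ} : (gr F).Adj u v ↔ s(u, v) ∈ F ∧ u ≠ v := by
  simp [gr]

theorem gr_mono {F F' : Multiset (Sym2 ℕ)} (h : ∀ x ∈ F, x ∈ F') : gr F ≤ gr F' :=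
  SimpleGraph.fromEdgeSet_mono h

theorem gr_reachable_of_mem {F : Multiset (Sym2 ℕ)} {u v : ℕ} (h : s(u, v) ∈ F) :
    (gr F).Reachable u v := by
  rcases eq_or_ne u v with rfl | hne
  · rfl
  · exact (gr_adj.2 ⟨h, hne⟩).reachable

theorem reachable_closed {H : SimpleGraph ℕ} {P : ℕ → Prop}
    (h : ∀ u v, H.Adj u v → P u → P v) {u v : ℕ} (hr : H.Reachable u v) (hu : P u) : P v := by
  obtain ⟨w⟩ := hr
  induction w with
  | nil => exact hu
  | cons hadj _ ih => exact ih (h _ _ hadj hu)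

theorem reachable_of_adj {H H' : SimpleGraph ℕ} (h : ∀ u v, H.Adj u v → H'.Reachable u v)
    {u v : ℕ} (hr : H.Reachable u v) : H'.Reachable u v :=
  reachable_closed (P := fun x => H'.Reachable u x) (fun _ _ hadj hx => hx.trans (h _ _ hadj)) hr
    (SimpleGraph.Reachable.refl u)

section Graph
variable {G : WGraph} {F : Multiset (Sym2 ℕ)}

theorem WGraph.IsEdgeMultiset.mem_left (hF : G.IsEdgeMultiset F) {u v : ℕ} (h : s(u, v) ∈ F) :
    u ∈ G.V := G.ends _ (hF _ h) _ (Sym2.mem_mk_left u v)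

theorem WGraph.IsEdgeMultiset.mem_right (hF : G.IsEdgeMultiset F) {u v : ℕ} (h : s(u, v) ∈ F) :
    v ∈ G.V := G.ends _ (hF _ h) _ (Sym2.mem_mk_right u v)

theorem WGraph.IsEdgeMultiset.ne (hF : G.IsEdgeMultiset F) {u v : ℕ} (h : s(u, v) ∈ F) :
    u ≠ v := fun e => G.loopless _ (hF _ h) (by simpa using e)

theorem reachable_mem (hF : G.IsEdgeMultiset F) {u v : ℕ} (h : (gr F).Reachable u v)
    (hu : u ∈ G.V) : v ∈ G.V :=
  reachable_closed (P := fun x => x ∈ G.V) (fun _ _ h _ => hF.mem_right (gr_adj.1 h).1) h hu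

theorem graphOf_reachable (hF : G.IsEdgeMultiset F) {u v : G.V} :
    (G.graphOf F).Reachable u v ↔ (gr F).Reachable u v := by
  constructor
  · rintro ⟨w⟩
    induction w with
    | nil => rfl
    | cons h _ ih => exact (gr_reachable_of_mem h.2).trans ih
  · suffices H : ∀ a b : ℕ, (gr F).Reachable a b → ∀ (ha : a ∈ G.V) (hb : b ∈ G.V),
        (G.graphOf F).Reachable ⟨a, ha⟩ ⟨b, hb⟩ from fun h => H _ _ h u.2 v.2
    rintro a b ⟨w⟩
    induction w with
    | nil => exact fun _ _ => .refl _
    | cons h _ ih =>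
      intro ha hb
      have hF' := gr_adj.1 h
      have hm := hF.mem_right hF'.1
      refine SimpleGraph.Reachable.trans ?_ (ih hm hb)
      exact SimpleGraph.Adj.reachable
        (show (G.graphOf F).Adj ⟨_, ha⟩ ⟨_, hm⟩ from ⟨fun e => hF'.2 (by simpa using e), hF'.1⟩)

theorem graphOf_connected (hF : G.IsEdgeMultiset F) : (G.graphOf F).Connected ↔
    G.V.Nonempty ∧ ∀ u ∈ G.V, ∀ v ∈ G.V, (gr F).Reachable u v := by
  rw [SimpleGraph.connected_iff, and_comm]
  refine and_congr (by simp [Finset.Nonempty]) ?_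
  constructor
  · intro h u hu v hv
    exact (graphOf_reachable hF (u := ⟨u, hu⟩) (v := ⟨v, hv⟩)).1 (h _ _)
  · exact fun h u v => (graphOf_reachable hF).2 (h _ u.2 _ v.2)

/-- The contraction of `I` is connected if and only if the graph is connected, or every vertex is
connected to a vertex of `I`. -/
theorem contract_connected (hF : G.IsEdgeMultiset F) {I : Finset ℕ} (hI : I ⊆ G.V) :
    (G.contract F I).Connected ↔ G.V.Nonempty ∧
      ((∀ u ∈ G.V, ∀ v ∈ G.V, (gr F).Reachable u v) ∨
        ∀ v ∈ G.V, ∃ i ∈ I, (gr F).Reachable i v) := by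
  constructor
  · intro h
    have hne : G.V.Nonempty := by
      obtain ⟨a⟩ := h.nonempty
      obtain ⟨u, -⟩ := Quotient.exists_rep a
      exact ⟨_, u.2⟩
    refine ⟨hne, ?_⟩
    have key : ∀ u : G.V, ∀ a b, (G.contract F I).Reachable a b →
        (∀ v : G.V, Quotient.mk (contractSetoid G.V I) v = a → (gr F).Reachable u v ∨
          ((∃ i ∈ I, (gr F).Reachable i u) ∧ ∃ i ∈ I, (gr F).Reachable i v)) →
        ∀ v : G.V, Quotient.mk (contractSetoid G.V I) v = b → (gr F).Reachable u v ∨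
          ((∃ i ∈ I, (gr F).Reachable i u) ∧ ∃ i ∈ I, (gr F).Reachable i v) := by
      rintro u a b ⟨w⟩ hP
      induction w with
      | nil => exact hP
      | @cons c d _ hadj _ ih =>
        refine ih fun v hv => ?_
        have hadj' : ∃ x y : G.V, Quotient.mk (contractSetoid G.V I) x = c ∧
            Quotient.mk (contractSetoid G.V I) y = d ∧ (G.graphOf F).Adj x y := by
          rcases ((SimpleGraph.fromRel_adj _ _ _).1 hadj).2 with h | ⟨x, y, h1, h2, h3⟩
          · exact h
          · exact ⟨y, x, h2, h1, h3.symm⟩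
        obtain ⟨x, y, hx, hy, hxy⟩ := hadj'
        have hr : (gr F).Reachable x y := gr_reachable_of_mem hxy.2
        have h1 := hP x hx
        have h2 : y = v ∨ ((y : ℕ) ∈ I ∧ (v : ℕ) ∈ I) := Quotient.exact (hy.trans hv.symm)
        rcases h2 with rfl | ⟨h2, h3⟩
        · exact h1.imp (fun h => h.trans hr) fun ⟨h, i, hi, h'⟩ => ⟨h, i, hi, h'.trans hr⟩
        · rcases h1 with h1 | ⟨h1, -⟩
          · exact .inr ⟨⟨_, h2, (h1.trans hr).symm⟩, _, h3, .refl _⟩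
          · exact .inr ⟨h1, _, h3, .refl _⟩
    have key' : ∀ u v : G.V, (gr F).Reachable u v ∨
        ((∃ i ∈ I, (gr F).Reachable i u) ∧ ∃ i ∈ I, (gr F).Reachable i v) := by
      intro u v
      refine key u _ _ (h.preconnected (Quotient.mk _ u) (Quotient.mk _ v)) (fun v hv => ?_) v rfl
      rcases (Quotient.exact hv : v = u ∨ ((v : ℕ) ∈ I ∧ (u : ℕ) ∈ I)) with rfl | ⟨h1, h2⟩
      · exact .inl (.refl _)
      · exact .inr ⟨⟨_, h2, .refl _⟩, _, h1, .refl _⟩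
    by_contra! hcon
    obtain ⟨⟨a, ha, b, hb, hab⟩, c, hc, hci⟩ := hcon
    have h1 : ∀ v : G.V, (gr F).Reachable c v := fun v =>
      (key' ⟨c, hc⟩ v).resolve_right fun ⟨⟨i, hi, h⟩, _⟩ => hci i hi h
    exact hab ((h1 ⟨a, ha⟩).symm.trans (h1 ⟨b, hb⟩))
  · rintro ⟨⟨v₀, hv₀⟩, h⟩
    have key : ∀ u v : G.V, (gr F).Reachable u v →
        (G.contract F I).Reachable (Quotient.mk _ u) (Quotient.mk _ v) := by
      intro u v huv
      obtain ⟨w⟩ := (graphOf_reachable hF).2 huv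
      induction w with
      | nil => rfl
      | @cons a b c hadj _ ih =>
        refine SimpleGraph.Reachable.trans ?_
          (ih ((graphOf_reachable hF).1 ⟨‹_›⟩))
        by_cases e : (Quotient.mk (contractSetoid G.V I) a) = Quotient.mk _ b
        · rw [e]
        · exact SimpleGraph.Adj.reachable
            ((SimpleGraph.fromRel_adj _ _ _).2 ⟨e, .inl ⟨a, b, rfl, rfl, hadj⟩⟩)
    refine (SimpleGraph.connected_iff _).2 ⟨fun a b => ?_, ⟨Quotient.mk _ ⟨v₀, hv₀⟩⟩⟩
    obtain ⟨u, rfl⟩ := Quotient.exists_rep a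
    obtain ⟨v, rfl⟩ := Quotient.exists_rep b
    rcases h with h | h
    · exact key _ _ (h _ u.2 _ v.2)
    · obtain ⟨i, hi, hiu⟩ := h _ u.2
      obtain ⟨j, hj, hjv⟩ := h _ v.2
      have e : (Quotient.mk (contractSetoid G.V I) ⟨i, hI hi⟩) = Quotient.mk _ ⟨j, hI hj⟩ :=
        Quotient.sound (.inr ⟨hi, hj⟩)
      exact (key ⟨i, hI hi⟩ u hiu).symm.trans (e ▸ key ⟨j, hI hj⟩ v hjv)

/-! ### Parities of degrees -/

/-- The indicator function of `a`, modulo two. -/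
def ind (x a : ℕ) : ZMod 2 := if x = a then 1 else 0

/-- The degree of `x` in `F`, modulo two. -/
def deg (F : Multiset (Sym2 ℕ)) (x : ℕ) : ZMod 2 := ((F.countP fun e => x ∈ e : ℕ) : ZMod 2)

@[simp] theorem deg_zero (x : ℕ) : deg 0 x = 0 := rfl

@[simp] theorem deg_add (F F' : Multiset (Sym2 ℕ)) (x : ℕ) :
    deg (F + F') x = deg F x + deg F' x := by
  simp [deg, Multiset.countP_add]

theorem deg_cons {a b : ℕ} (h : a ≠ b) (F : Multiset (Sym2 ℕ)) (x : ℕ) :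
    deg (s(a, b) ::ₘ F) x = ind x a + ind x b + deg F x := by
  have : (x ∈ s(a, b)) ↔ x = a ∨ x = b := by simp
  by_cases h1 : x = a
  · subst h1; simp [deg, ind, h, add_comm]
  · by_cases h2 : x = b <;> simp [deg, ind, this, h1, h2, h.symm, add_comm]

theorem natCast_zmod_two_eq {n : ℕ} {P : Prop} [Decidable P] :
    (n : ZMod 2) = (if P then 1 else 0) ↔ (Odd n ↔ P) := by
  by_cases h : P
  · simp only [h, if_true, iff_true]; exact ZMod.natCast_eq_one_iff_odd
  · simp only [h, if_false, iff_false, Nat.not_odd_iff_even]; exact ZMod.natCast_eq_zero_iff_even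

theorem odd_eq_iff {T : Finset ℕ} (hT : T ⊆ G.V) :
    G.odd F = T ↔ ∀ v ∈ G.V, deg F v = if v ∈ T then 1 else 0 := by
  simp only [deg, natCast_zmod_two_eq, Finset.ext_iff, WGraph.odd, Finset.mem_filter]
  refine forall_congr' fun v => ?_
  have := @hT v
  tauto

theorem odd_eq_empty_iff : G.odd F = ∅ ↔ ∀ v ∈ G.V, deg F v = 0 := by
  simpa using odd_eq_iff (G := G) (F := F) (Finset.empty_subset _)

/-- The conditions for a `Φ`-tour in terms of parities and of the graph on the natural numbers. -/
theorem isPhiTour_iff {Φ : Interface G} (hV : G.V.Nonempty) (hF : G.IsEdgeMultiset F) :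
    IsPhiTour G Φ F ↔ (∀ v ∈ G.V, deg F v = if v ∈ Φ.T then 1 else 0) ∧
      ((∀ u ∈ G.V, ∀ v ∈ G.V, (gr F).Reachable u v) ∨
        ∀ v ∈ G.V, ∃ i ∈ Φ.I, (gr F).Reachable i v) ∧
      ∀ C ∈ Φ.C.parts, ∀ u ∈ C, ∀ v ∈ C, (gr F).Reachable u v := by
  rw [IsPhiTour, WGraph.IsTJoin, odd_eq_iff (Φ.T_subset.trans Φ.I_subset),
    contract_connected hF Φ.I_subset]
  have hC : ∀ C ∈ Φ.C.parts, ∀ u ∈ C, u ∈ G.V := fun C hC u hu => Φ.I_subset (Φ.C.le hC hu)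
  constructor
  · rintro ⟨⟨-, h1⟩, ⟨-, h2⟩, h3⟩
    exact ⟨h1, h2, fun C hC' u hu v hv => (graphOf_reachable hF (u := ⟨u, hC C hC' u hu⟩)
      (v := ⟨v, hC C hC' v hv⟩)).1 (h3 C hC' _ _ hu hv)⟩
  · rintro ⟨h1, h2, h3⟩
    exact ⟨⟨hF, h1⟩, ⟨hV, h2⟩, fun C hC' u v hu hv => (graphOf_reachable hF).2 (h3 C hC' _ hu _ hv)⟩

theorem feasible_nonempty {Φ : Interface G} (h : IsPhiTour G Φ F) : G.V.Nonempty :=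
  ((contract_connected h.1.1 Φ.I_subset).1 h.2.1).1

theorem length_add (F F' : Multiset (Sym2 ℕ)) : G.length (F + F') = G.length F + G.length F' := by
  simp [WGraph.length]

theorem length_nonneg (F : Multiset (Sym2 ℕ)) : 0 ≤ G.length F :=
  Multiset.sum_nonneg fun x hx => by
    obtain ⟨e, -, rfl⟩ := Multiset.mem_map.1 hx
    exact (G.len e).2

theorem length_mono {F F' : Multiset (Sym2 ℕ)} (h : F ≤ F') : G.length F ≤ G.length F' := by
  obtain ⟨D, rfl⟩ := Multiset.le_iff_exists_add.1 h
  rw [length_add]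
  exact le_add_of_nonneg_right (length_nonneg _)

theorem length_cons (e : Sym2 ℕ) (F : Multiset (Sym2 ℕ)) :
    G.length (e ::ₘ F) = G.len e + G.length F := by
  simp [WGraph.length]

end Graph

/-! ### Lists of edges -/

/-- The edge of a graph that an element of an edge list stands for. -/
def sym (e : Ed) : Sym2 ℕ := s(e.1, e.2.1)

/-- The multi-set of edges that a list stands for. -/
def ms (F : List Ed) : Multiset (Sym2 ℕ) := (F.map sym : List (Sym2 ℕ))

@[simp] theorem ms_nil : ms [] = 0 := rfl
@[simp] theorem ms_cons (e : Ed) (F : List Ed) : ms (e :: F) = sym e ::ₘ ms F := rfl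
@[simp] theorem ms_append (F F' : List Ed) : ms (F ++ F') = ms F + ms F' := by
  simp [ms, ← Multiset.coe_add]

theorem mem_ms {F : List Ed} {x : Sym2 ℕ} : x ∈ ms F ↔ ∃ e ∈ F, sym e = x := by simp [ms]

theorem ms_mono {F F' : List Ed} (h : F ⊆ F') : ∀ x ∈ ms F, x ∈ ms F' := by
  intro x hx
  obtain ⟨e, he, rfl⟩ := mem_ms.1 hx
  exact mem_ms.2 ⟨e, h he, rfl⟩

/-- The vertices of `G` in increasing order. -/
def VL (G : WGraph) : List ℕ := G.V.sort (· ≤ ·)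

/-- The edges of `G`, with their lengths. -/
noncomputable def EL (G : WGraph) : List Ed :=
  G.edgeList.map fun q => (q.1, q.2, ((G.len s(q.1, q.2) : ℝ≥0) : ℝ))

section Lists
variable {G : WGraph}

@[simp] theorem mem_VL {v : ℕ} : v ∈ VL G ↔ v ∈ G.V := by simp [VL]

theorem mem_edgeList {q : ℕ × ℕ} : q ∈ G.edgeList ↔ q.1 < q.2 ∧ s(q.1, q.2) ∈ G.E := by
  obtain ⟨a, b⟩ := q
  simp only [WGraph.edgeList, List.mem_filter, List.pair_mem_product, Finset.mem_sort,
    decide_eq_true_eq, and_iff_right_iff_imp]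
  exact fun h => ⟨G.ends _ h.2 _ (Sym2.mem_mk_left _ _), G.ends _ h.2 _ (Sym2.mem_mk_right _ _)⟩

theorem mem_EL {e : Ed} : e ∈ EL G ↔ e.1 < e.2.1 ∧ sym e ∈ G.E ∧ e.2.2 = G.len (sym e) := by
  obtain ⟨a, b, r⟩ := e
  simp only [EL, List.mem_map, mem_edgeList, Prod.mk.injEq, Prod.exists, sym]
  constructor
  · rintro ⟨a, b, h, rfl, rfl, rfl⟩
    exact ⟨h.1, h.2, rfl⟩
  · rintro ⟨h1, h2, h3⟩
    exact ⟨a, b, ⟨h1, h2⟩, rfl, rfl, h3.symm⟩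

theorem exists_mem_EL {x : Sym2 ℕ} (hx : x ∈ G.E) : ∃ e ∈ EL G, sym e = x := by
  induction x with
  | _ a b =>
    have hne : a ≠ b := fun e => G.loopless _ hx (by simpa using e)
    rcases hne.lt_or_gt with h | h
    · exact ⟨(a, b, G.len s(a, b)), mem_EL.2 ⟨h, hx, rfl⟩, rfl⟩
    · refine ⟨(b, a, G.len s(b, a)), mem_EL.2 ⟨h, ?_, rfl⟩, Sym2.eq_swap⟩
      rwa [sym, Sym2.eq_swap]

theorem ends_eq_of_sym_eq {e f : Ed} (he : e ∈ EL G) (hf : f ∈ EL G) (h : sym e = sym f) :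
    e.1 = f.1 ∧ e.2.1 = f.2.1 := by
  have h1 := (mem_EL.1 he).1
  have h2 := (mem_EL.1 hf).1
  rcases Sym2.eq_iff.1 h with h | h
  · exact h
  · omega

theorem sym_injOn {e f : Ed} (he : e ∈ EL G) (hf : f ∈ EL G) (h : sym e = sym f) : e = f := by
  obtain ⟨h1, h2⟩ := ends_eq_of_sym_eq he hf h
  have h3 := (mem_EL.1 he).2.2
  rw [h, ← (mem_EL.1 hf).2.2] at h3
  exact Prod.ext h1 (Prod.ext h2 h3)

theorem nodup_EL : (EL G).Nodup := by
  refine List.Nodup.map ?_ (List.Nodup.filter _ (List.Nodup.product (Finset.sort_nodup _ _)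
    (Finset.sort_nodup _ _)))
  intro a b h
  simp only [Prod.mk.injEq] at h
  exact Prod.ext h.1 h.2.1

theorem isEdgeMultiset_ms {F : List Ed} (h : F ⊆ EL G) : G.IsEdgeMultiset (ms F) := by
  intro x hx
  obtain ⟨e, he, rfl⟩ := mem_ms.1 hx
  exact (mem_EL.1 (h he)).2.1

theorem mem_ms_iff {F : List Ed} (hF : F ⊆ EL G) {e : Ed} (he : e ∈ EL G) :
    sym e ∈ ms F ↔ e ∈ F := by
  rw [mem_ms]
  exact ⟨fun ⟨f, hf, h⟩ => sym_injOn (hF hf) he h ▸ hf, fun h => ⟨e, h, rfl⟩⟩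

theorem total_eq {F : List Ed} (h : F ⊆ EL G) : total F = G.length (ms F) := by
  have key : ∀ (l : List Ed) (r : ℝ), l ⊆ EL G →
      l.foldl (fun r e => r + e.2.2) r = r + G.length (ms l) := by
    intro l
    induction l with
    | nil => intro r _; simp [WGraph.length]
    | cons a l ih =>
      intro r hl
      rw [List.cons_subset] at hl
      rw [List.foldl_cons, ih _ hl.2, ms_cons, length_cons, (mem_EL.1 hl.1).2.2, add_assoc]
  rw [total, key F 0 h, zero_add]

theorem encode_eq : G.encode = enc (VL G, EL G) := by
  simp [WGraph.encode, Data.ofVertices, VL, EL, Enc.enc, List.map_map, Function.comp_def]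

end Lists

/-! ### Shortest walks -/

theorem exists_best_le {γ : Type} {l : List (ℝ × γ)} {c : ℝ × γ} (h : c ∈ l) :
    ∃ c' ∈ best l, c'.1 ≤ c.1 := by
  induction l using List.reverseRecOn with
  | nil => simp at h
  | append_singleton l a ih =>
    rw [best_concat]
    rcases List.mem_append.1 h with h | h
    · obtain ⟨c', hc', hle⟩ := ih h
      split
      · exact ⟨c', hc', hle⟩
      · rename_i hn
        refine ⟨a, by simp, le_trans (le_of_not_ge fun hle' => hn ?_) hle⟩
        exact List.any_eq_true.2 ⟨c', hc', by simpa using hle'⟩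
    · obtain rfl := List.mem_singleton.1 h
      split
      · rename_i hn
        obtain ⟨c', hc', hle⟩ := List.any_eq_true.1 hn
        exact ⟨c', hc', by simpa using hle⟩
      · exact ⟨c, by simp, le_rfl⟩

section Walks
variable {G : WGraph} {E : List Ed} {s v : ℕ}

/-- The labels of a table stand for walks from `s`: they have the lengths and the parities of walks,
and exist only for vertices that are reachable from `s`. -/
def Sound (G : WGraph) (E : List Ed) (s : ℕ) (tbl : List (ℕ × List (ℝ × List Ed))) : Prop :=
  ∀ v, ∀ c ∈ look tbl v, v ∈ G.V ∧ c.2 ⊆ E ∧ c.1 = G.length (ms c.2) ∧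
    (∀ x, deg (ms c.2) x = ind x s + ind x v) ∧ (gr (ms E)).Reachable s v

theorem ind_add_self (x a : ℕ) : ind x a + ind x a = 0 := CharTwo.add_self_eq_zero _

theorem Sound.start : Sound G E s (start (VL G) s) := by
  intro v c hc
  obtain ⟨q, hq, hqv, hcq⟩ := mem_look.1 hc
  obtain ⟨u, hv, rfl⟩ := List.mem_map.1 hq
  obtain rfl : u = v := hqv
  clear hc
  by_cases h : u = s
  · subst h
    simp at hcq
    subst hcq
    exact ⟨mem_VL.1 hv, by simp, by simp [WGraph.length], fun x => by simp [ind_add_self], .refl _⟩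
  · simp [h] at hcq

theorem Sound.extend {tbl : List (ℕ × List (ℝ × List Ed))} (h : Sound G E s tbl)
    (hE : E ⊆ EL G) {a b : ℕ} {e : Ed} (he : e ∈ E) (hab : sym e = s(a, b)) {c : ℝ × List Ed}
    (hc : c ∈ extend tbl a b v e) :
    v ∈ G.V ∧ c.2 ⊆ E ∧ c.1 = G.length (ms c.2) ∧
      (∀ x, deg (ms c.2) x = ind x s + ind x v) ∧ (gr (ms E)).Reachable s v := by
  obtain ⟨rfl, c', hc', rfl⟩ := mem_extend.1 hc
  obtain ⟨-, h2, h3, h4, h5⟩ := h a c' hc'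
  have hmem : s(a, v) ∈ ms E := mem_ms.2 ⟨e, he, hab⟩
  have hF := isEdgeMultiset_ms hE
  refine ⟨hF.mem_right hmem, by simp [he, h2], ?_, fun x => ?_, h5.trans (gr_reachable_of_mem hmem)⟩
  · rw [ms_cons, length_cons, h3, (mem_EL.1 (hE he)).2.2, add_comm]
  · rw [ms_cons, hab, deg_cons (hF.ne hmem), h4]
    linear_combination ind_add_self x a

theorem Sound.relax {tbl : List (ℕ × List (ℝ × List Ed))} (h : Sound G E s tbl)
    (hE : E ⊆ EL G) : Sound G E s (relax E tbl) := by
  intro v c hc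
  obtain ⟨q, hq, hqv, hcq⟩ := mem_look.1 hc
  obtain ⟨q, hq', rfl⟩ := List.mem_map.1 hq
  obtain rfl : q.1 = v := hqv
  rcases List.mem_append.1 (best_subset _ hcq) with hc | hc
  · exact h _ _ (mem_look.2 ⟨q, hq', rfl, hc⟩)
  · obtain ⟨e, he, hc⟩ := List.mem_flatMap.1 hc
    rcases List.mem_append.1 hc with hc | hc
    · exact h.extend hE he rfl hc
    · exact h.extend hE he Sym2.eq_swap hc

/-- The table has labels for all the walks with at most `k` edges that end in `s`, and these labels
are not longer than the walks. -/
def Complete (G : WGraph) (E : List Ed) (s k : ℕ) (tbl : List (ℕ × List (ℝ × List Ed))) : Prop :=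
  tbl.map Prod.fst = VL G ∧ ∀ v ∈ G.V, ∀ w : (gr (ms E)).Walk v s, w.length ≤ k →
    ∃ c ∈ look tbl v, c.1 ≤ G.length (w.edges : Multiset (Sym2 ℕ))

theorem Complete.start : Complete G E s 0 (start (VL G) s) := by
  refine ⟨by simp [PhiTSP.start, Function.comp_def], fun v hv w hw => ?_⟩
  have hw0 := Nat.le_zero.1 hw
  obtain rfl := SimpleGraph.Walk.eq_of_length_eq_zero hw0
  exact ⟨(0, []), mem_look.2 ⟨(v, [(0, [])]), by simp [PhiTSP.start, hv], rfl, by simp⟩,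
    length_nonneg _⟩

theorem Complete.relax {k : ℕ} {tbl : List (ℕ × List (ℝ × List Ed))} (h : Complete G E s k tbl)
    (hE : E ⊆ EL G) : Complete G E s (k + 1) (relax E tbl) := by
  refine ⟨by rw [← h.1]; simp [PhiTSP.relax], fun v hv w hw => ?_⟩
  -- a candidate for the new label of `v` yields a label that is at most as long
  have key : ∀ lab c, (v, lab) ∈ tbl → c ∈ lab ++ (E.flatMap fun e =>
      PhiTSP.extend tbl e.1 e.2.1 v e ++ PhiTSP.extend tbl e.2.1 e.1 v e) →
      c.1 ≤ G.length (w.edges : Multiset (Sym2 ℕ)) →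
      ∃ c ∈ look (PhiTSP.relax E tbl) v, c.1 ≤ G.length (w.edges : Multiset (Sym2 ℕ)) := by
    intro lab c hlab hc hle
    obtain ⟨c', hc', hle'⟩ := exists_best_le hc
    exact ⟨c', mem_look.2 ⟨_, List.mem_map.2 ⟨_, hlab, rfl⟩, rfl, hc'⟩, hle'.trans hle⟩
  obtain ⟨⟨v', lab⟩, hlab, rfl⟩ : ∃ q ∈ tbl, q.1 = v := by
    have : v ∈ tbl.map Prod.fst := by rw [h.1]; exact mem_VL.2 hv
    simpa using this
  have hF := isEdgeMultiset_ms hE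
  match w with
  | .nil =>
    obtain ⟨c, hc, hle⟩ := h.2 _ hv .nil (by simp)
    obtain ⟨q, hq, e, hc⟩ := mem_look.1 hc
    refine key q.2 c ?_ (List.mem_append_left _ hc) hle
    rw [← e]; exact hq
  | .cons (v := u) hadj w =>
    obtain ⟨hmem, -⟩ := gr_adj.1 hadj
    obtain ⟨c, hc, hle⟩ := h.2 u (hF.mem_right hmem) w (by simpa using hw)
    obtain ⟨e, he, hsym⟩ := mem_ms.1 hmem
    refine key lab (c.1 + e.2.2, e :: c.2) hlab (List.mem_append_right _
      (List.mem_flatMap.2 ⟨e, he, List.mem_append.2 ?_⟩)) ?_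
    · rcases Sym2.eq_iff.1 hsym with ⟨h1, h2⟩ | ⟨h1, h2⟩
      · exact .inr (mem_extend.2 ⟨h1.symm, c, by rwa [h2], rfl⟩)
      · exact .inl (mem_extend.2 ⟨h2.symm, c, by rwa [h1], rfl⟩)
    · rw [SimpleGraph.Walk.edges_cons, ← Multiset.cons_coe, length_cons, (mem_EL.1 (hE he)).2.2,
        hsym, add_comm]
      exact add_le_add le_rfl hle

/-- Every walk contains a path between the same ends, and a path has less than `|V|` edges. -/
theorem exists_short_walk {F : Multiset (Sym2 ℕ)} (hF : G.IsEdgeMultiset F) {u : ℕ} (hu : u ∈ G.V)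
    (w : (gr F).Walk u v) : ∃ w' : (gr F).Walk u v, w'.length ≤ G.V.card ∧
      G.length (w'.edges : Multiset (Sym2 ℕ)) ≤ G.length (w.edges : Multiset (Sym2 ℕ)) := by
  classical
  refine ⟨w.bypass, ?_, length_mono ?_⟩
  · have h1 : w.bypass.support.toFinset ⊆ G.V := fun x hx => reachable_mem hF
      (w.bypass.takeUntil x (List.mem_toFinset.1 hx)).reachable hu
    have h2 := Finset.card_le_card h1
    rw [List.toFinset_card_of_nodup w.bypass_isPath.support_nodup,
      SimpleGraph.Walk.length_support] at h2
    omega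
  · exact (Multiset.le_iff_subset (Multiset.coe_nodup.2 w.bypass_isPath.isTrail.edges_nodup)).2
      w.edges_bypass_subset_edges

/-- After `|V|` rounds all shortest walks have been found. -/
theorem walks_spec (hE : E ⊆ EL G) (s : ℕ) : Sound G E s (walks (VL G) E s) ∧
    Complete G E s G.V.card (walks (VL G) E s) := by
  have key : ∀ l : List ℕ,
      Sound G E s (l.foldl (fun tbl _ => relax E tbl) (start (VL G) s)) ∧
      Complete G E s l.length (l.foldl (fun tbl _ => relax E tbl) (start (VL G) s)) := by
    intro l
    induction l using List.reverseRecOn with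
    | nil => exact ⟨.start, .start⟩
    | append_singleton l a ih => simpa using ⟨ih.1.relax hE, ih.2.relax hE⟩
  have h := key (VL G)
  rwa [show (VL G).length = G.V.card by simp [VL]] at h

theorem reach_iff (hE : E ⊆ EL G) (hv : v ∈ G.V) :
    reach (VL G) E s v = true ↔ (gr (ms E)).Reachable s v := by
  obtain ⟨h1, h2⟩ := walks_spec hE s
  have h3 : reach (VL G) E s v = true ↔ ∃ c, c ∈ look (walks (VL G) E s) v := by
    rw [reach, Bool.not_eq_true', List.isEmpty_eq_false_iff_exists_mem]
  rw [h3]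
  constructor
  · rintro ⟨c, hc⟩
    exact (h1 v c hc).2.2.2.2
  · intro h
    obtain ⟨w⟩ := h.symm
    obtain ⟨w', hw', -⟩ := exists_short_walk (isEdgeMultiset_ms hE) hv w
    obtain ⟨c, hc, -⟩ := h2.2 v hv w' hw'
    exact ⟨c, hc⟩

theorem walk_subset (hE : E ⊆ EL G) : walk (VL G) E s v ⊆ E := by
  intro e he
  obtain ⟨c, hc, he⟩ := List.mem_flatMap.1 he
  exact ((walks_spec hE s).1 v c (best_subset _ hc)).2.1 he

/-- The edges of the computed walk have odd degrees at its ends only, and it is at most as long as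
any walk. -/
theorem walk_spec (hE : E ⊆ EL G) (hv : v ∈ G.V) (w : (gr (ms E)).Walk v s) :
    (∀ x, deg (ms (walk (VL G) E s v)) x = ind x s + ind x v) ∧
      G.length (ms (walk (VL G) E s v)) ≤ G.length (w.edges : Multiset (Sym2 ℕ)) := by
  obtain ⟨h1, h2⟩ := walks_spec hE s
  obtain ⟨w', hw', hle⟩ := exists_short_walk (isEdgeMultiset_ms hE) hv w
  obtain ⟨c, hc, hc'⟩ := h2.2 v hv w' hw'
  obtain ⟨d, hd, hdc⟩ := exists_best_le hc
  obtain ⟨-, -, h3, h4, -⟩ := h1 v d (best_subset _ hd)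
  rcases best_eq (look (walks (VL G) E s) v) with h | ⟨d', -, h⟩
  · simp [h] at hd
  · obtain rfl : d = d' := by simpa [h] using hd
    have : walk (VL G) E s v = d.2 := by simp [walk, h]
    rw [this]
    exact ⟨h4, by linarith⟩

theorem walk_eq_nil (hE : E ⊆ EL G) (h : ¬ (gr (ms E)).Reachable s v) :
    walk (VL G) E s v = [] := by
  rw [walk, List.flatMap_eq_nil_iff]
  intro c hc
  exact absurd ((walks_spec hE s).1 v c (best_subset _ hc)).2.2.2.2 h

end Walks

/-! ### The test for tours -/

theorem odds_eq {γ : Type} (g : γ → Bool) (l : List γ) : odds g l = decide (Odd (l.countP g)) := by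
  induction l using List.reverseRecOn with
  | nil => simp [odds]
  | append_singleton l a ih =>
    have h : odds g (l ++ [a]) = (odds g l ^^ g a) := by simp [odds]
    rw [h, ih, List.countP_append]
    cases ha : g a
    · simp [ha]
    · simp [ha, Nat.odd_add_one, -Nat.not_odd_iff_even]

theorem countP_ms (F : List Ed) (P : Sym2 ℕ → Prop) [DecidablePred P] :
    (ms F).countP P = F.countP fun e => decide (P (sym e)) := by
  simp [ms, Multiset.coe_countP, List.countP_map, Function.comp_def]

theorem deg_eq_odds (F : List Ed) (v : ℕ) :
    deg (ms F) v = if odds (fun f => f.1 == v || f.2.1 == v) F = true then 1 else 0 := by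
  rw [deg, natCast_zmod_two_eq, odds_eq, countP_ms, decide_eq_true_iff]
  have : (fun e : Ed => decide (v ∈ sym e)) = fun f => f.1 == v || f.2.1 == v := by
    funext f
    simp [sym, eq_comm, Bool.beq_eq_decide_eq]
  rw [this]

/-- The condition `hC` says that `Cs` lists the parts of the partition, up to the order of their
elements. -/
theorem check_iff {G : WGraph} (hV : G.V.Nonempty) (Φ : Interface G) {F : List Ed}
    (hF : F ⊆ EL G) {T I : List ℕ} {Cs : List (List ℕ)} (hT : ∀ x, x ∈ T ↔ x ∈ Φ.T)
    (hI : ∀ x, x ∈ I ↔ x ∈ Φ.I) (hC : ∀ P : (ℕ → Prop) → Prop,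
      (∀ C ∈ Cs, P (· ∈ C)) ↔ ∀ C ∈ Φ.C.parts, P (· ∈ C)) :
    check (VL G) I T Cs F = true ↔ IsPhiTour G Φ (ms F) := by
  rw [isPhiTour_iff hV (isEdgeMultiset_ms hF), check, Bool.and_eq_true, Bool.and_eq_true,
    Bool.or_eq_true, and_assoc]
  refine and_congr ?_ (and_congr (or_congr ?_ ?_) ?_)
  · rw [List.all_eq_true]
    simp only [mem_VL]
    refine forall₂_congr fun v _ => ?_
    rw [deg_eq_odds]
    have : (T.any fun t => t == v) = decide (v ∈ Φ.T) := by
      rw [Bool.eq_iff_iff]; simp [hT]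
    rw [this]
    by_cases h1 : v ∈ Φ.T <;>
      cases h2 : odds (fun f => f.1 == v || f.2.1 == v) F <;> simp [h1]
  · simp only [List.all_eq_true, mem_VL]
    exact forall₂_congr fun u _ => forall₂_congr fun v hv => reach_iff hF hv
  · simp only [List.all_eq_true, List.any_eq_true, mem_VL, hI]
    exact forall₂_congr fun v hv => exists_congr fun i => and_congr_right fun _ => reach_iff hF hv
  · simp only [List.all_eq_true]
    rw [hC fun P => ∀ u, P u → ∀ v, P v → reach (VL G) F u v = true]
    exact forall₂_congr fun C hC => forall₂_congr fun u _ => forall₂_congr fun v hv =>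
      reach_iff hF (Φ.I_subset (Φ.C.le hC hv))

/-! ### Reducing multiplicities -/

/-- The multi-set `F` with all multiplicities reduced to one or two, without changing parities. -/
def red (F : Multiset (Sym2 ℕ)) : Multiset (Sym2 ℕ) :=
  ∑ e ∈ F.toFinset, Multiset.replicate (if Odd (F.count e) then 1 else 2) e

theorem count_red (F : Multiset (Sym2 ℕ)) (e : Sym2 ℕ) :
    (red F).count e = if e ∈ F then (if Odd (F.count e) then 1 else 2) else 0 := by
  rw [red, Multiset.count_sum']
  simp only [Multiset.count_replicate]
  rw [Finset.sum_ite_eq' F.toFinset e]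
  simp

theorem mem_red {F : Multiset (Sym2 ℕ)} {e : Sym2 ℕ} : e ∈ red F ↔ e ∈ F := by
  rw [← Multiset.count_pos, count_red]
  split
  · split <;> simp [*]
  · simp [*]

theorem red_le (F : Multiset (Sym2 ℕ)) : red F ≤ F := by
  refine Multiset.le_iff_count.2 fun e => ?_
  rw [count_red]
  split
  · rename_i h
    have h1 := Multiset.count_pos.2 h
    split
    · exact h1
    · rename_i h2
      rw [Nat.not_odd_iff_even] at h2
      obtain ⟨k, hk⟩ := h2
      omega
  · exact Nat.zero_le _

theorem deg_eq_sum (F : Multiset (Sym2 ℕ)) (x : ℕ) :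
    deg F x = (F.map fun e => if x ∈ e then (1 : ZMod 2) else 0).sum := by
  induction F using Multiset.induction_on with
  | empty => rfl
  | cons e F ih =>
    rw [Multiset.map_cons, Multiset.sum_cons, ← ih, deg, deg, Multiset.countP_cons]
    push_cast
    rw [add_comm]

theorem deg_red (F : Multiset (Sym2 ℕ)) (x : ℕ) : deg (red F) x = deg F x := by
  have h : (red F).toFinset = F.toFinset := by ext e; simp [mem_red]
  rw [deg_eq_sum, deg_eq_sum, Finset.sum_multiset_map_count, Finset.sum_multiset_map_count, h]
  refine Finset.sum_congr rfl fun e he => ?_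
  rw [count_red, if_pos (by simpa using he), nsmul_eq_mul, nsmul_eq_mul]
  congr 1
  split
  · rename_i h
    rw [ZMod.natCast_eq_one_iff_odd.2 h, Nat.cast_one]
  · rename_i h
    rw [ZMod.natCast_eq_zero_iff_even.2 (Nat.not_odd_iff_even.1 h)]
    rfl

theorem gr_red (F : Multiset (Sym2 ℕ)) : gr (red F) = gr F := by
  simp only [gr, mem_red]

theorem mult_eq (d : List (ℕ × ℕ)) (e : Ed) : mult d e =
    (decide (sym e ∈ (d.map fun q => s(q.1, q.2))),
      decide (Odd ((d.map fun q => s(q.1, q.2)).count (sym e)))) := by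
  induction d using List.reverseRecOn with
  | nil => simp [mult]
  | append_singleton d q ih =>
    have h : mult (d ++ [q]) e = if ((q.1 == e.1 && q.2 == e.2.1) ||
        (q.1 == e.2.1 && q.2 == e.1)) = true then (true, !(mult d e).2) else mult d e := by
      simp only [mult, List.foldl_append, List.foldl_cons, List.foldl_nil]
    have h2 : (((q.1 == e.1 && q.2 == e.2.1) || (q.1 == e.2.1 && q.2 == e.1)) = true) ↔
        s(q.1, q.2) = sym e := by
      rw [sym, Sym2.eq_iff]; simp
    rw [h, ih]
    simp only [h2, List.map_append, List.map_cons, List.map_nil, List.mem_append,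
      List.mem_singleton, List.count_append, List.count_singleton]
    by_cases h3 : s(q.1, q.2) = sym e
    · simp [h3, Nat.odd_add_one, -Nat.not_odd_iff_even]
    · simp [h3, Ne.symm h3]

theorem ms_flatMap {γ : Type} (l : List γ) (f : γ → List Ed) :
    ms (l.flatMap f) = (l.map fun a => ms (f a)).sum := by
  induction l with
  | nil => rfl
  | cons a l ih => simp [ih]

theorem ms_copies (d : List (ℕ × ℕ)) (e : Ed) : ms (copies d e) =
    if sym e ∈ (d.map fun q => s(q.1, q.2)) then Multiset.replicate
      (if Odd ((d.map fun q => s(q.1, q.2)).count (sym e)) then 1 else 2) (sym e) else 0 := by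
  rw [copies, mult_eq]
  simp only [decide_eq_true_eq]
  split
  · split <;> rfl
  · rfl

/-- Normalising a list of edges amounts to reducing the multiplicities. -/
theorem ms_flatMap_copies {G : WGraph} {E : List Ed} (hE : E ⊆ EL G) (hn : E.Nodup)
    {d : List (ℕ × ℕ)} (hd : ∀ q ∈ d, s(q.1, q.2) ∈ ms E) :
    ms (E.flatMap fun e => copies d e) = red (d.map fun q => s(q.1, q.2) : List (Sym2 ℕ)) := by
  ext x
  have h1 : ms (E.flatMap fun e => copies d e) = ∑ e ∈ E.toFinset, ms (copies d e) := by
    rw [ms_flatMap, List.sum_toFinset _ hn]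
  rw [h1, count_red, Multiset.count_sum']
  simp only [ms_copies, Multiset.mem_coe, Multiset.coe_count]
  by_cases hx : x ∈ d.map fun q => s(q.1, q.2)
  · rw [if_pos hx]
    obtain ⟨q, hq, rfl⟩ := List.mem_map.1 hx
    obtain ⟨e, he, hs⟩ := mem_ms.1 (hd q hq)
    rw [Finset.sum_eq_single e]
    · rw [hs, if_pos hx, Multiset.count_replicate_self]
    · intro f hf hne
      split
      · rw [Multiset.count_replicate, if_neg]
        intro h
        exact hne (sym_injOn (hE (by simpa using hf)) (hE he) (h.trans hs.symm))
      · simp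
    · intro h; exact absurd (by simpa using he) h
  · rw [if_neg hx]
    refine Finset.sum_eq_zero fun e _ => ?_
    split
    · rename_i h
      rw [Multiset.count_replicate, if_neg]
      rintro rfl
      exact hx h
    · simp

/-! ### The connected components -/

/-- A sublist of a list without repetitions is determined by its elements. -/
theorem filter_mem_of_sublist {γ : Type} [DecidableEq γ] {l l' : List γ} (h : l'.Sublist l)
    (hn : l.Nodup) : l.filter (fun a => decide (a ∈ l')) = l' := by
  induction h with
  | slnil => rfl
  | @cons l' l a h ih =>
    rw [List.nodup_cons] at hn
    rw [List.filter_cons_of_neg (by simpa using fun h' => hn.1 (h.subset h')), ih hn.2]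
  | @cons_cons l' l a h ih =>
    rw [List.nodup_cons] at hn
    rw [List.filter_cons_of_pos (by simp)]
    congr 1
    rw [← ih hn.2]
    refine List.filter_congr fun b hb => ?_
    have : b ≠ a := fun e => hn.1 (e ▸ hb)
    simp [this, hb]

theorem product_filter {γ : Type} (l m : List γ) (p : γ → Bool) :
    (l.filter p).product (m.filter p) = (l.product m).filter fun q => p q.1 && p q.2 := by
  induction l with
  | nil => rfl
  | cons a l ih =>
    have hc : ∀ (b : γ) (l m : List γ),
        (b :: l).product m = (m.map fun c => (b, c)) ++ l.product m :=
      fun _ _ _ => rfl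
    rw [hc, List.filter_append, ← ih]
    have h : ∀ m : List γ, (m.map fun b => (a, b)).filter (fun q => p q.1 && p q.2) =
        if p a then (m.filter p).map fun b => (a, b) else [] := by
      intro m
      rw [List.filter_map]
      cases h : p a <;> simp [h, Function.comp_def]
    rw [h]
    cases h : p a
    · simp [h]
    · simp [h, hc]

theorem sort_filter (S : Finset ℕ) (p : ℕ → Prop) [DecidablePred p] :
    (S.filter p).sort (· ≤ ·) = (S.sort (· ≤ ·)).filter fun x => decide (p x) := by
  refine List.Perm.eq_of_pairwise' (r := (· ≤ ·)) (Finset.pairwise_sort _ _)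
    ((Finset.pairwise_sort _ _).filter _) ?_
  rw [List.perm_ext_iff_of_nodup (Finset.sort_nodup _ _) ((Finset.sort_nodup _ _).filter _)]
  intro a
  simp

section Components
variable {G : WGraph} {E : List Ed} {s : ℕ}

open Classical in
/-- The connected component of `s` in the graph with the edges `E`. -/
noncomputable def compGraph (G : WGraph) (E : List Ed) (s : ℕ) : WGraph where
  V := G.V.filter fun v => (gr (ms E)).Reachable s v
  E := (G.E.filter fun x => x ∈ ms E ∧ ∀ v ∈ x, (gr (ms E)).Reachable s v)
  ends e he v hv := by
    obtain ⟨h1, -, h2⟩ := Finset.mem_filter.1 he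
    exact Finset.mem_filter.2 ⟨G.ends e h1 v hv, h2 v hv⟩
  loopless e he := G.loopless e (Finset.mem_filter.1 he).1
  len := G.len

theorem mem_compGraph_V {v : ℕ} :
    v ∈ (compGraph G E s).V ↔ v ∈ G.V ∧ (gr (ms E)).Reachable s v := by
  classical exact Finset.mem_filter

theorem mem_compGraph_E (hE : E ⊆ EL G) {x : Sym2 ℕ} :
    x ∈ (compGraph G E s).E ↔ x ∈ ms E ∧ ∀ v ∈ x, (gr (ms E)).Reachable s v := by
  classical
  exact Finset.mem_filter.trans (and_iff_right_iff_imp.2 fun h => isEdgeMultiset_ms hE x h.1)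

theorem compGraph_isSubgraph : (compGraph G E s).IsSubgraph G := by
  classical exact ⟨Finset.filter_subset _ _, Finset.filter_subset _ _, fun _ _ => rfl⟩

theorem VL_compGraph (hE : E ⊆ EL G) : VL (compGraph G E s) = compV (VL G) E s := by
  classical
  have h := sort_filter G.V fun v => (gr (ms E)).Reachable s v
  refine (Eq.trans ?_ h).trans (List.filter_congr fun v hv => ?_)
  · simp only [VL, compGraph]
  · rw [Bool.eq_iff_iff, reach_iff hE (by simpa using hv)]
    simp

theorem reachable_of_mem_compE {x : Sym2 ℕ} (hx : x ∈ ms E) {u : ℕ} (hu : u ∈ x)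
    (h : (gr (ms E)).Reachable s u) : ∀ v ∈ x, (gr (ms E)).Reachable s v := by
  intro v hv
  rcases eq_or_ne u v with rfl | hne
  · exact h
  · rw [(Sym2.mem_and_mem_iff hne).1 ⟨hu, hv⟩] at hx
    exact h.trans (gr_reachable_of_mem hx)

/-- Filtering the edge list of `G` yields the edge list of a component in the right order. -/
theorem EL_compGraph (hE : E.Sublist (EL G)) :
    EL (compGraph G E s) = compE (VL G) E s := by
  classical
  have hn := nodup_EL (G := G)
  have h1 : compE (VL G) E s =
      (EL G).filter fun e => reach (VL G) E s e.1 && decide (e ∈ E) := by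
    conv_lhs => rw [compE, ← filter_mem_of_sublist hE hn]
    rw [List.filter_filter]
    refine List.filter_congr fun e _ => ?_
    rw [filter_mem_of_sublist hE hn]
    congr
  have h2 : (compGraph G E s).edgeList = G.edgeList.filter fun q =>
      reach (VL G) E s q.1 && decide ((q.1, q.2, (G.len s(q.1, q.2) : ℝ)) ∈ E) := by
    have h3 := VL_compGraph (s := s) hE.subset
    rw [VL] at h3
    rw [WGraph.edgeList, h3, compV, product_filter, List.filter_filter, WGraph.edgeList,
      List.filter_filter]
    refine List.filter_congr fun q hq => ?_
    obtain ⟨a, b⟩ := q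
    have hab : a ∈ G.V ∧ b ∈ G.V := by
      simpa [VL] using hq
    rw [Bool.eq_iff_iff]
    simp only [Bool.and_eq_true, decide_eq_true_eq, mem_compGraph_E hE.subset,
      reach_iff hE.subset hab.1, reach_iff hE.subset hab.2]
    constructor
    · rintro ⟨⟨h4, h5, h6⟩, h7, h8⟩
      have h9 := isEdgeMultiset_ms hE.subset _ h5
      refine ⟨⟨h7, ?_⟩, h4, h9⟩
      have : ((a, b, (G.len s(a, b) : ℝ)) : Ed) ∈ EL G := mem_EL.2 ⟨h4, h9, rfl⟩
      exact (mem_ms_iff hE.subset this).1 h5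
    · rintro ⟨⟨h4, h5⟩, h6, h7⟩
      have h8 : s(a, b) ∈ ms E := mem_ms.2 ⟨_, h5, rfl⟩
      have h9 := reachable_of_mem_compE h8 (Sym2.mem_mk_left a b) h4
      exact ⟨⟨h6, h8, h9⟩, h4, h9 b (Sym2.mem_mk_right a b)⟩
  rw [h1]
  unfold EL
  rw [h2, List.filter_map]
  rfl

theorem compGraph_connected (hE : E ⊆ EL G) (hs : s ∈ G.V) : (compGraph G E s).Connected := by
  refine (graphOf_connected (G := compGraph G E s) fun x hx => hx).2
    ⟨⟨s, mem_compGraph_V.2 ⟨hs, .refl _⟩⟩, ?_⟩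
  have key : ∀ v, (gr (ms E)).Reachable s v →
      (gr (compGraph G E s).E.val).Reachable s v := by
    intro v hv
    refine (reachable_closed (P := fun x => (gr (ms E)).Reachable s x ∧
      (gr (compGraph G E s).E.val).Reachable s x) ?_ hv ⟨.refl _, .refl _⟩).2
    rintro u v hadj ⟨h1, h2⟩
    have hm := (gr_adj.1 hadj).1
    exact ⟨h1.trans (gr_reachable_of_mem hm), h2.trans (gr_reachable_of_mem ((mem_compGraph_E hE).2
      ⟨hm, reachable_of_mem_compE hm (Sym2.mem_mk_left u v) h1⟩))⟩
  intro u hu v hv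
  exact (key u (mem_compGraph_V.1 hu).2).symm.trans (key v (mem_compGraph_V.1 hv).2)

theorem deg_eq_zero_of_notMem {F : Multiset (Sym2 ℕ)} (hF : G.IsEdgeMultiset F) {x : ℕ}
    (hx : x ∉ G.V) : deg F x = 0 := by
  rw [deg, Multiset.countP_eq_zero.2, Nat.cast_zero]
  exact fun e he h => hx (G.ends e (hF e he) x h)

/-- On every connected subgraph of `G`, the oracle `O` finds a tour that is at most `α` times as
long as any tour. -/
def GoodOracle (α : ℝ) (O : List ℕ → List Ed → List (ℕ × ℕ)) (G : WGraph) : Prop :=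
  ∀ H : WGraph, H.IsSubgraph G → H.Connected →
    H.IsTSPTour ((O (VL H) (EL H)).map fun q => s(q.1, q.2) : List (Sym2 ℕ)) ∧
    ∀ F, H.IsTSPTour F →
      H.length ((O (VL H) (EL H)).map fun q => s(q.1, q.2) : List (Sym2 ℕ)) ≤ α * H.length F

variable {α : ℝ} {O : List ℕ → List Ed → List (ℕ × ℕ)}

/-- Reducing the multiplicities of a tour keeps its parities and its connected components. -/
theorem subtour_spec (hO : GoodOracle α O G) (hE : E.Sublist (EL G)) (hs : s ∈ G.V) :
    subtour O (VL G) E s ⊆ E ∧ (∀ x, deg (ms (subtour O (VL G) E s)) x = 0) ∧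
    (∀ u ∈ G.V, (gr (ms E)).Reachable s u → (gr (ms (subtour O (VL G) E s))).Reachable s u) ∧
    ∀ F, (compGraph G E s).IsTSPTour F →
      G.length (ms (subtour O (VL G) E s)) ≤ α * G.length F := by
  obtain ⟨⟨h1, h2, h3⟩, h4⟩ := hO _ (compGraph_isSubgraph)
    (compGraph_connected hE.subset hs)
  rw [VL_compGraph hE.subset, EL_compGraph hE] at h1 h2 h3 h4
  have hsub : compE (VL G) E s ⊆ E := List.filter_subset_self _
  have hms : ms (subtour O (VL G) E s) =
      red ((O (compV (VL G) E s) (compE (VL G) E s)).map fun q => s(q.1, q.2) :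
        List (Sym2 ℕ)) := by
    refine ms_flatMap_copies (G := G) (fun e he => hE.subset (hsub he))
      ((nodup_EL.sublist hE).filter _) ?_
    intro q hq
    have h5 := h1 s(q.1, q.2) (Multiset.mem_coe.2 (List.mem_map.2 ⟨q, hq, rfl⟩))
    change _ ∈ ms (compE (VL G) E s)
    rw [← EL_compGraph hE]
    obtain ⟨e, he, h⟩ := exists_mem_EL h5
    exact mem_ms.2 ⟨e, he, h⟩
  refine ⟨?_, fun x => ?_, fun u hu hr => ?_, fun F hF => ?_⟩
  · intro e he
    obtain ⟨f, hf, he⟩ := List.mem_flatMap.1 he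
    have : e = f := by
      simp only [copies] at he
      split at he
      · split at he <;> simpa using he
      · simp at he
    exact this ▸ hsub hf
  · rw [hms, deg_red]
    by_cases hx : x ∈ (compGraph G E s).V
    · exact odd_eq_empty_iff.1 h3 x hx
    · exact deg_eq_zero_of_notMem h1 hx
  · rw [hms, gr_red]
    exact ((graphOf_connected h1).1 h2).2 _ (mem_compGraph_V.2 ⟨hs, .refl _⟩) _
      (mem_compGraph_V.2 ⟨hu, hr⟩)
  · rw [hms]
    exact (length_mono (red_le _)).trans (h4 F hF)

theorem isRep_iff (hE : E ⊆ EL G) : isRep (VL G) E s = true ↔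
    ∀ v ∈ G.V, (gr (ms E)).Reachable s v → s ≤ v := by
  simp only [isRep, List.all_eq_true, mem_VL]
  refine forall₂_congr fun v hv => ?_
  rw [← reach_iff hE hv]
  cases reach (VL G) E s v <;> simp

theorem exists_rep (hE : E ⊆ EL G) {v : ℕ} (hv : v ∈ G.V) :
    ∃ s ∈ G.V, isRep (VL G) E s = true ∧ (gr (ms E)).Reachable s v := by
  classical
  have hne : (G.V.filter fun u => (gr (ms E)).Reachable v u).Nonempty :=
    ⟨v, Finset.mem_filter.2 ⟨hv, .refl _⟩⟩
  obtain ⟨h1, h2⟩ := Finset.mem_filter.1 (Finset.min'_mem _ hne)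
  refine ⟨_, h1, (isRep_iff hE).2 fun u hu hr => ?_, h2.symm⟩
  exact Finset.min'_le _ _ (Finset.mem_filter.2 ⟨hu, h2.trans hr⟩)

theorem rep_unique (hE : E ⊆ EL G) {t : ℕ} (hs : s ∈ G.V) (ht : t ∈ G.V)
    (h1 : isRep (VL G) E s = true) (h2 : isRep (VL G) E t = true)
    (h : (gr (ms E)).Reachable s t) : s = t :=
  le_antisymm ((isRep_iff hE).1 h1 t ht h) ((isRep_iff hE).1 h2 s hs h.symm)

/-- If the properties `P s` exclude each other, then the parts of `Q` are not longer than `Q`. -/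
theorem sum_length_filter_le (S : Finset ℕ) (P : ℕ → Sym2 ℕ → Prop) [∀ s, DecidablePred (P s)]
    (Q : Multiset (Sym2 ℕ)) (h : ∀ e ∈ Q, ∀ s ∈ S, ∀ t ∈ S, P s e → P t e → s = t) :
    ∑ s ∈ S, G.length (Q.filter (P s)) ≤ G.length Q := by
  induction Q using Multiset.induction_on with
  | empty => simp [WGraph.length]
  | cons e Q ih =>
    have h1 : ∀ s, G.length ((e ::ₘ Q).filter (P s)) =
        (if P s e then (G.len e : ℝ) else 0) + G.length (Q.filter (P s)) := by
      intro s
      by_cases hs : P s e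
      · rw [Multiset.filter_cons_of_pos _ hs, length_cons, if_pos hs]
      · rw [Multiset.filter_cons_of_neg _ hs, if_neg hs, zero_add]
    simp only [h1, Finset.sum_add_distrib, length_cons]
    refine add_le_add ?_ (ih fun f hf => h f (Multiset.mem_cons_of_mem hf))
    by_cases hs : ∃ s ∈ S, P s e
    · obtain ⟨s, hs, hse⟩ := hs
      rw [Finset.sum_eq_single_of_mem s hs, if_pos hse]
      intro t ht hne
      exact if_neg fun hte => hne (h e (by simp) t ht s hs hte hse)
    · push Not at hs
      rw [Finset.sum_eq_zero fun s hs' => if_neg (hs s hs')]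
      exact (G.len e).2

theorem length_list_sum (l : List (Multiset (Sym2 ℕ))) :
    G.length l.sum = (l.map G.length).sum := by
  induction l with
  | nil => simp [WGraph.length]
  | cons a l ih => simp [length_add, ih]

theorem deg_list_sum (l : List (Multiset (Sym2 ℕ))) (x : ℕ) :
    deg l.sum x = (l.map fun F => deg F x).sum := by
  induction l with
  | nil => simp
  | cons a l ih => simp [ih]

/-- The part of an even connected edge set in one component is a tour of the component. -/
theorem isTSPTour_filter (hE : E ⊆ EL G) (hs : s ∈ G.V) {Q : Multiset (Sym2 ℕ)}
    (hQ : ∀ x ∈ Q, x ∈ ms E) (h0 : ∀ x, deg Q x = 0)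
    (hr : ∀ u v, (gr (ms E)).Reachable u v → (gr Q).Reachable u v)
    [DecidablePred fun x : Sym2 ℕ => ∀ v ∈ x, (gr (ms E)).Reachable s v] :
    (compGraph G E s).IsTSPTour
      (Q.filter fun x => ∀ v ∈ x, (gr (ms E)).Reachable s v) := by
  have hF : (compGraph G E s).IsEdgeMultiset
      (Q.filter fun x => ∀ v ∈ x, (gr (ms E)).Reachable s v) := by
    intro x hx
    obtain ⟨h1, h2⟩ := Multiset.mem_filter.1 hx
    exact (mem_compGraph_E hE).2 ⟨hQ x h1, h2⟩
  refine ⟨hF, (graphOf_connected hF).2 ⟨⟨s, mem_compGraph_V.2 ⟨hs, .refl _⟩⟩, ?_⟩,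
    odd_eq_empty_iff.2 fun v hv => ?_⟩
  · have key : ∀ v, (gr (ms E)).Reachable s v →
        (gr (Q.filter fun x => ∀ v ∈ x, (gr (ms E)).Reachable s v)).Reachable s v := by
      intro v hv
      refine (reachable_closed (P := fun x => (gr (ms E)).Reachable s x ∧
        (gr (Q.filter fun x => ∀ v ∈ x, (gr (ms E)).Reachable s v)).Reachable s x) ?_
        (hr _ _ hv) ⟨.refl _, .refl _⟩).2
      rintro u v hadj ⟨h1, h2⟩
      have hm := (gr_adj.1 hadj).1
      have hm' := hQ _ hm
      exact ⟨h1.trans (gr_reachable_of_mem hm'), h2.trans (gr_reachable_of_mem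
        (Multiset.mem_filter.2 ⟨hm, reachable_of_mem_compE hm' (Sym2.mem_mk_left u v) h1⟩))⟩
    intro u hu v hv
    exact (key u (mem_compGraph_V.1 hu).2).symm.trans (key v (mem_compGraph_V.1 hv).2)
  · rw [← h0 v, deg, deg, Multiset.countP_filter]
    congr 1
    refine Multiset.countP_congr rfl fun x hx => ?_
    exact propext ⟨fun h => h.1, fun h => ⟨h, reachable_of_mem_compE (hQ x hx) h
      (mem_compGraph_V.1 hv).2⟩⟩

/-- The tours of the components form an even edge set with the same components, at most `α` times as
long as any other one. -/
theorem tours_spec (hO : GoodOracle α O G) (hα : 0 ≤ α) (hE : E.Sublist (EL G)) :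
    tours O (VL G) E ⊆ E ∧ (∀ x, deg (ms (tours O (VL G) E)) x = 0) ∧
    (∀ u v, (gr (ms E)).Reachable u v → (gr (ms (tours O (VL G) E))).Reachable u v) ∧
    ∀ Q : Multiset (Sym2 ℕ), (∀ x ∈ Q, x ∈ ms E) → (∀ x, deg Q x = 0) →
      (∀ u v, (gr (ms E)).Reachable u v → (gr Q).Reachable u v) →
      G.length (ms (tours O (VL G) E)) ≤ α * G.length Q := by
  classical
  refine ⟨?_, fun x => ?_, fun u v h => ?_, fun Q hQ h0 hr => ?_⟩
  · intro e he
    obtain ⟨s, hs, he⟩ := List.mem_flatMap.1 he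
    split at he
    · exact (subtour_spec hO hE (mem_VL.1 hs)).1 he
    · simp at he
  · rw [tours, ms_flatMap, deg_list_sum, List.map_map]
    refine List.sum_eq_zero fun r hr => ?_
    obtain ⟨s, hs, rfl⟩ := List.mem_map.1 hr
    simp only [Function.comp_apply]
    split
    · exact (subtour_spec hO hE (mem_VL.1 hs)).2.1 x
    · simp
  · refine reachable_of_adj (fun a b hab => ?_) h
    have hm := (gr_adj.1 hab).1
    have ha := (isEdgeMultiset_ms hE.subset).mem_left hm
    have hb := (isEdgeMultiset_ms hE.subset).mem_right hm
    obtain ⟨s, hs, hrep, hsa⟩ := exists_rep hE.subset ha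
    have hsub : subtour O (VL G) E s ⊆ tours O (VL G) E := fun e he =>
      List.mem_flatMap.2 ⟨s, mem_VL.2 hs, by rwa [if_pos hrep]⟩
    have h3 := (subtour_spec hO hE hs).2.2.1
    exact ((h3 a ha hsa).symm.trans (h3 b hb (hsa.trans hab.reachable))).mono
      (gr_mono (ms_mono hsub))
  · have h1 : G.length (ms (tours O (VL G) E)) =
        ∑ s ∈ G.V.filter (fun s => isRep (VL G) E s = true),
          G.length (ms (subtour O (VL G) E s)) := by
      rw [tours, ms_flatMap, length_list_sum, List.map_map, Finset.sum_filter,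
        show G.V = (VL G).toFinset by simp [VL], List.sum_toFinset _ (by simp [VL] : (VL G).Nodup)]
      congr 1
      refine List.map_congr_left fun s _ => ?_
      simp only [Function.comp_apply]
      split <;> simp [WGraph.length]
    rw [h1]
    calc _ ≤ ∑ s ∈ G.V.filter (fun s => isRep (VL G) E s = true),
          α * G.length (Q.filter fun x => ∀ v ∈ x, (gr (ms E)).Reachable s v) := by
          refine Finset.sum_le_sum fun s hs => ?_
          have hs' := (Finset.mem_filter.1 hs).1
          exact (subtour_spec hO hE hs').2.2.2 _ (isTSPTour_filter hE.subset hs' hQ h0 hr)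
      _ ≤ α * G.length Q := by
          rw [← Finset.mul_sum]
          refine mul_le_mul_of_nonneg_left (sum_length_filter_le _ _ _ ?_) hα
          intro e _ s hs t ht h1 h2
          obtain ⟨hs, hs'⟩ := Finset.mem_filter.1 hs
          obtain ⟨ht, ht'⟩ := Finset.mem_filter.1 ht
          induction e with
          | _ a b =>
            exact rep_unique hE.subset hs ht hs' ht' ((h1 a (Sym2.mem_mk_left a b)).trans
              (h2 a (Sym2.mem_mk_left a b)).symm)

end Components

/-! ### Existence of shortest edge sets -/

section Join
variable {G : WGraph}

/-- Reducing multiplicities does not lengthen an edge set, so it suffices to compare the finitely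
many edge sets with multiplicities at most two. -/
theorem exists_shortest {P : Multiset (Sym2 ℕ) → Prop} (hP : ∀ F, P F → G.IsEdgeMultiset F)
    (hred : ∀ F, P F → P (red F)) (h : ∃ F, P F) : ∃ F, G.IsShortest P F := by
  have hfin : {F : Multiset (Sym2 ℕ) | F ≤ 2 • G.E.val ∧ P F}.Finite :=
    (Set.finite_Iic (2 • G.E.val)).subset fun F hF => hF.1
  have hle : ∀ F, P F → red F ≤ 2 • G.E.val := by
    intro F hF
    refine Multiset.le_iff_count.2 fun e => ?_
    rw [count_red, Multiset.count_nsmul]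
    split
    · rename_i he
      rw [Multiset.count_eq_one_of_mem G.E.nodup (hP F hF e he)]
      split <;> simp
    · exact Nat.zero_le _
  obtain ⟨F₀, hF₀⟩ := h
  obtain ⟨F, hF, hmin⟩ := Set.exists_min_image _ G.length hfin ⟨red F₀, hle _ hF₀, hred _ hF₀⟩
  exact ⟨F, hF.2, fun F' hF' =>
    (hmin _ ⟨hle _ hF', hred _ hF'⟩).trans (length_mono (red_le F'))⟩

/-! ### Pairing the odd vertices -/

/-- There is a walk from `a` to `b` whose length is at most `r`. -/
def Route (G : WGraph) (a b : ℕ) (r : ℝ) : Prop :=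
  ∃ w : (gr (ms (EL G))).Walk a b, G.length (w.edges : Multiset (Sym2 ℕ)) ≤ r

theorem Route.symm {a b : ℕ} {r : ℝ} (h : Route G a b r) : Route G b a r := by
  obtain ⟨w, hw⟩ := h
  exact ⟨w.reverse, by simpa [SimpleGraph.Walk.edges_reverse, Multiset.coe_reverse] using hw⟩

theorem Route.trans {a b c : ℕ} {r r' : ℝ} (h : Route G a b r) (h' : Route G b c r') :
    Route G a c (r + r') := by
  obtain ⟨w, hw⟩ := h
  obtain ⟨w', hw'⟩ := h'
  refine ⟨w.append w', ?_⟩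
  rw [SimpleGraph.Walk.edges_append, ← Multiset.coe_add, length_add]
  exact add_le_add hw hw'

/-- The elements `(a, (b, r))` of `W` stand for walks from `a` to `b` of length at most `r`, which
together have the parities of the edge set `F` and are not longer than `F`. -/
structure Routing (G : WGraph) (F : Multiset (Sym2 ℕ)) (W : Multiset Ed) : Prop where
  route : ∀ e ∈ W, Route G e.1 e.2.1 e.2.2
  parity : ∀ x, (W.map fun e => ind x e.1 + ind x e.2.1).sum = deg F x
  length_le : (W.map fun e => e.2.2).sum ≤ G.length F

/-- Every edge is a walk by itself. -/
theorem exists_routing {F : Multiset (Sym2 ℕ)} (hF : G.IsEdgeMultiset F) :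
    ∃ W, Routing G F W := by
  induction F using Multiset.induction_on with
  | empty => exact ⟨0, by simp, by simp, by simp [WGraph.length]⟩
  | cons e F ih =>
    obtain ⟨W, h1, h2, h3⟩ := ih fun x hx => hF x (Multiset.mem_cons_of_mem hx)
    induction e with
    | _ a b =>
      have hab := hF.ne (Multiset.mem_cons_self s(a, b) F)
      have hmem : s(a, b) ∈ ms (EL G) := by
        obtain ⟨e, he, h⟩ := exists_mem_EL (hF _ (Multiset.mem_cons_self s(a, b) F))
        exact mem_ms.2 ⟨e, he, h⟩
      refine ⟨(a, b, (G.len s(a, b) : ℝ)) ::ₘ W, ?_, fun x => ?_, ?_⟩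
      · intro f hf
        rcases Multiset.mem_cons.1 hf with rfl | hf
        · refine ⟨.cons (gr_adj.2 ⟨hmem, hab⟩) .nil, ?_⟩
          simp [WGraph.length]
        · exact h1 f hf
      · rw [Multiset.map_cons, Multiset.sum_cons, h2, deg_cons hab]
      · rw [Multiset.map_cons, Multiset.sum_cons, length_cons]
        exact add_le_add le_rfl h3

theorem Routing.flip {F : Multiset (Sym2 ℕ)} {e : Ed} {W : Multiset Ed}
    (h : Routing G F (e ::ₘ W)) : Routing G F ((e.2.1, e.1, e.2.2) ::ₘ W) := by
  refine ⟨fun f hf => ?_, fun x => ?_, ?_⟩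
  · rcases Multiset.mem_cons.1 hf with rfl | hf
    · exact (h.route e (by simp)).symm
    · exact h.route f (by simp [hf])
  · rw [← h.parity x]
    simp [add_comm (ind x e.2.1)]
  · simpa using h.length_le

/-- A closed walk may be omitted. -/
theorem Routing.drop {F : Multiset (Sym2 ℕ)} {a : ℕ} {r : ℝ} {W : Multiset Ed}
    (h : Routing G F ((a, a, r) ::ₘ W)) : Routing G F W := by
  refine ⟨fun f hf => h.route f (by simp [hf]), fun x => ?_, le_trans ?_ h.length_le⟩
  · rw [← h.parity x]
    simp [ind_add_self]
  · obtain ⟨w, hw⟩ := h.route (a, a, r) (by simp)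
    have := (length_nonneg _).trans hw
    simpa using this

/-- Two walks with a common end may be joined. -/
theorem Routing.join {F : Multiset (Sym2 ℕ)} {a b c : ℕ} {r r' : ℝ} {W : Multiset Ed}
    (h : Routing G F ((a, b, r) ::ₘ (a, c, r') ::ₘ W)) :
    Routing G F ((b, c, r + r') ::ₘ W) := by
  refine ⟨fun f hf => ?_, fun x => ?_, ?_⟩
  · rcases Multiset.mem_cons.1 hf with rfl | hf
    · exact (h.route (a, b, r) (by simp)).symm.trans (h.route (a, c, r') (by simp))
    · exact h.route f (by simp [hf])
  · rw [← h.parity x]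
    simp only [Multiset.map_cons, Multiset.sum_cons]
    linear_combination -ind_add_self x a
  · have := h.length_le
    simp only [Multiset.map_cons, Multiset.sum_cons] at this ⊢
    linarith

/-- A routing with the least number of walks: no vertex is an end of two walks. -/
theorem Routing.minimal_ends {F : Multiset (Sym2 ℕ)} {W : Multiset Ed}
    (hmin : ∀ W', Routing G F W' → Multiset.card W ≤ Multiset.card W') {a b : ℕ} {r : ℝ}
    {W₁ : Multiset Ed} (hW : Routing G F ((a, b, r) ::ₘ W₁))
    (hcard : Multiset.card W = Multiset.card W₁ + 1) :
    a ≠ b ∧ ∀ e ∈ W₁, a ≠ e.1 ∧ a ≠ e.2.1 := by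
  refine ⟨?_, fun e he => ?_⟩
  · rintro rfl
    have := hmin _ hW.drop
    omega
  · obtain ⟨W₂, rfl⟩ := Multiset.exists_cons_of_mem he
    obtain ⟨c, d, r'⟩ := e
    rw [Multiset.card_cons] at hcard
    constructor
    · rintro rfl
      have := hmin _ hW.join
      rw [Multiset.card_cons] at this
      omega
    · rintro rfl
      rw [Multiset.cons_swap] at hW
      have h := hW.flip
      rw [Multiset.cons_swap] at h
      have := hmin _ h.join
      rw [Multiset.card_cons] at this
      omega

theorem ind_self (x : ℕ) : ind x x = 1 := if_pos rfl

/-- In a minimal routing, all ends of walks are odd vertices. -/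
theorem Routing.parity_of_minimal {F : Multiset (Sym2 ℕ)} {W : Multiset Ed}
    (hmin : ∀ W', Routing G F W' → Multiset.card W ≤ Multiset.card W') {a b : ℕ} {r : ℝ}
    {W₁ : Multiset Ed} (hW : Routing G F ((a, b, r) ::ₘ W₁))
    (hcard : Multiset.card W = Multiset.card W₁ + 1) : deg F a = 1 := by
  obtain ⟨h1, h2⟩ := Routing.minimal_ends hmin hW hcard
  rw [← hW.parity a, Multiset.map_cons, Multiset.sum_cons, Multiset.sum_eq_zero]
  · simp [ind, h1]
  · intro x hx
    obtain ⟨e, he, rfl⟩ := Multiset.mem_map.1 hx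
    simp [ind, h2 e he]

/-- A `T`-join contains walks that pair up the vertices of `T`, and these can be replaced by
shortest walks. -/
theorem exists_pairing {T : Finset ℕ} (hT : T ⊆ G.V) {F : Multiset (Sym2 ℕ)}
    (hF : G.IsTJoin T F) : ∃ P : List (ℕ × ℕ), P.length ≤ T.card ∧ (∀ q ∈ P, q.1 ∈ T ∧ q.2 ∈ T) ∧
      (∀ x, deg (ms (joinOf (VL G) (EL G) P)) x = deg F x) ∧
      G.length (ms (joinOf (VL G) (EL G) P)) ≤ G.length F := by
  obtain ⟨W, hW, hmin⟩ : ∃ W, Routing G F W ∧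
      ∀ W', Routing G F W' → Multiset.card W ≤ Multiset.card W' := by
    classical
    have hex : ∃ n, ∃ W, Routing G F W ∧ Multiset.card W = n := by
      obtain ⟨W, hW⟩ := exists_routing hF.1
      exact ⟨_, W, hW, rfl⟩
    obtain ⟨W, hW, h⟩ := Nat.find_spec hex
    exact ⟨W, hW, fun W' hW' => h ▸ Nat.find_min' hex ⟨W', hW', rfl⟩⟩
  have hmemT : ∀ x, deg F x = 1 → x ∈ T := by
    intro x hx
    by_contra hxT
    by_cases hxV : x ∈ G.V
    · have := (odd_eq_iff hT).1 hF.2 x hxV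
      rw [if_neg hxT, hx] at this
      exact one_ne_zero this
    · rw [deg_eq_zero_of_notMem hF.1 hxV] at hx
      exact zero_ne_one hx
  have hends : ∀ e ∈ W, e.1 ∈ T ∧ e.2.1 ∈ T := by
    intro e he
    obtain ⟨W₁, rfl⟩ := Multiset.exists_cons_of_mem he
    exact ⟨hmemT _ (Routing.parity_of_minimal hmin (r := e.2.2) hW (Multiset.card_cons _ _)),
      hmemT _ (Routing.parity_of_minimal hmin hW.flip (Multiset.card_cons _ _))⟩
  have hnodup : (W.map fun e => e.1).Nodup := by
    rw [Multiset.nodup_iff_ne_cons_cons]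
    intro a t h
    obtain ⟨e, he, rfl⟩ : ∃ e ∈ W, e.1 = a := by
      have : a ∈ W.map fun e => e.1 := by rw [h]; simp
      simpa using this
    obtain ⟨W₁, rfl⟩ := Multiset.exists_cons_of_mem he
    rw [Multiset.map_cons, Multiset.cons_inj_right] at h
    obtain ⟨e', he', h'⟩ : ∃ e' ∈ W₁, e'.1 = e.1 := by
      have : e.1 ∈ W₁.map fun e => e.1 := by rw [h]; simp
      simpa using this
    exact ((Routing.minimal_ends hmin (r := e.2.2) hW (Multiset.card_cons _ _)).2 e' he').1 h'.symm
  have hcard : Multiset.card W ≤ T.card := by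
    rw [← Multiset.card_map (fun e : Ed => e.1) W, ← Multiset.toFinset_card_of_nodup hnodup]
    refine Finset.card_le_card fun x hx => ?_
    obtain ⟨e, he, rfl⟩ := Multiset.mem_map.1 (Multiset.mem_toFinset.1 hx)
    exact (hends e he).1
  have hwalk : ∀ e ∈ W.toList, (∀ x, deg (ms (walk (VL G) (EL G) e.1 e.2.1)) x =
      ind x e.1 + ind x e.2.1) ∧ G.length (ms (walk (VL G) (EL G) e.1 e.2.1)) ≤ e.2.2 := by
    intro e he
    rw [Multiset.mem_toList] at he
    obtain ⟨w, hw⟩ := (hW.route e he).symm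
    obtain ⟨h1, h2⟩ := walk_spec (fun e he => he) (hT (hends e he).2) w
    exact ⟨h1, h2.trans hw⟩
  refine ⟨W.toList.map fun e => (e.1, e.2.1), by simpa using hcard, ?_, fun x => ?_, ?_⟩
  · intro q hq
    obtain ⟨e, he, rfl⟩ := List.mem_map.1 hq
    exact hends e (Multiset.mem_toList.1 he)
  · rw [← hW.parity x, joinOf, ms_flatMap, deg_list_sum, List.map_map, List.map_map]
    conv_rhs => rw [← Multiset.coe_toList W, Multiset.map_coe, Multiset.sum_coe]
    exact congrArg List.sum (List.map_congr_left fun e he => (hwalk e he).1 x)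
  · refine le_trans ?_ hW.length_le
    rw [joinOf, ms_flatMap, length_list_sum, List.map_map, List.map_map]
    conv_rhs => rw [← Multiset.coe_toList W, Multiset.map_coe, Multiset.sum_coe]
    exact List.sum_le_sum fun e he => (hwalk e he).2

/-! ### Connecting edges -/

/-- If every vertex is connected to one of `n` given vertices, then `n` further edges suffice to
connect everything that can be connected. -/
theorem exists_connecting {M : Multiset (Sym2 ℕ)} (hM : G.IsEdgeMultiset M) (n : ℕ) (D : Finset ℕ)
    (hn : D.card = n) (Q : Multiset (Sym2 ℕ))
    (hD : ∀ v ∈ G.V, ∃ i ∈ D, (gr Q).Reachable i v) :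
    ∃ Y : Multiset (Sym2 ℕ), Multiset.card Y ≤ n ∧ (∀ y ∈ Y, y ∈ M ∧ y ∉ Q) ∧
      ∀ u v, (gr M).Reachable u v → (gr (Q + Y)).Reachable u v := by
  induction n generalizing D Q with
  | zero =>
    refine ⟨0, by simp, by simp, fun u v h => reachable_of_adj (fun a b hab => ?_) h⟩
    obtain ⟨i, hi, -⟩ := hD a (hM.mem_left (gr_adj.1 hab).1)
    simp [Finset.card_eq_zero.1 hn] at hi
  | succ n ih =>
    by_cases h : ∀ a b, (gr M).Adj a b → (gr Q).Reachable a b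
    · exact ⟨0, by simp, by simp, fun u v huv => by simpa using reachable_of_adj h huv⟩
    push Not at h
    obtain ⟨a, b, hab, hnr⟩ := h
    have hm := (gr_adj.1 hab).1
    obtain ⟨i, hi, hia⟩ := hD a (hM.mem_left hm)
    obtain ⟨j, hj, hjb⟩ := hD b (hM.mem_right hm)
    have hij : i ≠ j := by
      rintro rfl
      exact hnr (hia.symm.trans hjb)
    have hle : gr Q ≤ gr (s(a, b) ::ₘ Q) := gr_mono fun x hx => Multiset.mem_cons_of_mem hx
    obtain ⟨Y, h1, h2, h3⟩ := ih (D.erase j) (by rw [Finset.card_erase_of_mem hj, hn]; rfl)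
      (s(a, b) ::ₘ Q) fun v hv => by
        obtain ⟨k, hk, hkv⟩ := hD v hv
        by_cases hkj : k = j
        · subst hkj
          refine ⟨i, Finset.mem_erase.2 ⟨hij, hi⟩, (hia.mono hle).trans ?_⟩
          refine (gr_reachable_of_mem (Multiset.mem_cons_self s(a, b) Q)).trans ?_
          exact (hjb.symm.trans hkv).mono hle
        · exact ⟨k, Finset.mem_erase.2 ⟨hkj, hk⟩, hkv.mono hle⟩
    refine ⟨s(a, b) ::ₘ Y, by simpa using h1, fun y hy => ?_, fun u v huv => ?_⟩
    · rcases Multiset.mem_cons.1 hy with rfl | hy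
      · exact ⟨hm, fun hQ => hnr (gr_reachable_of_mem hQ)⟩
      · exact ⟨(h2 y hy).1, fun hQ => (h2 y hy).2 (Multiset.mem_cons_of_mem hQ)⟩
    · rw [Multiset.add_cons, ← Multiset.cons_add]
      exact h3 u v huv

/-! ### Long edges -/

theorem card_mul_le_length {S : Multiset (Sym2 ℕ)} {θ : ℝ} (h : ∀ x ∈ S, θ ≤ G.len x) :
    Multiset.card S * θ ≤ G.length S := by
  rw [WGraph.length, ← Multiset.card_map (fun e => (G.len e : ℝ)) S, ← nsmul_eq_mul]
  exact Multiset.card_nsmul_le_sum fun x hx => by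
    obtain ⟨e, he, rfl⟩ := Multiset.mem_map.1 hx
    exact h e he

theorem length_le_card_mul {S : Multiset (Sym2 ℕ)} {θ : ℝ} (h : ∀ x ∈ S, G.len x ≤ θ) :
    G.length S ≤ Multiset.card S * θ := by
  rw [WGraph.length, ← Multiset.card_map (fun e => (G.len e : ℝ)) S, ← nsmul_eq_mul]
  exact Multiset.sum_le_card_nsmul _ _ fun x hx => by
    obtain ⟨e, he, rfl⟩ := Multiset.mem_map.1 hx
    exact h e he

open Classical in
/-- The edges of `F` that are longer than `θ`. -/
noncomputable def longEdges (G : WGraph) (F : Multiset (Sym2 ℕ)) (θ : ℝ) : List Ed :=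
  (EL G).filter fun e => decide (sym e ∈ F ∧ θ < e.2.2)

theorem mem_longEdges {F : Multiset (Sym2 ℕ)} {θ : ℝ} {e : Ed} :
    e ∈ longEdges G F θ ↔ e ∈ EL G ∧ sym e ∈ F ∧ θ < e.2.2 := by
  simp [longEdges]

theorem ms_le {S : List Ed} (hS : S ⊆ EL G) (hn : S.Nodup) {F : Multiset (Sym2 ℕ)}
    (h : ∀ e ∈ S, sym e ∈ F) : ms S ≤ F := by
  refine (Multiset.le_iff_subset ?_).2 fun x hx => ?_
  · rw [ms, Multiset.coe_nodup]
    exact hn.map_on fun a ha b hb hab => sym_injOn (hS ha) (hS hb) hab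
  · obtain ⟨e, he, rfl⟩ := mem_ms.1 hx
    exact h e he

/-- There is a threshold for which the number of edges of `F` above it is small, and `m` edges
below it are short in comparison with `F`. -/
theorem exists_threshold {F : Multiset (Sym2 ℕ)} {δ : ℝ} (hδ : 0 < δ)
    (m : ℕ) : ∃ θ : ℝ, 0 ≤ θ ∧ (longEdges G F θ).length * δ ≤ 8 * m ∧
      8 * (m * θ) ≤ δ * G.length F := by
  have hle : ∀ θ : ℝ, (longEdges G F θ).length * θ ≤ G.length F := by
    intro θ
    have h1 : ms (longEdges G F θ) ≤ F := by
      refine ms_le (G := G) (fun e he => (mem_longEdges.1 he).1) (nodup_EL.filter _) ?_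
      exact fun e he => (mem_longEdges.1 he).2.1
    have h2 : ∀ x ∈ ms (longEdges G F θ), θ ≤ G.len x := by
      intro x hx
      obtain ⟨e, he, rfl⟩ := mem_ms.1 hx
      obtain ⟨h3, -, h4⟩ := mem_longEdges.1 he
      rw [← (mem_EL.1 h3).2.2]
      exact h4.le
    have h3 := card_mul_le_length h2
    rw [ms, Multiset.coe_card, List.length_map] at h3
    exact h3.trans (length_mono h1)
  have hnil : longEdges G F (G.length F) = [] := by
    refine List.eq_nil_iff_forall_not_mem.2 fun e he => ?_
    obtain ⟨h1, h2, h3⟩ := mem_longEdges.1 he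
    obtain ⟨F', rfl⟩ := Multiset.exists_cons_of_mem h2
    rw [length_cons, (mem_EL.1 h1).2.2] at h3
    have := length_nonneg (G := G) F'
    linarith
  rcases Nat.eq_zero_or_pos m with rfl | hm
  · exact ⟨G.length F, length_nonneg F, by simp [hnil],
      by simpa using mul_nonneg hδ.le (length_nonneg F)⟩
  have hm' : (0 : ℝ) < m := Nat.cast_pos.2 hm
  rcases (length_nonneg (G := G) F).eq_or_lt with h0 | h0
  · exact ⟨G.length F, length_nonneg F, by simp [hnil], by simp [← h0]⟩
  · refine ⟨δ * G.length F / (8 * m), by positivity, ?_, le_of_eq (by field_simp)⟩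
    have h1 := hle (δ * G.length F / (8 * m))
    set L : ℝ := ((longEdges G F (δ * G.length F / (8 * m))).length : ℝ)
    rw [mul_div_assoc', div_le_iff₀ (by positivity)] at h1
    have h2 : (L * δ) * G.length F ≤ (8 * m) * G.length F := by linarith
    exact le_of_mul_le_mul_right h2 h0

/-- A threshold may be replaced by the length of the longest edge that does not exceed it; the list
`l` is empty if there is none. -/
theorem exists_thresholdEdge (G : WGraph) (θ : ℝ) : ∃ l : List Ed, l.length ≤ 1 ∧ l ⊆ EL G ∧
    ∀ e ∈ EL G, (l.any fun a => decide (e.2.2 ≤ a.2.2)) = true ↔ e.2.2 ≤ θ := by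
  classical
  by_cases h : ((EL G).toFinset.filter fun e => e.2.2 ≤ θ).Nonempty
  · obtain ⟨a, ha, hmax⟩ := Finset.exists_max_image _ (fun e : Ed => e.2.2) h
    simp only [Finset.mem_filter, List.mem_toFinset] at ha hmax
    refine ⟨[a], by simp, by simp [ha.1], fun e he => ?_⟩
    simp only [List.any_cons, List.any_nil, Bool.or_false, decide_eq_true_eq]
    exact ⟨fun h => h.trans ha.2, fun h => hmax e ⟨he, h⟩⟩
  · refine ⟨[], by simp, by simp, fun e he => ?_⟩
    simp only [List.any_nil, Bool.false_eq_true, false_iff]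
    exact fun hle => h ⟨e, by simp [he, hle]⟩

/-- The list is as long as the subtraction of `δ` from `8 |I|` can be repeated, but not longer
than `E`. -/
theorem budget_spec (I : List ℕ) (E : List Ed) {δ : ℝ} :
    (budget I E δ).length ≤ E.length ∧ (budget I E δ).length * δ ≤ 8 * I.length ∧
      ∀ n : ℕ, n ≤ E.length → n * δ ≤ 8 * I.length → n ≤ (budget I E δ).length := by
  have h8 : I.foldl (fun (r : ℝ) _ => r + ((8 : ℕ) : ℝ)) 0 = 8 * I.length := by
    induction I using List.reverseRecOn with
    | nil => simp
    | append_singleton l a ih =>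
      rw [List.foldl_append, List.foldl_cons, List.foldl_nil, ih]
      push_cast [List.length_append, List.length_singleton]
      ring
  rw [budget, h8]
  set r₀ : ℝ := 8 * I.length with hr₀
  have h0 : 0 ≤ r₀ := by positivity
  have key : ∀ l : List Ed, ∃ st : ℝ × List Ed, l.foldl (fun (st : ℝ × List Ed) e =>
      if decide (δ ≤ st.1) then (st.1 - δ, e :: st.2) else st) (r₀, []) = st ∧
      st.1 = r₀ - st.2.length * δ ∧ 0 ≤ st.1 ∧ st.2.length ≤ l.length ∧
      (st.2.length = l.length ∨ st.1 < δ) := by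
    intro l
    induction l using List.reverseRecOn with
    | nil => exact ⟨_, rfl, by simp, h0, by simp, .inl rfl⟩
    | append_singleton l a ih =>
      obtain ⟨st, h1, h2, h3, h4, h5⟩ := ih
      rw [List.foldl_append, List.foldl_cons, List.foldl_nil, h1]
      by_cases h : δ ≤ st.1
      · rw [if_pos (by simpa using h)]
        refine ⟨_, rfl, ?_, by simpa using h, by simpa using h4, .inl ?_⟩
        · rw [h2]; push_cast [List.length_cons]; ring
        · rcases h5 with h5 | h5
          · simp [h5]
          · linarith
      · rw [if_neg (by simpa using h)]
        exact ⟨_, rfl, h2, h3, by simp; omega, .inr (not_le.1 h)⟩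
  obtain ⟨st, h1, h2, h3, h4, h5⟩ := key E
  rw [h1]
  refine ⟨h4, by linarith, fun n hn hle => ?_⟩
  rcases h5 with h5 | h5
  · omega
  · by_contra hlt
    have h6 : (st.2.length : ℝ) + 1 ≤ n := by exact_mod_cast not_le.1 hlt
    nlinarith

/-! ### Parity corrections inside the components -/

theorem sameEnds_iff {e f : Ed} (he : e ∈ EL G) (hf : f ∈ EL G) :
    sameEnds f e = true ↔ f = e := by
  rw [sameEnds, Bool.and_eq_true, beq_iff_eq, beq_iff_eq]
  exact ⟨fun h => sym_injOn hf he (by rw [sym, sym, h.1, h.2]), fun h => by rw [h]; simp⟩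

theorem odds_sameEnds {W : List Ed} (hW : W ⊆ EL G) {e : Ed} (he : e ∈ EL G) [DecidableEq Ed] :
    odds (fun f => sameEnds f e) W = true ↔ Odd (W.countP fun f => decide (f = e)) := by
  rw [odds_eq, decide_eq_true_iff]
  refine iff_of_eq (congrArg _ (List.countP_congr fun f hf => ?_))
  rw [sameEnds_iff he (hW hf), decide_eq_true_iff]

theorem mem_of_mem_oddPart {W : List Ed} (hW : W ⊆ EL G) {e : Ed} (h : e ∈ oddPart (EL G) W) :
    e ∈ W := by
  classical
  obtain ⟨h1, h2⟩ := List.mem_filter.1 h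
  obtain ⟨f, hf, hfe⟩ := List.countP_pos_iff.1 ((odds_sameEnds hW h1).1 h2).pos
  exact of_decide_eq_true hfe ▸ hf

/-- Elements that occur an even number of times do not contribute to a sum modulo two. -/
theorem sum_filter_odd {γ : Type} [DecidableEq γ] {E W : List γ} (hE : E.Nodup) (hW : W ⊆ E)
    {g : γ → Bool} (hg : ∀ e ∈ E, g e = true ↔ Odd (W.countP fun f => decide (f = e)))
    (f : γ → ZMod 2) : ((E.filter g).map f).sum = (W.map f).sum := by
  have h1 : W.toFinset ⊆ E.toFinset := fun e he => by simpa using hW (by simpa using he)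
  rw [Finset.sum_list_map_count W, Finset.sum_subset h1 fun e _ he => by
      rw [List.count_eq_zero_of_not_mem (by simpa using he), zero_smul],
    ← List.sum_toFinset _ (hE.filter _), List.toFinset_filter, Finset.sum_filter]
  refine Finset.sum_congr rfl fun e he => ?_
  have hc : W.count e = W.countP fun f => decide (f = e) := by
    rw [List.count_eq_countP]
    exact List.countP_congr fun _ _ => by simp
  have h2 := hg e (by simpa using he)
  rw [← hc] at h2
  rw [nsmul_eq_mul]
  by_cases h : Odd (W.count e)
  · rw [if_pos (h2.2 h), ZMod.natCast_eq_one_iff_odd.2 h, one_mul]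
  · rw [if_neg (mt h2.1 h), ZMod.natCast_eq_zero_iff_even.2 (Nat.not_odd_iff_even.1 h), zero_mul]

/-- Counting the edges of `W` modulo two does not change parities. -/
theorem deg_oddPart {W : List Ed} (hW : W ⊆ EL G) (x : ℕ) :
    deg (ms (oddPart (EL G) W)) x = deg (ms W) x := by
  classical
  have key : ∀ l : List Ed, deg (ms l) x =
      (l.map fun e => if x ∈ sym e then (1 : ZMod 2) else 0).sum := by
    intro l
    rw [deg_eq_sum, ms, Multiset.map_coe, Multiset.sum_coe, List.map_map]
    rfl
  rw [key, key]
  exact sum_filter_odd nodup_EL hW (fun e he => odds_sameEnds hW he) _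

/-- The number of odd vertices in a union of components is even. -/
theorem sum_deg_eq_zero {Q : Multiset (Sym2 ℕ)} (hQ : G.IsEdgeMultiset Q) (C : Finset ℕ)
    (hC : ∀ a b, s(a, b) ∈ Q → (a ∈ C ↔ b ∈ C)) : ∑ v ∈ C, deg Q v = 0 := by
  induction Q using Multiset.induction_on with
  | empty => simp
  | cons e Q ih =>
    induction e with
    | _ a b =>
      have h1 := ih (fun x hx => hQ x (Multiset.mem_cons_of_mem hx))
        fun a b h => hC a b (Multiset.mem_cons_of_mem h)
      simp only [deg_cons (hQ.ne (Multiset.mem_cons_self s(a, b) Q)), Finset.sum_add_distrib, h1,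
        ind, Finset.sum_ite_eq', hC a b (Multiset.mem_cons_self s(a, b) Q)]
      split
      · rw [add_zero]; exact CharTwo.add_self_eq_zero 1
      · simp

theorem treeWalks_subset {EH K : List Ed} (hK : K ⊆ EL G) (T : List ℕ) :
    treeWalks (VL G) EH K T ⊆ K := by
  intro e he
  obtain ⟨s, -, he⟩ := List.mem_flatMap.1 he
  split at he
  · obtain ⟨t, -, he⟩ := List.mem_flatMap.1 he
    exact walk_subset hK he
  · simp at he

theorem sum_map_sort {β : Type} [AddCommMonoid β] (S : Finset ℕ) (f : ℕ → β) :
    ((S.sort (· ≤ ·)).map f).sum = ∑ v ∈ S, f v := by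
  rw [← List.sum_toFinset _ (Finset.sort_nodup _ _), Finset.sort_toFinset]

/-- The walks from the least vertices of the components to the vertices of `T` have the parities of
any `T`-join whose edges do not leave the components. -/
theorem deg_treeWalks {T : Finset ℕ} (hT : T ⊆ G.V) {EH K : List Ed} (hEH : EH ⊆ EL G)
    (hK : K ⊆ EL G) (hreach : ∀ u v, (gr (ms EH)).Reachable u v ↔ (gr (ms K)).Reachable u v)
    {Q : Multiset (Sym2 ℕ)} (hQ : ∀ x ∈ Q, x ∈ ms EH)
    (hodd : ∀ v ∈ G.V, deg Q v = if v ∈ T then 1 else 0) {x : ℕ} (hx : x ∈ G.V) :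
    deg (ms (treeWalks (VL G) EH K (T.sort (· ≤ ·)))) x = if x ∈ T then 1 else 0 := by
  classical
  have hwalk : ∀ s, ∀ t ∈ T, deg (ms (walk (VL G) K s t)) x =
      if (gr (ms EH)).Reachable s t then ind x s + ind x t else 0 := by
    intro s t ht
    split
    · rename_i h
      obtain ⟨w⟩ := ((hreach _ _).1 h).symm
      exact (walk_spec hK (hT ht) w).1 x
    · rename_i h
      rw [walk_eq_nil hK fun h' => h ((hreach _ _).2 h')]
      rfl
  have h1 : deg (ms (treeWalks (VL G) EH K (T.sort (· ≤ ·)))) x =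
      ∑ t ∈ T, ∑ s ∈ G.V, if isRep (VL G) EH s = true ∧ (gr (ms EH)).Reachable s t
        then ind x s + ind x t else 0 := by
    rw [treeWalks, ms_flatMap, deg_list_sum, List.map_map, VL, sum_map_sort, Finset.sum_comm]
    refine Finset.sum_congr rfl fun s _ => ?_
    simp only [Function.comp_apply]
    split
    · rename_i h
      rw [ms_flatMap, deg_list_sum, List.map_map, sum_map_sort]
      refine Finset.sum_congr rfl fun t ht => ?_
      simp only [Function.comp_apply, h, true_and]
      exact hwalk s t ht
    · rename_i h
      rw [Bool.not_eq_true] at h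
      simp [h]
  have h2 : ∀ t ∈ T, (∑ s ∈ G.V, if isRep (VL G) EH s = true ∧ (gr (ms EH)).Reachable s t
        then ind x s + ind x t else 0) =
      ind x t + if isRep (VL G) EH x = true ∧ (gr (ms EH)).Reachable x t then 1 else 0 := by
    intro t ht
    obtain ⟨s, hs, hrep, hst⟩ := exists_rep hEH (hT ht)
    rw [Finset.sum_eq_single s]
    · rw [if_pos ⟨hrep, hst⟩, add_comm]
      congr 1
      by_cases hxs : x = s
      · subst hxs; rw [if_pos ⟨hrep, hst⟩, ind_self]
      · rw [ind, if_neg hxs, if_neg]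
        exact fun h => hxs (rep_unique hEH hx hs h.1 hrep (h.2.trans hst.symm))
    · intro s' hs' hne
      rw [if_neg]
      exact fun h => hne (rep_unique hEH hs' hs h.1 hrep (h.2.trans hst.symm))
    · exact fun h => absurd hs h
  rw [h1, Finset.sum_congr rfl h2, Finset.sum_add_distrib]
  have h3 : ∑ t ∈ T, ind x t = if x ∈ T then 1 else 0 := by
    simp only [ind]
    rw [Finset.sum_ite_eq]
  rw [h3, add_eq_left]
  by_cases hrep : isRep (VL G) EH x = true
  · have h4 := sum_deg_eq_zero (fun y hy => isEdgeMultiset_ms hEH y (hQ y hy))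
      (G.V.filter fun v => (gr (ms EH)).Reachable x v) fun a b hab => by
        have hm := hQ _ hab
        have hF := isEdgeMultiset_ms hEH
        simp only [Finset.mem_filter, hF.mem_left hm, hF.mem_right hm, true_and]
        have := gr_reachable_of_mem hm
        exact ⟨fun h => h.trans this, fun h => h.trans this.symm⟩
    refine Eq.trans ?_ h4
    rw [Finset.sum_filter, ← Finset.sum_subset hT fun v hv hvT => by
      rw [hodd v hv, if_neg hvT, ite_self]]
    refine Finset.sum_congr rfl fun t ht => ?_
    rw [hodd t (hT ht), if_pos ht]
    simp [hrep]
  · exact Finset.sum_eq_zero fun t _ => if_neg fun h => hrep h.1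

end Join

/-! ### The right guess -/

section Main
variable {G : WGraph} {Φ : Interface G} {α δ : ℝ} {O : List ℕ → List Ed → List (ℕ × ℕ)}

theorem guessed_sublist (E S θ J : List Ed) : (guessed E S θ J).Sublist E := List.filter_sublist

theorem joinOf_subset (P : List (ℕ × ℕ)) : joinOf (VL G) (EL G) P ⊆ EL G := by
  intro e he
  obtain ⟨q, -, he⟩ := List.mem_flatMap.1 he
  exact walk_subset (fun e he => he) he

theorem candidate_subset (hO : GoodOracle α O G) (hα : 0 ≤ α) (T : List ℕ) (S θ : List Ed)
    (P : List (ℕ × ℕ)) : candidate O (VL G) (EL G) T δ S θ P ⊆ EL G := by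
  refine List.append_subset.2 ⟨fun e he => ?_, ?_⟩
  · exact (guessed_sublist _ _ _ _).subset ((tours_spec hO hα (guessed_sublist _ _ _ _)).1 he)
  · split
    · exact List.filter_subset_self _
    · exact joinOf_subset P

/-- For the right guess, the guessed edges contain the given tour, and few and short further edges
connect all that the guessed edges can connect. -/
theorem exists_guess (hδ : 0 < δ) {OPT : Multiset (Sym2 ℕ)} (hOPT : IsPhiTour G Φ OPT)
    {J : List Ed} (hJ : J ⊆ EL G) :
    ∃ S ∈ seqs (EL G) (budget (Φ.I.sort (· ≤ ·)) (EL G) δ), ∃ θ ∈ seqs (EL G) [false],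
      (∀ x ∈ OPT, x ∈ ms (guessed (EL G) S θ J)) ∧ J ⊆ guessed (EL G) S θ J ∧
      ∃ Y : Multiset (Sym2 ℕ), (∀ y ∈ Y, y ∈ ms (guessed (EL G) S θ J)) ∧
        8 * G.length Y ≤ δ * G.length OPT ∧ ∀ u v, (gr (ms (guessed (EL G) S θ J))).Reachable u v →
          (gr (OPT + ms J + Y)).Reachable u v := by
  have hV := feasible_nonempty hOPT
  have hOE := hOPT.1.1
  obtain ⟨r, hr0, hr1, hr2⟩ := exists_threshold (G := G) (F := OPT) hδ Φ.I.card
  obtain ⟨θ, hθ1, hθ2, hθ3⟩ := exists_thresholdEdge G r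
  set S := longEdges G OPT r with hS
  have hSsub : S ⊆ EL G := fun e he => (mem_longEdges.1 he).1
  have hmem : ∀ e ∈ EL G, e ∈ guessed (EL G) S θ J ↔ e ∈ S ∨ e ∈ J ∨ e.2.2 ≤ r := by
    intro e he
    have h1 : ∀ L : List Ed, L ⊆ EL G → ((L.any fun f => sameEnds f e) = true ↔ e ∈ L) := by
      intro L hL
      rw [List.any_eq_true]
      exact ⟨fun ⟨f, hf, h⟩ => (sameEnds_iff he (hL hf)).1 h ▸ hf,
        fun h => ⟨e, h, (sameEnds_iff he he).2 rfl⟩⟩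
    rw [guessed, List.mem_filter, Bool.or_eq_true, Bool.or_eq_true, h1 S hSsub, h1 J hJ,
      hθ3 e he, or_assoc]
    simp [he]
  have hOPTsub : ∀ x ∈ OPT, x ∈ ms (guessed (EL G) S θ J) := by
    intro x hx
    obtain ⟨e, he, rfl⟩ := exists_mem_EL (hOE x hx)
    refine mem_ms.2 ⟨e, (hmem e he).2 ?_, rfl⟩
    rcases le_or_gt e.2.2 r with h | h
    · exact .inr (.inr h)
    · exact .inl (mem_longEdges.2 ⟨he, hx, h⟩)
  have hJsub : J ⊆ guessed (EL G) S θ J := fun e he => (hmem e (hJ he)).2 (.inr (.inl he))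
  have hM : G.IsEdgeMultiset (ms (guessed (EL G) S θ J)) :=
    isEdgeMultiset_ms (guessed_sublist _ _ _ _).subset
  obtain ⟨Y, hY1, hY2, hY3⟩ : ∃ Y : Multiset (Sym2 ℕ), Multiset.card Y ≤ Φ.I.card ∧
      (∀ y ∈ Y, y ∈ ms (guessed (EL G) S θ J) ∧ y ∉ OPT + ms J) ∧
      ∀ u v, (gr (ms (guessed (EL G) S θ J))).Reachable u v →
        (gr (OPT + ms J + Y)).Reachable u v := by
    have hle : gr OPT ≤ gr (OPT + ms J) := gr_mono fun x hx => Multiset.mem_add.2 (.inl hx)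
    rcases ((isPhiTour_iff hV hOE).1 hOPT).2.1 with h | h
    · refine ⟨0, by simp, by simp, fun u v huv => reachable_of_adj (fun a b hab => ?_) huv⟩
      have hab' := (gr_adj.1 hab).1
      rw [add_zero]
      exact (h a (hM.mem_left hab') b (hM.mem_right hab')).mono hle
    · exact exists_connecting hM _ Φ.I rfl _ fun v hv =>
        let ⟨i, hi, hiv⟩ := h v hv
        ⟨i, hi, hiv.mono hle⟩
  refine ⟨S, mem_seqs.2 ⟨?_, hSsub⟩, θ, mem_seqs.2 ⟨hθ1, hθ2⟩, hOPTsub, hJsub, Y,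
    fun y hy => (hY2 y hy).1, ?_, hY3⟩
  · refine (budget_spec _ _).2.2 _ (List.length_filter_le _ _) ?_
    simpa using hr1
  · -- the connecting edges are not among the long ones, since those are in the tour
    have h1 : ∀ y ∈ Y, G.len y ≤ r := by
      intro y hy
      obtain ⟨h2, h3⟩ := hY2 y hy
      obtain ⟨e, he, rfl⟩ := mem_ms.1 h2
      have he' := (guessed_sublist _ _ _ _).subset he
      rw [← (mem_EL.1 he').2.2]
      rcases (hmem e he').1 he with h | h | h
      · exact absurd (Multiset.mem_add.2 (.inl (mem_longEdges.1 h).2.1)) h3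
      · exact absurd (Multiset.mem_add.2 (.inr (mem_ms.2 ⟨e, h, rfl⟩))) h3
      · exact h
    have h2 := length_le_card_mul h1
    have h3 : (Multiset.card Y : ℝ) * r ≤ Φ.I.card * r :=
      mul_le_mul_of_nonneg_right (by exact_mod_cast hY1) hr0
    linarith

theorem gr_reachable_mono {F F' : Multiset (Sym2 ℕ)} (h : ∀ x ∈ F, x ∈ F') {u v : ℕ}
    (hr : (gr F).Reachable u v) : (gr F').Reachable u v := hr.mono (gr_mono h)

/-- Adding edges with the right parities to the tours of the components yields a `Φ`-tour, since
the components contain those of a `Φ`-tour. -/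
theorem isPhiTour_append {OPT : Multiset (Sym2 ℕ)} (hOPT : IsPhiTour G Φ OPT) {EH K X : List Ed}
    (hK : K ⊆ EL G) (hX : X ⊆ EL G) (hsub : ∀ x ∈ OPT, x ∈ ms EH)
    (hreach : ∀ u v, (gr (ms EH)).Reachable u v → (gr (ms K)).Reachable u v)
    (hK0 : ∀ x, deg (ms K) x = 0) (hXT : ∀ v ∈ G.V, deg (ms X) v = if v ∈ Φ.T then 1 else 0) :
    IsPhiTour G Φ (ms (K ++ X)) := by
  have hV := feasible_nonempty hOPT
  obtain ⟨-, h2, h3⟩ := (isPhiTour_iff hV hOPT.1.1).1 hOPT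
  have key : ∀ u v, (gr OPT).Reachable u v → (gr (ms (K ++ X))).Reachable u v := fun u v h =>
    gr_reachable_mono (ms_mono (List.subset_append_left _ _))
      (hreach u v (gr_reachable_mono hsub h))
  refine (isPhiTour_iff hV (isEdgeMultiset_ms (List.append_subset.2 ⟨hK, hX⟩))).2
    ⟨fun v hv => by rw [ms_append, deg_add, hK0, hXT v hv, zero_add], ?_,
      fun C hC u hu v hv => key u v (h3 C hC u hu v hv)⟩
  exact h2.imp (fun h u hu v hv => key u v (h u hu v hv))
    fun h v hv => let ⟨i, hi, hiv⟩ := h v hv; ⟨i, hi, key i v hiv⟩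

theorem mem_candidates {S θ : List Ed} {P : List (ℕ × ℕ)} {V I T : List ℕ} {E : List Ed}
    (hS : S ∈ seqs E (budget I E δ)) (hθ : θ ∈ seqs E [false])
    (hP : P ∈ seqs (pairsOf T) (pairBudget T δ)) :
    candidate O V E T δ S θ P ∈ candidates O V E I T δ :=
  List.mem_flatMap.2 ⟨S, hS, List.mem_flatMap.2 ⟨θ, hθ, List.mem_map.2 ⟨P, hP, rfl⟩⟩⟩

theorem deg_eq_of_isTJoin {T : Finset ℕ} (hT : T ⊆ G.V) {F : Multiset (Sym2 ℕ)}
    (hF : G.IsTJoin T F) (x : ℕ) : deg F x = if x ∈ T then 1 else 0 := by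
  by_cases hx : x ∈ G.V
  · exact (odd_eq_iff hT).1 hF.2 x hx
  · rw [deg_eq_zero_of_notMem hF.1 hx, if_neg fun h => hx (hT h)]

/-- For the right guess, the candidate is a `Φ`-tour that is short enough. -/
theorem exists_candidate (hO : GoodOracle α O G) (hα : 1 < α) (hδ : 0 < δ)
    {OPT J : Multiset (Sym2 ℕ)} (hOPT : IsPhiTour G Φ OPT) (hJ : G.IsTJoin Φ.T J) :
    ∃ F ∈ candidates O (VL G) (EL G) (Φ.I.sort (· ≤ ·)) (Φ.T.sort (· ≤ ·)) δ,
      IsPhiTour G Φ (ms F) ∧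
      G.length (ms F) ≤ (1 + δ) * α * G.length OPT + (α + 1) * G.length J := by
  have hα0 : 0 ≤ α := by linarith
  have hT : Φ.T ⊆ G.V := Φ.T_subset.trans Φ.I_subset
  have hOPT0 := length_nonneg (G := G) OPT
  have hJ0 := length_nonneg (G := G) J
  have hdegOPT := deg_eq_of_isTJoin hT hOPT.1
  by_cases h6 : 6 ≤ δ
  · obtain ⟨S, hS, θ, hθ, h1, -, Y, h2, h3, h4⟩ :=
      exists_guess hδ hOPT (J := []) (List.nil_subset _)
    obtain ⟨k1, k2, k3, k4⟩ :=
      tours_spec hO hα0 (guessed_sublist (EL G) S θ [])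
    have hEH : guessed (EL G) S θ [] ⊆ EL G := (guessed_sublist _ _ _ _).subset
    set EH := guessed (EL G) S θ []
    set K := tours O (VL G) EH
    have hK : K ⊆ EL G := fun e he => hEH (k1 he)
    set W := treeWalks (VL G) EH K (Φ.T.sort (· ≤ ·))
    have hWK : W ⊆ K := treeWalks_subset hK _
    have hW : W ⊆ EL G := fun e he => hK (hWK he)
    have hXW : ∀ e ∈ oddPart (EL G) W, e ∈ W := fun e he => mem_of_mem_oddPart hW he
    have hcand : candidate O (VL G) (EL G) (Φ.T.sort (· ≤ ·)) δ S θ [] =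
        K ++ oddPart (EL G) W := by
      simp only [candidate, joinOf, List.flatMap_nil]
      rw [if_pos (by simpa using h6)]
    refine ⟨K ++ oddPart (EL G) W, hcand ▸ mem_candidates hS hθ (mem_seqs.2 ⟨by simp, by simp⟩),
      ?_, ?_⟩
    · refine isPhiTour_append hOPT hK (fun e he => hW (hXW e he)) h1 k3 k2 fun v hv => ?_
      rw [deg_oddPart hW]
      exact deg_treeWalks hT hEH hK (fun u v => ⟨k3 u v, gr_reachable_mono (ms_mono k1)⟩) h1
        (fun v _ => hdegOPT v) hv
    · have h5 := k4 (OPT + OPT + (Y + Y)) ?_ ?_ ?_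
      · have h7 : G.length (ms (oddPart (EL G) W)) ≤ G.length (ms K) :=
          length_mono (ms_le (G := G) (fun e he => hW (hXW e he)) (nodup_EL.filter _)
            fun e he => mem_ms.2 ⟨e, hWK (hXW e he), rfl⟩)
        rw [ms_append, length_add]
        rw [length_add, length_add, length_add] at h5
        have h8 : α * (8 * G.length Y) ≤ α * (δ * G.length OPT) :=
          mul_le_mul_of_nonneg_left h3 hα0
        -- the total is at most `2 α (2 + δ / 4) ℓ(OPT)`, and `4 + δ / 2 ≤ 1 + δ`
        have h9 : 0 ≤ α * G.length OPT := mul_nonneg hα0 hOPT0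
        have h10 : 6 * (α * G.length OPT) ≤ δ * (α * G.length OPT) :=
          mul_le_mul_of_nonneg_right h6 h9
        have h11 : 0 ≤ (α + 1) * G.length J := mul_nonneg (by linarith) hJ0
        linarith
      · intro x hx
        simp only [Multiset.mem_add] at hx
        rcases hx with (hx | hx) | (hx | hx)
        exacts [h1 x hx, h1 x hx, h2 x hx, h2 x hx]
      · intro x
        simp only [deg_add]
        rw [CharTwo.add_self_eq_zero, CharTwo.add_self_eq_zero, add_zero]
      · intro u v huv
        refine gr_reachable_mono (fun x hx => ?_) (h4 u v huv)
        simp only [Multiset.mem_add, ms_nil, Multiset.notMem_zero] at hx ⊢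
        tauto
  · obtain ⟨P, p1, p2, p3, p4⟩ := exists_pairing hT hJ
    set L := joinOf (VL G) (EL G) P with hL
    have hLsub : L ⊆ EL G := joinOf_subset P
    obtain ⟨S, hS, θ, hθ, h1, hLH, Y, h2, h3, h4⟩ := exists_guess hδ hOPT hLsub
    obtain ⟨k1, k2, k3, k4⟩ :=
      tours_spec hO hα0 (guessed_sublist (EL G) S θ L)
    have hEH : guessed (EL G) S θ L ⊆ EL G := (guessed_sublist _ _ _ _).subset
    set EH := guessed (EL G) S θ L
    set K := tours O (VL G) EH
    have hcand : candidate O (VL G) (EL G) (Φ.T.sort (· ≤ ·)) δ S θ P = K ++ L := by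
      rw [candidate, if_neg (by simpa using h6)]
    have hP : P ∈ seqs (pairsOf (Φ.T.sort (· ≤ ·))) (pairBudget (Φ.T.sort (· ≤ ·)) δ) := by
      rw [mem_seqs, pairBudget, if_neg (by simpa using h6)]
      refine ⟨by simpa using p1, fun q hq => ?_⟩
      obtain ⟨ha, hb⟩ := p2 q hq
      exact List.mem_flatMap.2 ⟨q.1, by simpa using ha,
        List.mem_map.2 ⟨q.2, by simpa using hb, rfl⟩⟩
    refine ⟨K ++ L, hcand ▸ mem_candidates hS hθ hP, ?_, ?_⟩
    · refine isPhiTour_append hOPT (fun e he => hEH (k1 he)) hLsub h1 k3 k2 fun v hv => ?_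
      rw [p3, deg_eq_of_isTJoin hT hJ]
    · have h5 := k4 (OPT + ms L + (Y + Y)) ?_ ?_ ?_
      · rw [ms_append, length_add]
        rw [length_add, length_add, length_add] at h5
        have h8 : α * (8 * G.length Y) ≤ α * (δ * G.length OPT) :=
          mul_le_mul_of_nonneg_left h3 hα0
        have h9 : 0 ≤ α * (δ * G.length OPT) := mul_nonneg hα0 (mul_nonneg hδ.le hOPT0)
        have h10 : (α + 1) * G.length (ms L) ≤ (α + 1) * G.length J :=
          mul_le_mul_of_nonneg_left p4 (by linarith)
        linarith
      · intro x hx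
        simp only [Multiset.mem_add] at hx
        rcases hx with (hx | hx) | (hx | hx)
        exacts [h1 x hx, ms_mono hLH x hx, h2 x hx, h2 x hx]
      · intro x
        simp only [deg_add]
        rw [p3, hdegOPT, deg_eq_of_isTJoin hT hJ, CharTwo.add_self_eq_zero,
          CharTwo.add_self_eq_zero, add_zero]
      · intro u v huv
        refine gr_reachable_mono (fun x hx => ?_) (h4 u v huv)
        simp only [Multiset.mem_add] at hx ⊢
        tauto

theorem mem_partList {C : Finset ℕ} : C ∈ Φ.partList ↔ C ∈ Φ.C.parts := by
  simp only [Interface.partList, List.mem_map, List.mem_filter, Finset.mem_sort, decide_eq_true_eq]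
  constructor
  · rintro ⟨i, ⟨hi, -⟩, rfl⟩
    exact Φ.C.part_mem.2 hi
  · intro hC
    have hne := Φ.C.nonempty_of_mem_parts hC
    have hm := Finset.min'_mem C hne
    have hpart : Φ.C.part (C.min' hne) = C := Φ.C.part_eq_of_mem hC hm
    exact ⟨C.min' hne, ⟨Φ.C.le hC hm, fun j hj => Finset.min'_le _ _ (hpart ▸ hj)⟩, hpart⟩

/-- The output of the algorithm. -/
theorem solve_spec (hO : GoodOracle α O G) (hα : 1 < α) (hδ : 0 < δ)
    {OPT J : Multiset (Sym2 ℕ)} (hOPT : IsPhiTour G Φ OPT) (hJ : G.IsTJoin Φ.T J) :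
    ∃ F : List Ed, solve O (VL G) (EL G) (Φ.I.sort (· ≤ ·)) (Φ.T.sort (· ≤ ·))
        (Φ.partList.map fun C => C.sort (· ≤ ·)) δ = F.map (fun e => (e.1, e.2.1)) ∧
      IsPhiTour G Φ (ms F) ∧
      G.length (ms F) ≤ (1 + δ) * α * G.length OPT + (α + 1) * G.length J := by
  have hV := feasible_nonempty hOPT
  have hα0 : 0 ≤ α := by linarith
  obtain ⟨F, hF, hF1, hF2⟩ := exists_candidate hO hα hδ hOPT hJ
  have hsub : ∀ F ∈ candidates O (VL G) (EL G) (Φ.I.sort (· ≤ ·)) (Φ.T.sort (· ≤ ·)) δ,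
      F ⊆ EL G := by
    intro F hF
    obtain ⟨S, -, hF⟩ := List.mem_flatMap.1 hF
    obtain ⟨θ, -, hF⟩ := List.mem_flatMap.1 hF
    obtain ⟨P, -, rfl⟩ := List.mem_map.1 hF
    exact candidate_subset hO hα0 _ _ _ _
  have hcheck : ∀ F ⊆ EL G, check (VL G) (Φ.I.sort (· ≤ ·)) (Φ.T.sort (· ≤ ·))
      (Φ.partList.map fun C => C.sort (· ≤ ·)) F = true ↔ IsPhiTour G Φ (ms F) := by
    intro F hF
    refine check_iff hV Φ hF (by simp) (by simp) fun P => ?_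
    simp [mem_partList]
  set l := ((candidates O (VL G) (EL G) (Φ.I.sort (· ≤ ·)) (Φ.T.sort (· ≤ ·)) δ).filter fun F =>
    check (VL G) (Φ.I.sort (· ≤ ·)) (Φ.T.sort (· ≤ ·))
      (Φ.partList.map fun C => C.sort (· ≤ ·)) F).map fun F => (total F, F) with hl
  have hmem : (total F, F) ∈ l := List.mem_map.2
    ⟨F, List.mem_filter.2 ⟨hF, (hcheck F (hsub F hF)).2 hF1⟩, rfl⟩
  obtain ⟨c, hc, hle⟩ := exists_best_le hmem
  obtain ⟨F', hF', rfl⟩ := List.mem_map.1 (best_subset _ hc)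
  obtain ⟨h1, h2⟩ := List.mem_filter.1 hF'
  refine ⟨F', ?_, (hcheck F' (hsub F' h1)).1 h2, ?_⟩
  · rw [solve, ← hl]
    rcases best_eq l with h | ⟨c', -, h⟩
    · simp [h] at hc
    · rw [h, List.mem_singleton] at hc
      rw [h, ← hc]
      simp
  · rw [total_eq (hsub F' h1), total_eq (hsub F hF)] at hle
    exact hle.trans hF2

end Main

/-! ### The output of the subroutine -/

/-- The height of a value, as a binary tree. -/
def Data.depth : Data → ℕ
  | .pair x y => max x.depth y.depth + 1
  | _ => 0

theorem Data.depth_le_size (d : Data) : d.depth ≤ d.size := by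
  induction d with
  | pair x y hx hy => simp only [depth, size]; omega
  | _ => simp [depth]

theorem length_le_depth {β : Type} [Enc β] (l : List β) : l.length ≤ (enc l).depth := by
  induction l with
  | nil => simp
  | cons a l ih => simp only [enc_cons, Data.depth, List.length_cons]; omega

theorem Data.depth_ofProp_le (p : Prop) : (Data.ofProp p).depth ≤ 1 := by
  unfold Data.ofProp
  split <;> simp [depth]

theorem Prim.depth_apply_le (q : Prim) (x : Data) : (q.apply x).depth ≤ x.depth + 1 := by
  unfold Prim.apply
  split
  case h_17 => exact Nat.zero_le _
  all_goals first
    | exact Nat.le_succ _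
    | exact (Data.depth_ofProp_le _).trans (Nat.le_add_left _ _)
    | simp only [Data.depth]; omega

/-- A step increases the height of a value by at most one. -/
theorem Runs.depth_le {A : Code} {x y : Data} {t : ℕ} (h : Runs A x y t) :
    y.depth ≤ x.depth + t := by
  unfold Runs at h
  induction h with
  | prim q x => exact q.depth_apply_le x
  | pair => simp only [Data.depth]; omega
  | call h => exact h.elim
  | _ => omega

theorem Runs.pos {A : Code} {x y : Data} {t : ℕ} (h : Runs A x y t) : 1 ≤ t := by
  unfold Runs at h
  cases h <;> omega

theorem Runs.unique {A : Code} {x y y' : Data} {t t' : ℕ} (h : Runs A x y t)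
    (h' : Runs A x y' t') : y = y' ∧ t = t' :=
  Eval.unique (fun _ _ _ _ _ h => h.elim) h h'

theorem enc_list_injective {β : Type} [Enc β] (h : Function.Injective (enc : β → Data)) :
    Function.Injective (enc : List β → Data) := by
  intro l
  induction l with
  | nil => rintro (_ | ⟨a, l'⟩) h' <;> simp_all
  | cons a l ih =>
    rintro (_ | ⟨a', l'⟩) h'
    · simp at h'
    · simp only [enc_cons, Data.pair.injEq] at h'
      rw [h h'.1, ih h'.2]

theorem enc_pair_injective : Function.Injective (enc : ℕ × ℕ → Data) := by
  rintro ⟨a, b⟩ ⟨a', b'⟩ h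
  simpa using h

open Classical in
/-- The list of edges that the program `A` computes, if it computes one. -/
noncomputable def oracle (A : Code) (v : List ℕ) (e : List Ed) : List (ℕ × ℕ) :=
  if h : ∃ l : List (ℕ × ℕ), ∃ t, Runs A (enc (v, e)) (enc l) t then h.choose else []

theorem oracle_eq {A : Code} {v : List ℕ} {e : List Ed} {l : List (ℕ × ℕ)} {t : ℕ}
    (h : Runs A (enc (v, e)) (enc l) t) : oracle A v e = l := by
  have h' : ∃ l : List (ℕ × ℕ), ∃ t, Runs A (enc (v, e)) (enc l) t := ⟨l, t, h⟩
  rw [oracle, dif_pos h']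
  obtain ⟨t', ht'⟩ := h'.choose_spec
  exact enc_list_injective enc_pair_injective (Runs.unique ht' h).1

section
variable {α : ℝ} {A : Code} {G H : WGraph}

theorem IsTSPApprox.exists_runs (hA : IsTSPApprox α A) (hH : H.Connected) :
    ∃ t, Runs A (enc (VL H, EL H)) (enc (oracle A (VL H) (EL H))) t := by
  obtain ⟨_, t, F, hr, ⟨l, rfl, rfl⟩, -⟩ := hA H hH
  rw [encode_eq] at hr
  exact ⟨t, (oracle_eq (l := l) hr).symm ▸ hr⟩

theorem IsTSPApprox.goodOracle (hA : IsTSPApprox α A) (G : WGraph) :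
    GoodOracle α (oracle A) G := by
  intro H _ hH
  obtain ⟨_, t, F, hr, ⟨l, rfl, rfl⟩, h1, h2⟩ := hA H hH
  rw [encode_eq] at hr
  rw [oracle_eq (l := l) hr]
  exact ⟨h1, h2⟩

/-- A weighted graph has finitely many subgraphs, up to the irrelevant lengths of non-edges. -/
theorem finite_encode_subgraph (G : WGraph) :
    {x | ∃ H : WGraph, H.IsSubgraph G ∧ H.encode = x}.Finite := by
  let f : Finset ℕ × Finset (Sym2 ℕ) → Data := fun S => .pair (Data.ofVertices S.1)
    (Data.ofList ((((S.1.sort (· ≤ ·)).product (S.1.sort (· ≤ ·))).filter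
      fun q => q.1 < q.2 ∧ s(q.1, q.2) ∈ S.2).map fun q =>
        .pair (.atom q.1) (.pair (.atom q.2) (.num (G.len s(q.1, q.2))))))
  refine ((G.V.powerset ×ˢ G.E.powerset).finite_toSet.image f).subset ?_
  rintro _ ⟨H, ⟨hV, hE, hl⟩, rfl⟩
  refine ⟨(H.V, H.E), by simp [hV, hE], ?_⟩
  simp only [f, WGraph.encode]
  congr 2
  refine List.map_congr_left fun q hq => ?_
  rw [hl _ (mem_edgeList.1 (show q ∈ H.edgeList from hq)).2]

theorem le_maxTime {d : Data} {t : ℕ} (hH : H.IsSubgraph G) (hc : H.Connected)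
    (h : Runs A H.encode d t) : t ≤ maxTime A G := by
  refine le_csSup (Set.Finite.bddAbove ?_) ⟨H, d, hH, hc, h⟩
  refine ((finite_encode_subgraph G).biUnion (t := fun x => {t | ∃ d, Runs A x d t}) fun x _ =>
    Set.Subsingleton.finite ?_).subset ?_
  · rintro t ⟨d, h⟩ t' ⟨d', h'⟩
    exact (h.unique h').2
  · rintro t ⟨H, d, h1, -, h2⟩
    exact Set.mem_biUnion (show H.encode ∈ _ from ⟨H, h1, rfl⟩) ⟨d, h2⟩

theorem IsTSPApprox.maxTime_pos (hA : IsTSPApprox α A) (hV : G.V.Nonempty) : 1 ≤ maxTime A G := by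
  obtain ⟨s, hs⟩ := hV
  have hc := compGraph_connected (G := G) (List.nil_subset _) hs
  obtain ⟨t, ht⟩ := hA.exists_runs hc
  rw [← encode_eq] at ht
  exact (Runs.pos ht).trans (le_maxTime compGraph_isSubgraph hc ht)

/-- The length of the output of the subroutine is bounded by its running time and the height of
its input. -/
theorem IsTSPApprox.callable (hA : IsTSPApprox α A) {q : Machine} (hq : q.sub = Runs A)
    (hM : q.M = maxTime A G) {E : List Ed} (hE : E.Sublist (EL G)) {s : ℕ} (hs : s ∈ G.V) :
    Callable q ((enc (VL G, EL G)).size + 1) (oracle A) (compV (VL G) E s) (compE (VL G) E s) := by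
  have hc := compGraph_connected hE.subset hs
  rw [← VL_compGraph hE.subset, ← EL_compGraph hE]
  obtain ⟨t, ht⟩ := hA.exists_runs hc
  have htM : t ≤ q.M := by
    rw [hM]
    rw [← encode_eq] at ht
    exact le_maxTime compGraph_isSubgraph hc ht
  refine ⟨?_, t, htM, hq ▸ ht⟩
  have h1 := (length_le_depth _).trans ht.depth_le
  have h2 := Data.depth_le_size (enc (VL (compGraph G E s), EL (compGraph G E s)))
  have h3 : (enc (VL (compGraph G E s), EL (compGraph G E s))).size ≤ (enc (VL G, EL G)).size := by
    have hv : (VL (compGraph G E s)).Sublist (VL G) := by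
      rw [VL_compGraph hE.subset]
      exact List.filter_sublist
    have he : (EL (compGraph G E s)).Sublist (EL G) := by
      rw [EL_compGraph hE]
      exact List.filter_sublist.trans hE
    have := size_sublist_le hv
    have := size_sublist_le he
    simp only [enc_prod, Data.size]
    omega
  have h4 := Nat.le_mul_of_pos_right (enc (VL G, EL G)).size q.M_pos
  rw [add_mul, one_mul]
  omega

end

/-! ### The total running time -/

/-- The instances: an approximation algorithm for TSP, an accuracy parameter, and a weighted graph
with a feasible interface. They index the families of computations. -/
structure Problem where
  α : ℝ
  A : Code
  δ : ℝ
  G : WGraph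
  Φ : Interface G
  approx : IsTSPApprox α A
  δ_pos : 0 < δ
  feasible : Feasible G Φ

namespace Problem

theorem nonempty (i : Problem) : i.G.V.Nonempty :=
  let ⟨_, h⟩ := i.feasible
  feasible_nonempty h

/-- The interface vertices, as a list. -/
def lI (i : Problem) : List ℕ := i.Φ.I.sort (· ≤ ·)

/-- The vertices of odd degree, as a list. -/
def lT (i : Problem) : List ℕ := i.Φ.T.sort (· ≤ ·)

/-- The parts of the partition, as lists. -/
def lC (i : Problem) : List (List ℕ) := i.Φ.partList.map fun C => C.sort (· ≤ ·)

/-- The number of long edges that are guessed. -/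
noncomputable def edgeGuesses (i : Problem) : ℕ := (budget i.lI (EL i.G) i.δ).length

/-- The number of pairs of vertices of odd degree that are guessed. -/
noncomputable def pairGuesses (i : Problem) : ℕ := (pairBudget i.lT i.δ).length

/-- The exponent of the number of vertices in the bound for the number of all guesses. -/
noncomputable def exponent (i : Problem) : ℕ := 2 * (i.edgeGuesses + 1) + 3 * i.pairGuesses

theorem card_pos (i : Problem) : 1 ≤ i.G.V.card := i.nonempty.card_pos

/-- The TSP algorithm is the subroutine, and its maximum running time is the factor `M`. -/
noncomputable def machine (i : Problem) : Machine where
  sub := Runs i.A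
  B := i.G.V.card ^ i.exponent
  M := maxTime i.A i.G
  B_pos := Nat.one_le_pow _ _ i.card_pos
  M_pos := i.approx.maxTime_pos i.nonempty

theorem pow_le_B (i : Problem) {k : ℕ} (h : k ≤ i.exponent) : i.G.V.card ^ k ≤ i.machine.B :=
  Nat.pow_le_pow_right i.card_pos h

theorem card_le_B (i : Problem) : i.G.V.card ≤ i.machine.B := by
  simpa using i.pow_le_B (k := 1) (by unfold exponent; omega)

/-- There are fewer edges than pairs of vertices, since there are no loops. -/
theorem length_EL_lt (i : Problem) : (EL i.G).length < i.G.V.card ^ 2 := by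
  obtain ⟨v, hv⟩ := i.nonempty
  rw [EL, List.length_map, WGraph.edgeList, sq, ← Finset.length_sort (α := ℕ) (· ≤ ·),
    ← List.length_product]
  refine List.length_filter_lt_length_iff_exists.2 ⟨(v, v), ?_, by simp⟩
  exact List.mem_product.2 (by simpa using hv)

theorem length_EL_le_B (i : Problem) : (EL i.G).length ≤ i.machine.B :=
  i.length_EL_lt.le.trans (i.pow_le_B (by unfold exponent; omega))

theorem size_sort_le (i : Problem) {S : Finset ℕ} (hS : S ⊆ i.G.V) :
    (enc (S.sort (· ≤ ·))).size ≤ i.machine.B * 2 + 1 := by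
  have h1 := size_list_le (l := S.sort (· ≤ ·)) (s := 1) fun a _ => by simp [Data.size]
  have h2 := (Finset.card_le_card hS).trans i.card_le_B
  rw [Finset.length_sort] at h1
  omega

/-- The input of the program. -/
noncomputable def input (i : Problem) :
    (List ℕ × List Ed) × (List ℕ × List ℕ × List (List ℕ)) × ℝ :=
  ((VL i.G, EL i.G), (i.lI, i.lT, i.lC), i.δ)

theorem enc_input (i : Problem) : enc i.input = encodeInput i.G i.Φ i.δ := by
  rw [encodeInput, encode_eq]
  simp [input, Interface.encode, lI, lT, lC, Enc.enc, List.map_map, Function.comp_def,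
    funext fun S => Data.ofVertices.eq_1 S]

theorem bd_size_V : Bd machine fun i => (enc (VL i.G)).size :=
  ((Bd.B.mul (Bd.const 2)).add (Bd.const 1)).mono fun i => i.size_sort_le subset_rfl

theorem bd_size_E : Bd machine fun i => (enc (EL i.G)).size :=
  ((Bd.B.mul (Bd.const 6)).add (Bd.const 1)).mono fun i =>
    (size_list_le (s := 5) fun e _ => by simp [Data.size, size_prod]).trans
      (Nat.add_le_add_right (Nat.mul_le_mul_right _ i.length_EL_le_B) 1)

theorem bd_size_I : Bd machine fun i => (enc i.lI).size :=
  ((Bd.B.mul (Bd.const 2)).add (Bd.const 1)).mono fun i => i.size_sort_le i.Φ.I_subset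

theorem bd_size_T : Bd machine fun i => (enc i.lT).size :=
  ((Bd.B.mul (Bd.const 2)).add (Bd.const 1)).mono fun i =>
    i.size_sort_le (i.Φ.T_subset.trans i.Φ.I_subset)

theorem bd_size_C : Bd machine fun i => (enc i.lC).size := by
  refine ((Bd.B.mul (((Bd.B.mul (Bd.const 2)).add (Bd.const 1)).add (Bd.const 1))).add
    (Bd.const 1)).mono fun i => ?_
  refine (size_list_le (s := i.machine.B * 2 + 1) fun l hl => ?_).trans
    (Nat.add_le_add_right (Nat.mul_le_mul_right _ ?_) 1)
  · obtain ⟨C, hC, rfl⟩ := List.mem_map.1 hl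
    exact i.size_sort_le ((i.Φ.C.le (mem_partList.1 hC)).trans i.Φ.I_subset)
  · rw [lC, List.length_map, Interface.partList, List.length_map]
    refine (List.length_filter_le _ _).trans ?_
    rw [Finset.length_sort]
    exact (Finset.card_le_card i.Φ.I_subset).trans i.card_le_B

theorem bd_edgeGuesses : Bd machine fun i =>
    ((EL i.G).length + 1) ^ (budget i.lI (EL i.G) i.δ).length := by
  refine Bd.B.mono fun i => (Nat.pow_le_pow_left i.length_EL_lt _).trans ?_
  rw [← pow_mul]
  exact i.pow_le_B (by unfold exponent edgeGuesses; omega)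

theorem pairGuesses_le (i : Problem) : i.pairGuesses ≤ i.Φ.T.card := by
  rw [pairGuesses, pairBudget]
  split <;> simp [lT]

theorem bd_pairGuesses : Bd machine fun i =>
    ((pairsOf i.lT).length + 1) ^ (pairBudget i.lT i.δ).length := by
  refine Bd.B.mono fun i => ?_
  have hT := Finset.card_le_card (i.Φ.T_subset.trans i.Φ.I_subset)
  have hlen : (pairsOf i.lT).length = i.Φ.T.card * i.Φ.T.card := by
    simp [pairsOf, lT, List.length_flatMap]
  have hB : i.G.V.card ^ (3 * i.pairGuesses) ≤ i.machine.B :=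
    i.pow_le_B (by unfold exponent; omega)
  refine le_trans ?_ hB
  rw [hlen, pow_mul]
  rcases Nat.lt_or_ge i.G.V.card 2 with h | h
  · -- a set of even cardinality in a graph with one vertex is empty
    obtain ⟨k, hk⟩ := i.Φ.even_T
    have := i.pairGuesses_le
    have h0 : i.pairGuesses = 0 := by omega
    rw [h0, show (pairBudget i.lT i.δ).length = 0 from h0]
    simp
  · refine Nat.pow_le_pow_left ?_ _
    have h1 := Nat.mul_le_mul hT hT
    nlinarith

/-- One program solves all instances, in time polynomial in the number of guesses, times the
running time of the TSP algorithm. -/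
theorem comp_solve : Comp machine input fun i =>
    solve (oracle i.A) (VL i.G) (EL i.G) i.lI i.lT i.lC i.δ := by
  have hx := Ev.refl (p := machine) input
  refine Comp.solve (L := fun i => (enc (VL i.G, EL i.G)).size + 1) ⟨hx.fst.fst, bd_size_V⟩
    ⟨hx.fst.snd, bd_size_E⟩ ⟨hx.snd.fst.fst, bd_size_I⟩ ⟨hx.snd.fst.snd.fst, bd_size_T⟩
    ⟨hx.snd.fst.snd.snd, bd_size_C⟩ (Comp.of_real hx.snd.snd) ?_ (fun i E' hE s hs => ?_)
    bd_edgeGuesses bd_pairGuesses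
  · exact ((bd_size_V.add bd_size_E).add (Bd.const 1)).add (Bd.const 1)
  · exact i.approx.callable rfl rfl hE (by simpa [VL] using hs)

/-- The three terms are bounded by `2`, `16 |I| / δ` and `18 |I| / δ`. The last one uses that no
pairs are guessed unless `δ < 6`. -/
theorem exponent_le (i : Problem) : (i.exponent : ℝ) ≤ 34 * (1 + i.Φ.I.card / i.δ) := by
  have hδ := i.δ_pos
  have h1 : (i.edgeGuesses : ℝ) ≤ 8 * (i.Φ.I.card / i.δ) := by
    rw [← mul_div_assoc, le_div_iff₀ hδ]
    have := (budget_spec i.lI (EL i.G) (δ := i.δ)).2.1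
    rwa [lI, Finset.length_sort] at this
  have h0 : (0 : ℝ) ≤ i.Φ.I.card / i.δ := by positivity
  have h2 : (i.pairGuesses : ℝ) ≤ 6 * (i.Φ.I.card / i.δ) := by
    by_cases h6 : 6 ≤ i.δ
    · have : i.pairGuesses = 0 := by
        rw [pairGuesses, pairBudget, if_pos (by simpa using h6), List.length_nil]
      rw [this]
      simpa using h0
    · have h3 : (i.pairGuesses : ℝ) ≤ i.Φ.I.card := by
        exact_mod_cast i.pairGuesses_le.trans (Finset.card_le_card i.Φ.T_subset)
      rw [← mul_div_assoc, le_div_iff₀ hδ]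
      nlinarith [(Nat.cast_nonneg i.Φ.I.card : (0 : ℝ) ≤ _)]
  unfold exponent
  push_cast
  linarith

theorem exists_shortest_phiTour (i : Problem) : ∃ F, i.G.IsShortest (IsPhiTour i.G i.Φ) F := by
  refine exists_shortest (fun F hF => hF.1.1) (fun F hF => ?_) i.feasible
  have hr : i.G.IsEdgeMultiset (red F) := fun e he => hF.1.1 e (mem_red.1 he)
  rw [isPhiTour_iff i.nonempty hr]
  simpa only [deg_red, gr_red] using (isPhiTour_iff i.nonempty hF.1.1).1 hF

theorem exists_shortest_tJoin (i : Problem) : ∃ F, i.G.IsShortest (i.G.IsTJoin i.Φ.T) F := by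
  have hT := i.Φ.T_subset.trans i.Φ.I_subset
  refine exists_shortest (fun F hF => hF.1) (fun F hF => ⟨fun e he => hF.1 e (mem_red.1 he), ?_⟩)
    (i.feasible.imp fun _ h => h.1)
  rw [odd_eq_iff hT]
  simpa only [deg_red] using (odd_eq_iff hT).1 hF.2

end Problem
end PhiTSP

theorem mainTheorem9 :
    ∃ (P : PhiTSP.Code) (c : ℝ), 0 < c ∧
      ∀ (α : ℝ), 1 < α → ∀ A : PhiTSP.Code, PhiTSP.IsTSPApprox α A →
      ∀ (δ : ℝ), 0 < δ → ∀ (G : PhiTSP.WGraph) (Φ : PhiTSP.Interface G), PhiTSP.Feasible G Φ →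
      ∃ OPT J : Multiset (Sym2 ℕ),
        G.IsShortest (PhiTSP.IsPhiTour G Φ) OPT ∧ G.IsShortest (G.IsTJoin Φ.T) J ∧
        ∃ (d : PhiTSP.Data) (t : ℕ) (F : Multiset (Sym2 ℕ)),
          PhiTSP.RunsWith A P (PhiTSP.encodeInput G Φ δ) d t ∧
          PhiTSP.Represents d F ∧ PhiTSP.IsPhiTour G Φ F ∧
          G.length F ≤ (1 + δ) * α * G.length OPT + (α + 1) * G.length J ∧
          (t : ℝ) ≤ c * (G.V.card : ℝ) ^ (c * (1 + (Φ.I.card : ℝ) / δ)) *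
            (PhiTSP.maxTime A G : ℝ) := by
  obtain ⟨P, τ, ⟨C, hC⟩, hP⟩ := PhiTSP.Problem.comp_solve.ev
  refine ⟨P, 34 * C + 1, by positivity, fun α hα A hA δ hδ G Φ hΦ => ?_⟩
  let i : PhiTSP.Problem := ⟨α, A, δ, G, Φ, hA, hδ, hΦ⟩
  obtain ⟨OPT, hOPT⟩ := i.exists_shortest_phiTour
  obtain ⟨J, hJ⟩ := i.exists_shortest_tJoin
  obtain ⟨F, h1, h2, h3⟩ := PhiTSP.solve_spec (hA.goodOracle G) hα hδ hOPT.1 hJ.1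
  obtain ⟨t, ht, hrun⟩ := hP i
  refine ⟨OPT, J, hOPT, hJ, _, t, PhiTSP.ms F, i.enc_input ▸ hrun, ⟨_, rfl, ?_⟩, h2, h3, ?_⟩
  · have h4 : PhiTSP.solve (PhiTSP.oracle i.A) (PhiTSP.VL i.G) (PhiTSP.EL i.G) i.lI i.lT i.lC i.δ =
        F.map fun e => (e.1, e.2.1) := h1
    simp only [h4, PhiTSP.ms, List.map_map]
    rfl
  · -- `C` is the degree of the polynomial in `B`, a power of `|V|` with exponent `i.exponent`
    have hn : (1 : ℝ) ≤ G.V.card := by exact_mod_cast i.card_pos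
    have h0 : (0 : ℝ) ≤ Φ.I.card / δ := by positivity
    have h4 : (t : ℝ) ≤ C * ((G.V.card : ℝ) ^ i.exponent) ^ C * PhiTSP.maxTime A G := by
      exact_mod_cast ht.trans (Nat.mul_le_mul_right _ (hC i))
    refine h4.trans (mul_le_mul_of_nonneg_right ?_ (Nat.cast_nonneg _))
    refine mul_le_mul (by linarith [(Nat.cast_nonneg C : (0 : ℝ) ≤ C)]) ?_ (by positivity)
      (by positivity)
    rw [← pow_mul, ← Real.rpow_natCast]
    refine Real.rpow_le_rpow_of_exponent_le hn ?_
    push_cast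
    have h5 := mul_le_mul_of_nonneg_right i.exponent_le (Nat.cast_nonneg C : (0 : ℝ) ≤ C)
    have h6 : (i.exponent : ℝ) * C ≤ 34 * (1 + Φ.I.card / δ) * C := h5
    linarith
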